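/- Let $\mathcal G$ be a locally compact Hausdorff groupoid with unit space $X=\mathcal G^{(0)}$, range and source maps $r,s$, and a left Haar system $(\lambda^x)_{x\in X}$. Let $\|\cdot\|_{\mathcal A}$ be an unconditional norm on $C_c(\mathcal G)$, i.e. a submultiplicative norm for the convolution product such that $|f_1|\le |f_2|$ pointwise implies $\|f_1\|_{\mathcal A}\le\|f_2\|_{\mathcal A}$; for a bounded function $\varphi\ge 0$ with compact support put $\|\varphi\|_{\mathcal A}=\inf\{\|\psi\|_{\mathcal A}:\psi\in C_c(\mathcal G),\ \psi\ge\varphi\}$. Let $B$ be a $\mathcal G$-Banach algebra, i.e. an upper semi-continuous field $(B_x)_{x\in X}$ of complex Banach algebras over $X$ together with a continuous action $\gamma\colon B_{s(\gamma)}\to B_{r(\gamma)}$ $(\gamma\in\mathcal G)$ by isometric algebra isomorphisms. Assume that $B$ is non-degenerate, i.e. that the linear span of $B_xB_x$ is dense in $B_x$ for every $x$. Let $\mathcal A(\mathcal G,B)$ be the Hausdorff completion of the space $\Gamma_c(\mathcal G,r^*B)$ of compactly supported sections for the seminorm $\|\xi\|=\big\|\gamma\mapsto\|\xi(\gamma)\|\big\|_{\mathcal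 A}$; the convolution product $$(\xi_1*\xi_2)(\gamma')=\int_{\mathcal G^{r(\gamma')}}\xi_1(\gamma)\,\gamma\big(\xi_2(\gamma^{-1}\gamma')\big)\,d\lambda^{r(\gamma')}(\gamma)$$ extends to it (uniquely) and makes it a Banach algebra. Let $U\subseteq X$ be open, closed and full, where full means that every element of $\mathcal G$ is a product $\gamma_1\gamma_2$ with $s(\gamma_1)=r(\gamma_2)\in U$. Let $\mathcal G_U^U=\{\gamma: r(\gamma),s(\gamma)\in U\}$ carry the inherited Haar system, let $B|_U$ be the restricted $\mathcal G_U^U$-Banach algebra, and let $\mathcal A(\mathcal G_U^U,B|_U)$ be the Banach algebra formed with the restriction of $\|\cdot\|_{\mathcal A}$ to $C_c(\mathcal G_U^U)\subseteq C_c(\mathcal G)$. Extension of sections by zero induces an isometric algebra homomorphism $\mathcal A(\mathcal G_U^U,B|_U)\to\mathcal A(\mathcal G,B)$, by which we regard $\mathcal A(\mathcal G_U^U,B|_U)$ as a closed subalgebra of $\mathcal A(\mathcal G,B)$. Then there is an idempotent $P$ in the multiplier algebra of $\mathcal A(\mathcal G,B)$ such that $$P\,\mathcal A(\mathcal G,B)\,P=\mathcal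 A(\mathcal G_U^U,B|_U)$$ and such that the linear span of $\mathcal A(\mathcal G,B)\,P\,\mathcal A(\mathcal G,B)$ is dense in $\mathcal A(\mathcal G,B)$; that is, $\mathcal A(\mathcal G_U^U,B|_U)$ is a full corner in $\mathcal A(\mathcal G,B)$. In particular, the Banach algebras $\mathcal A(\mathcal G_U^U,B|_U)$ and $\mathcal A(\mathcal G,B)$ are Morita equivalent in the sense of Lafforgue: there are Banach spaces $E^<,E^>$ such that $\begin{pmatrix}\mathcal A(\mathcal G_U^U,B|_U)&E^>\\E^<&\mathcal A(\mathcal G,B)\end{pmatrix}$ carries an associative matrix multiplication in which all products of entries are bilinear and bounded by one, and in which those products that involve an entry from $E^<$ or $E^>$ have dense linear span in their target. -/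

import Mathlib

open CategoryTheory MeasureTheory Topology Filter
open scoped MultiplierAlgebra CompactlySupported

set_option linter.unusedSectionVars false

universe u v w

namespace GroupoidDescent

/-! ### Locally compact groupoids

A groupoid with set of objects `X` is a Mathlib `Groupoid X`; an element `γ` with source `x` and
range `y` is a morphism `γ : x ⟶ y`, and the product `γ γ'` (first `γ'`, then `γ`) is `γ' ≫ γ`. -/

/-- The set `𝒢` of all elements of the groupoid (with arbitrary source and range). -/
structure Arr (X : Type u) [Groupoid.{v} X] where
  src : X
  tgt : X
  hom : src ⟶ tgt

/-- The set `𝒢^y` of all elements of the groupoid with range `y`. -/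
structure RangeFibre {X : Type u} [Groupoid.{v} X] (y : X) where
  src : X
  hom : src ⟶ y

/-- The set of composable pairs. -/
structure ComposablePair (X : Type u) [Groupoid.{v} X] where
  x : X
  y : X
  z : X
  first : x ⟶ y
  second : y ⟶ z

section Basic

variable {X : Type u} [Groupoid.{v} X]

/-- An element of `𝒢^y`, regarded as an element of `𝒢`. -/
abbrev RangeFibre.toArr {y : X} (g : RangeFibre y) : Arr X := ⟨g.src, y, g.hom⟩

/-- A composable pair, regarded as an element of `𝒢 × 𝒢`. -/
def ComposablePair.toProd (p : ComposablePair X) : Arr X × Arr X :=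
  (⟨p.x, p.y, p.first⟩, ⟨p.y, p.z, p.second⟩)

/-- The composition map. -/
def ComposablePair.comp (p : ComposablePair X) : Arr X := ⟨p.x, p.z, p.first ≫ p.second⟩

/-- `𝒢^y` carries the subspace topology. -/
instance [TopologicalSpace (Arr X)] (y : X) : TopologicalSpace (RangeFibre y) :=
  TopologicalSpace.induced RangeFibre.toArr inferInstance

instance [TopologicalSpace (Arr X)] (y : X) : MeasurableSpace (RangeFibre y) := borel _

instance [TopologicalSpace (Arr X)] (y : X) : BorelSpace (RangeFibre y) := ⟨rfl⟩

/-- The set of composable pairs carries the subspace topology of `𝒢 × 𝒢`. -/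
instance [TopologicalSpace (Arr X)] : TopologicalSpace (ComposablePair X) :=
  TopologicalSpace.induced ComposablePair.toProd inferInstance

end Basic

/-- Topological groupoids: given topologies on `𝒢` and on its unit space `X`, all structure maps
are continuous. -/
class TopologicalGroupoid (X : Type u) [Groupoid.{v} X] [TopologicalSpace X]
    [TopologicalSpace (Arr X)] : Prop where
  continuous_src : Continuous (Arr.src : Arr X → X)
  continuous_tgt : Continuous (Arr.tgt : Arr X → X)
  continuous_unit : Continuous (fun x : X => (⟨x, x, 𝟙 x⟩ : Arr X))
  continuous_inv : Continuous (fun γ : Arr X => (⟨γ.tgt, γ.src, Groupoid.inv γ.hom⟩ : Arr X))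
  continuous_comp : Continuous (ComposablePair.comp : ComposablePair X → Arr X)

/-- A left Haar system: a faithful continuous left invariant family of Radon measures `λ^x` on the
fibres `𝒢^x`. (The function in `continuous_integral` automatically has compact support.) -/
structure HaarSystem (X : Type u) [Groupoid.{v} X] [TopologicalSpace X]
    [TopologicalSpace (Arr X)] where
  measure : ∀ x : X, Measure (RangeFibre x)
  regular : ∀ x, (measure x).Regular
  faithful : ∀ x, (measure x).IsOpenPosMeasure
  continuous_integral : ∀ f : C_c(Arr X, ℂ),
    Continuous fun x => ∫ g : RangeFibre x, f g.toArr ∂(measure x)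
  invariant : ∀ {x y : X} (γ : x ⟶ y) (f : C_c(Arr X, ℂ)),
    ∫ g : RangeFibre y, f g.toArr ∂(measure y) =
      ∫ g : RangeFibre x, f ⟨g.src, y, g.hom ≫ γ⟩ ∂(measure x)

/-- The convolution product of scalar functions on `𝒢`:
`(f * g) (γ') = ∫_{γ ∈ 𝒢^{r(γ')}} f(γ) g(γ⁻¹ γ') dλ^{r(γ')}(γ)`. -/
noncomputable def scalarConvolution {X : Type u} [Groupoid.{v} X] [TopologicalSpace X]
    [TopologicalSpace (Arr X)] (haar : HaarSystem X) (f g : Arr X → ℂ) (γ' : Arr X) : ℂ :=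
  ∫ γ : RangeFibre γ'.tgt,
    f γ.toArr * g ⟨γ'.src, γ.src, γ'.hom ≫ Groupoid.inv γ.hom⟩ ∂(haar.measure γ'.tgt)

/-- An unconditional norm on `C_c(𝒢)`: an algebra norm for the convolution product that is monotone
in the absolute value. The completion of `C_c(𝒢)` for such a norm is an unconditional completion
`𝒜(𝒢)`, and each unconditional completion arises in this way from the restriction of its norm to
`C_c(𝒢)`. -/
structure UnconditionalNorm {X : Type u} [Groupoid.{v} X] [TopologicalSpace X]
    [TopologicalSpace (Arr X)] (haar : HaarSystem X) where
  norm : Seminorm ℂ C_c(Arr X, ℂ)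
  eq_zero : ∀ f, norm f = 0 → f = 0
  submultiplicative : ∀ f g h : C_c(Arr X, ℂ),
    (∀ γ, h γ = scalarConvolution haar f g γ) → norm h ≤ norm f * norm g
  unconditional : ∀ f g : C_c(Arr X, ℂ), (∀ γ, ‖f γ‖ ≤ ‖g γ‖) → norm f ≤ norm g

/-- The extension of an unconditional norm to non-negative (locally bounded, compactly supported)
functions `φ`: the infimum of the norms of all `ψ ∈ C_c(𝒢)` with `ψ ≥ φ`. -/
noncomputable def UnconditionalNorm.extended {X : Type u} [Groupoid.{v} X] [TopologicalSpace X]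
    [TopologicalSpace (Arr X)] {haar : HaarSystem X} (N : UnconditionalNorm haar)
    (φ : Arr X → ℝ) : ℝ :=
  sInf {t : ℝ | ∃ ψ : C_c(Arr X, ℂ), (∀ γ, (ψ γ).im = 0 ∧ φ γ ≤ (ψ γ).re) ∧ N.norm ψ = t}

theorem UnconditionalNorm.extended_le {X : Type u} [Groupoid.{v} X] [TopologicalSpace X]
    [TopologicalSpace (Arr X)] {haar : HaarSystem X} (N : UnconditionalNorm haar) {φ : Arr X → ℝ}
    {ψ : C_c(Arr X, ℂ)} (h : ∀ γ, (ψ γ).im = 0 ∧ φ γ ≤ (ψ γ).re) : N.extended φ ≤ N.norm ψ :=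
  csInf_le ⟨0, by rintro t ⟨ψ, -, rfl⟩; exact apply_nonneg _ _⟩ ⟨ψ, h, rfl⟩

/-! ### Fields of Banach spaces and `𝒢`-Banach algebras -/

/-- An upper semi-continuous field of Banach spaces over `X` with fibres `E x`. -/
structure UscField (X : Type*) [TopologicalSpace X] (E : X → Type*)
    [∀ x, NormedAddCommGroup (E x)] [∀ x, NormedSpace ℂ (E x)] [∀ x, CompleteSpace (E x)] where
  sections : Submodule ℂ (∀ x, E x)
  dense_eval : ∀ x, Dense {e : E x | ∃ ξ ∈ sections, ξ x = e}
  upperSemicontinuous_norm : ∀ ξ ∈ sections, UpperSemicontinuous fun x => ‖ξ x‖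
  mem_of_local : ∀ ξ : (∀ x, E x),
    (∀ x₀ : X, ∀ ε > (0 : ℝ), ∃ η ∈ sections, ∀ᶠ x in 𝓝 x₀, ‖ξ x - η x‖ ≤ ε) → ξ ∈ sections

section Pullback

variable {X : Type*} [TopologicalSpace X] {E : X → Type*} [∀ x, NormedAddCommGroup (E x)]
  [∀ x, NormedSpace ℂ (E x)] [∀ x, CompleteSpace (E x)]

/-- The sections of the pullback `p^*E`: all `ζ` that are locally approximable by `ξ ∘ p` with
`ξ` a section of `E`. -/
def UscField.pullbackSections (F : UscField X E) {Y : Type*} [TopologicalSpace Y] (p : Y → X) :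
    Submodule ℂ (∀ y, E (p y)) where
  carrier := {ζ | ∀ y₀ : Y, ∀ ε > (0 : ℝ), ∃ ξ ∈ F.sections,
    ∀ᶠ y in 𝓝 y₀, ‖ζ y - ξ (p y)‖ ≤ ε}
  zero_mem' := by
    intro y₀ ε hε
    exact ⟨0, F.sections.zero_mem, Eventually.of_forall fun y => by simp [hε.le]⟩
  add_mem' := by
    intro a b ha hb y₀ ε hε
    obtain ⟨ξ, hξ, h1⟩ := ha y₀ (ε / 2) (by positivity)
    obtain ⟨η, hη, h2⟩ := hb y₀ (ε / 2) (by positivity)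
    refine ⟨ξ + η, F.sections.add_mem hξ hη, ?_⟩
    filter_upwards [h1, h2] with y h1 h2
    have : (a + b) y - (ξ + η) (p y) = (a y - ξ (p y)) + (b y - η (p y)) := by
      simp only [Pi.add_apply]; abel
    rw [this]
    exact (norm_add_le _ _).trans (by linarith)
  smul_mem' := by
    intro c a ha y₀ ε hε
    obtain ⟨ξ, hξ, h1⟩ := ha y₀ (ε / (‖c‖ + 1)) (by positivity)
    refine ⟨c • ξ, F.sections.smul_mem c hξ, ?_⟩
    filter_upwards [h1] with y h1
    have : (c • a) y - (c • ξ) (p y) = c • (a y - ξ (p y)) := by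
      simp only [Pi.smul_apply, smul_sub]
    rw [this, norm_smul]
    have h2 : (‖c‖ + 1) * ‖a y - ξ (p y)‖ ≤ ε := by
      rw [mul_comm]; exact (le_div_iff₀ (by positivity)).1 h1
    nlinarith [norm_nonneg (a y - ξ (p y))]

/-- The pullback `p^*E` of a field along a continuous map `p`. -/
def UscField.pullback (F : UscField X E) {Y : Type*} [TopologicalSpace Y] (p : Y → X)
    (hp : Continuous p) : UscField Y (fun y => E (p y)) where
  sections := F.pullbackSections p
  dense_eval := by
    intro y
    refine (F.dense_eval (p y)).mono ?_
    rintro e ⟨ξ, hξ, rfl⟩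
    exact ⟨fun y => ξ (p y), fun y₀ ε hε => ⟨ξ, hξ, Eventually.of_forall fun y => by
      simp [hε.le]⟩, rfl⟩
  upperSemicontinuous_norm := by
    intro ζ hζ y₀ t ht
    have hε : (0 : ℝ) < (t - ‖ζ y₀‖) / 3 := by linarith
    obtain ⟨ξ, hξ, h1⟩ := hζ y₀ _ hε
    have h0 := h1.self_of_nhds
    have h2 : ‖ξ (p y₀)‖ < ‖ζ y₀‖ + 2 * ((t - ‖ζ y₀‖) / 3) := by
      have := norm_sub_norm_le (ξ (p y₀)) (ζ y₀)
      rw [norm_sub_rev] at this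
      linarith
    have h3 := (hp.tendsto y₀).eventually (F.upperSemicontinuous_norm ξ hξ (p y₀) _ h2)
    filter_upwards [h1, h3] with y h1 h3
    have := norm_sub_norm_le (ζ y) (ξ (p y))
    linarith
  mem_of_local := by
    intro ζ hζ y₀ ε hε
    obtain ⟨η, hη, h1⟩ := hζ y₀ (ε / 2) (by positivity)
    obtain ⟨ξ, hξ, h2⟩ := hη y₀ (ε / 2) (by positivity)
    refine ⟨ξ, hξ, ?_⟩
    filter_upwards [h1, h2] with y h1 h2
    have := norm_sub_le_norm_sub_add_norm_sub (ζ y) (η y) (ξ (p y))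
    linarith

end Pullback

/-- A `𝒢`-Banach algebra with fibres `B x`: an upper semi-continuous field of Banach algebras over
the unit space with an action `α : s^*B → r^*B` of `𝒢` by isometric algebra isomorphisms. Continuity
of `α⁻¹` and `α_{γ⁻¹} = α_γ⁻¹` are automatic. -/
structure GBanachAlgebra (X : Type u) [Groupoid.{v} X] [TopologicalSpace X]
    [TopologicalSpace (Arr X)] (B : X → Type w)
    [∀ x, NonUnitalNormedRing (B x)] [∀ x, NormedSpace ℂ (B x)]
    [∀ x, IsScalarTower ℂ (B x) (B x)] [∀ x, SMulCommClass ℂ (B x) (B x)]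
    [∀ x, CompleteSpace (B x)] extends UscField X B where
  mul_mem : ∀ ξ ∈ sections, ∀ η ∈ sections, (fun x => ξ x * η x) ∈ sections
  act : ∀ {x y : X}, (x ⟶ y) → (B x ≃ₗᵢ[ℂ] B y)
  act_id : ∀ (x : X) (b : B x), act (𝟙 x) b = b
  act_comp : ∀ {x y z : X} (γ' : x ⟶ y) (γ : y ⟶ z) (b : B x), act (γ' ≫ γ) b = act γ (act γ' b)
  act_mul : ∀ {x y : X} (γ : x ⟶ y) (a b : B x), act γ (a * b) = act γ a * act γ b
  act_continuous : ∀ ζ ∈ toUscField.pullbackSections (Arr.src : Arr X → X),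
    (fun γ : Arr X => act γ.hom (ζ γ)) ∈ toUscField.pullbackSections (Arr.tgt : Arr X → X)

/-- Non-degeneracy: in each fibre the products span a dense subspace. -/
def GBanachAlgebra.NonDegenerate {X : Type u} [Groupoid.{v} X] [TopologicalSpace X]
    [TopologicalSpace (Arr X)] {B : X → Type w}
    [∀ x, NonUnitalNormedRing (B x)] [∀ x, NormedSpace ℂ (B x)]
    [∀ x, IsScalarTower ℂ (B x) (B x)] [∀ x, SMulCommClass ℂ (B x) (B x)]
    [∀ x, CompleteSpace (B x)] (_β : GBanachAlgebra X B) : Prop :=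
  ∀ x : X, Dense (Submodule.span ℂ {c : B x | ∃ a b : B x, a * b = c} : Set (B x))

/-! ### The Banach space `𝒜(𝒢, B)` and its convolution product -/

section Descent

variable {X : Type u} [Groupoid.{v} X] [TopologicalSpace X] [TopologicalSpace (Arr X)]
  {haar : HaarSystem X} {B : X → Type w}
  [∀ x, NonUnitalNormedRing (B x)] [∀ x, NormedSpace ℂ (B x)]
  [∀ x, IsScalarTower ℂ (B x) (B x)] [∀ x, SMulCommClass ℂ (B x) (B x)]
  [∀ x, CompleteSpace (B x)]

/-- The space `Γ_c(𝒢, r^*B)` of compactly supported sections of `r^*B`. -/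
def GBanachAlgebra.compactSections (β : GBanachAlgebra X B) :
    Submodule ℂ (∀ γ : Arr X, B γ.tgt) where
  carrier := {ξ | ξ ∈ β.toUscField.pullbackSections (Arr.tgt : Arr X → X) ∧
    HasCompactSupport fun γ => ‖ξ γ‖}
  zero_mem' := ⟨Submodule.zero_mem _, by
    simpa using! (HasCompactSupport.zero : HasCompactSupport (0 : Arr X → ℝ))⟩
  add_mem' := by
    rintro a b ⟨ha, ha'⟩ ⟨hb, hb'⟩
    refine ⟨Submodule.add_mem _ ha hb, ?_⟩
    refine (ha'.add hb').mono ?_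
    intro γ hγ h
    apply hγ
    have h' : ‖a γ‖ + ‖b γ‖ = 0 := h
    have := norm_add_le (a γ) (b γ)
    exact le_antisymm (this.trans h'.le) (norm_nonneg _)
  smul_mem' := by
    rintro c a ⟨ha, ha'⟩
    refine ⟨Submodule.smul_mem _ c ha, ?_⟩
    refine ha'.mono ?_
    intro γ hγ h
    apply hγ
    have h' : ‖a γ‖ = 0 := h
    simp [norm_smul, h']

variable [TopologicalGroupoid X] [T2Space (Arr X)] [LocallyCompactSpace (Arr X)]

/-- The space `Γ_c(𝒢, r^*B)`, as a type that remembers the unconditional norm. -/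
def CompactSections (β : GBanachAlgebra X B) (_N : UnconditionalNorm haar) : Type (max u v w) :=
  β.compactSections

variable (β : GBanachAlgebra X B) (N : UnconditionalNorm haar)

noncomputable instance : AddCommGroup (CompactSections β N) :=
  inferInstanceAs (AddCommGroup β.compactSections)

noncomputable instance : Module ℂ (CompactSections β N) :=
  inferInstanceAs (Module ℂ β.compactSections)

/-- The value of a section at an element of the groupoid. -/
def CompactSections.val {β : GBanachAlgebra X B} {N : UnconditionalNorm haar}
    (ξ : CompactSections β N) (γ : Arr X) : B γ.tgt := Subtype.val ξ γ

theorem CompactSections.exists_dominating {β : GBanachAlgebra X B} {N : UnconditionalNorm haar}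
    (ξ : CompactSections β N) :
    ∃ ψ : C_c(Arr X, ℂ), ∀ γ, (ψ γ).im = 0 ∧ ‖ξ.val γ‖ ≤ (ψ γ).re := by
  have husc : UpperSemicontinuous fun γ => ‖ξ.val γ‖ :=
    (β.toUscField.pullback (Arr.tgt : Arr X → X)
      TopologicalGroupoid.continuous_tgt).upperSemicontinuous_norm _ ξ.2.1
  have hK : IsCompact (tsupport fun γ => ‖ξ.val γ‖) := ξ.2.2
  obtain ⟨M, hM⟩ := (husc.upperSemicontinuousOn _).bddAbove_of_isCompact hK
  obtain ⟨f, hf1, -, hf2, hf3⟩ := exists_continuous_one_zero_of_isCompact hK isClosed_empty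
    (Set.disjoint_empty _)
  refine ⟨⟨⟨fun γ => ((max M 0 * f γ : ℝ) : ℂ), by fun_prop⟩, ?_⟩, ?_⟩
  · refine hf2.mono ?_
    intro γ hγ h
    apply hγ
    have h' : f γ = 0 := h
    simp [h']
  · intro γ
    refine ⟨Complex.ofReal_im _, ?_⟩
    change _ ≤ (((max M 0 * f γ : ℝ) : ℂ)).re
    rw [Complex.ofReal_re]
    by_cases hγ : γ ∈ tsupport fun γ => ‖ξ.val γ‖
    · have h1 : f γ = 1 := hf1 hγ
      rw [h1, mul_one]
      exact (hM ⟨γ, hγ, rfl⟩).trans (le_max_left _ _)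
    · have h0 : ‖ξ.val γ‖ = 0 :=
        image_eq_zero_of_notMem_tsupport (f := fun γ => ‖ξ.val γ‖) hγ
      rw [h0]
      exact mul_nonneg (le_max_right _ _) (hf3 γ).1

/-- The seminorm `‖ξ‖ = ‖γ ↦ ‖ξ(γ)‖‖` on `Γ_c(𝒢, r^*B)`. -/
noncomputable instance : Norm (CompactSections β N) := ⟨fun ξ => N.extended fun γ => ‖ξ.val γ‖⟩

theorem CompactSections.le_norm {β : GBanachAlgebra X B} {N : UnconditionalNorm haar}
    (ξ : CompactSections β N) (c : ℝ)
    (h : ∀ ψ : C_c(Arr X, ℂ), (∀ γ, (ψ γ).im = 0 ∧ ‖ξ.val γ‖ ≤ (ψ γ).re) → c ≤ N.norm ψ) :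
    c ≤ ‖ξ‖ := by
  obtain ⟨ψ, hψ⟩ := ξ.exists_dominating
  refine le_csInf ⟨_, ψ, hψ, rfl⟩ ?_
  rintro t ⟨ψ, hψ, rfl⟩
  exact h ψ hψ

theorem CompactSections.core : SeminormedSpace.Core ℂ (CompactSections β N) where
  norm_nonneg ξ := ξ.le_norm 0 fun ψ _ => apply_nonneg _ _
  norm_smul c ξ := by
    have key : ∀ (c : ℂ) (ξ : CompactSections β N), ‖c • ξ‖ ≤ ‖c‖ * ‖ξ‖ := by
      intro c ξ
      rcases eq_or_ne c 0 with rfl | hc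
      · have : ‖(0 : ℂ) • ξ‖ ≤ N.norm 0 := N.extended_le fun γ => ⟨rfl, by
          change ‖((0 : ℂ) • ξ).1 γ‖ ≤ 0
          rw [zero_smul]
          exact norm_zero.le⟩
        simpa using this
      · have hpos : 0 < ‖c‖ := norm_pos_iff.2 hc
        rw [← div_le_iff₀' hpos]
        refine ξ.le_norm _ fun ψ hψ => ?_
        rw [div_le_iff₀' hpos]
        have : ‖c • ξ‖ ≤ N.norm ((‖c‖ : ℂ) • ψ) := N.extended_le fun γ => by
          have h2 : ‖(c • ξ).val γ‖ = ‖c‖ * ‖ξ.val γ‖ := norm_smul c (ξ.val γ)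
          rw [h2]
          simp only [CompactlySupportedContinuousMap.coe_smul, Pi.smul_apply, smul_eq_mul,
            Complex.im_ofReal_mul, Complex.re_ofReal_mul]
          exact ⟨by rw [(hψ γ).1, mul_zero],
            mul_le_mul_of_nonneg_left (hψ γ).2 (norm_nonneg _)⟩
        rwa [map_smul_eq_mul, Complex.norm_real, norm_norm] at this
    refine le_antisymm (key c ξ) ?_
    rcases eq_or_ne c 0 with rfl | hc
    · rw [norm_zero, zero_mul]
      exact ((0 : ℂ) • ξ).le_norm 0 fun ψ _ => apply_nonneg _ _
    · have h := key c⁻¹ (c • ξ)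
      rw [smul_smul, inv_mul_cancel₀ hc, one_smul, norm_inv] at h
      have hpos : 0 < ‖c‖ := norm_pos_iff.2 hc
      rwa [inv_mul_eq_div, le_div_iff₀' hpos] at h
  norm_triangle ξ η := by
    have h1 : ‖ξ + η‖ - ‖ξ‖ ≤ ‖η‖ := η.le_norm _ fun ψ₂ h₂ => by
      have h3 : ‖ξ + η‖ - N.norm ψ₂ ≤ ‖ξ‖ := ξ.le_norm _ fun ψ₁ h₁ => by
        have h4 : ‖ξ + η‖ ≤ N.norm (ψ₁ + ψ₂) := N.extended_le fun γ => by
          simp only [CompactlySupportedContinuousMap.coe_add, Pi.add_apply, Complex.add_im,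
            Complex.add_re]
          refine ⟨by rw [(h₁ γ).1, (h₂ γ).1, add_zero], ?_⟩
          exact (norm_add_le (ξ.val γ) (η.val γ)).trans (add_le_add (h₁ γ).2 (h₂ γ).2)
        have := map_add_le_add N.norm ψ₁ ψ₂
        linarith
      linarith
    linarith

noncomputable instance : SeminormedAddCommGroup (CompactSections β N) :=
  SeminormedAddCommGroup.ofCore (CompactSections.core β N)

noncomputable instance : NormedSpace ℂ (CompactSections β N) where
  norm_smul_le c ξ := ((CompactSections.core β N).norm_smul c ξ).le

/-- The Banach space `𝒜(𝒢, B)`: the Hausdorff completion of `Γ_c(𝒢, r^*B)`. -/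
abbrev Descent : Type (max u v w) := UniformSpace.Completion (CompactSections β N)

/-- The convolution product of sections,
`(ξ * η) (γ') = ∫_{γ ∈ 𝒢^{r(γ')}} ξ(γ) γ(η(γ⁻¹ γ')) dλ^{r(γ')}(γ)`. -/
noncomputable def convolution {β : GBanachAlgebra X B} {N : UnconditionalNorm haar}
    (ξ η : CompactSections β N) (γ' : Arr X) : B γ'.tgt :=
  ∫ γ : RangeFibre γ'.tgt,
    ξ.val γ.toArr * β.act γ.hom (η.val ⟨γ'.src, γ.src, γ'.hom ≫ Groupoid.inv γ.hom⟩)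
      ∂(haar.measure γ'.tgt)

/-- A Banach algebra product on `𝒜(𝒢, B)` that extends the convolution product of
`Γ_c(𝒢, r^*B)`. By density there is at most one, see the instance below. -/
structure ConvolutionProduct where
  mul : Descent β N →L[ℂ] Descent β N →L[ℂ] Descent β N
  mul_assoc : ∀ a b c, mul (mul a b) c = mul a (mul b c)
  norm_mul_le : ∀ a b, ‖mul a b‖ ≤ ‖a‖ * ‖b‖
  mul_coe : ∀ ξ η : CompactSections β N, ∃ ζ : CompactSections β N,
    (∀ γ', ζ.val γ' = convolution ξ η γ') ∧
      mul (ξ : Descent β N) (η : Descent β N) = (ζ : Descent β N)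

instance : Subsingleton (ConvolutionProduct β N) where
  allEq m m' := by
    have key : ∀ a b, m.mul a b = m'.mul a b := by
      intro a b
      induction a, b using UniformSpace.Completion.induction_on₂ with
      | hp => exact isClosed_eq (by fun_prop) (by fun_prop)
      | ih ξ η =>
        obtain ⟨ζ, h1, h2⟩ := m.mul_coe ξ η
        obtain ⟨ζ', h1', h2'⟩ := m'.mul_coe ξ η
        have : ζ = ζ' := Subtype.ext (funext fun γ => (h1 γ).trans (h1' γ).symm)
        rw [h2, h2', this]
    cases m; cases m'
    congr
    ext a b
    exact key a b

variable {β N}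

/-- The Banach algebra `𝒜(𝒢, B)`. -/
def ConvolutionProduct.Algebra (_m : ConvolutionProduct β N) : Type (max u v w) := Descent β N

noncomputable instance (m : ConvolutionProduct β N) : NormedAddCommGroup m.Algebra :=
  inferInstanceAs (NormedAddCommGroup (Descent β N))

noncomputable instance (m : ConvolutionProduct β N) : NonUnitalNormedRing m.Algebra :=
  { (inferInstance : NormedAddCommGroup m.Algebra) with
    mul := fun a b => m.mul a b
    left_distrib := fun a b c => (m.mul a).map_add b c
    right_distrib := fun a b c => DFunLike.congr_fun (m.mul.map_add a b) c
    zero_mul := fun a => DFunLike.congr_fun m.mul.map_zero a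
    mul_zero := fun a => (m.mul a).map_zero
    mul_assoc := m.mul_assoc
    norm_mul_le := m.norm_mul_le }

noncomputable instance (m : ConvolutionProduct β N) : NormedSpace ℂ m.Algebra :=
  inferInstanceAs (NormedSpace ℂ (Descent β N))

instance (m : ConvolutionProduct β N) : CompleteSpace m.Algebra :=
  inferInstanceAs (CompleteSpace (Descent β N))

instance (m : ConvolutionProduct β N) : IsScalarTower ℂ m.Algebra m.Algebra where
  smul_assoc c a b := DFunLike.congr_fun (m.mul.map_smul c a) b

instance (m : ConvolutionProduct β N) : SMulCommClass ℂ m.Algebra m.Algebra where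
  smul_comm c a b := ((m.mul a).map_smul c b).symm

/-- The canonical map `Γ_c(𝒢, r^*B) → 𝒜(𝒢, B)`. -/
noncomputable def ConvolutionProduct.ofSection (m : ConvolutionProduct β N)
    (ξ : CompactSections β N) : m.Algebra :=
  ((ξ : Descent β N) : Descent β N)

end Descent

/-! ### Restriction to an open subset `U` of the unit space -/

section Restriction

variable {X : Type u} [Groupoid.{v} X] [TopologicalSpace X] [TopologicalSpace (Arr X)]

/-- The unit space `U` of the restricted groupoid `𝒢_U^U`. -/
def Restrict (U : TopologicalSpace.Opens X) : Type u := U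

variable {U : TopologicalSpace.Opens X}

/-- The inclusion `U → X`. -/
def Restrict.val (x : Restrict U) : X := Subtype.val x

theorem Restrict.val_mem (x : Restrict U) : x.val ∈ U := Subtype.property x

theorem Restrict.val_injective : Function.Injective (Restrict.val : Restrict U → X) :=
  Subtype.val_injective

instance : TopologicalSpace (Restrict U) := inferInstanceAs (TopologicalSpace U)

theorem Restrict.continuous_val : Continuous (Restrict.val : Restrict U → X) :=
  continuous_subtype_val

theorem Restrict.isInducing_val : IsInducing (Restrict.val : Restrict U → X) :=
  IsInducing.subtypeVal

/-- The restricted groupoid `𝒢_U^U`: all elements of `𝒢` with source and range in `U`. -/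
instance : Groupoid.{v} (Restrict U) where
  Hom x y := x.val ⟶ y.val
  id x := 𝟙 x.val
  comp f g := CategoryStruct.comp (obj := X) f g
  id_comp f := Category.id_comp (obj := X) f
  comp_id f := Category.comp_id (obj := X) f
  assoc f g h := Category.assoc (obj := X) f g h
  inv f := Groupoid.inv (obj := X) f
  inv_comp f := Groupoid.inv_comp (obj := X) f
  comp_inv f := Groupoid.comp_inv (obj := X) f

/-- The inclusion `𝒢_U^U → 𝒢`. -/
def Arr.incl (γ : Arr (Restrict U)) : Arr X := ⟨γ.src.val, γ.tgt.val, γ.hom⟩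

/-- The inclusion `(𝒢_U^U)^x → 𝒢^x`. -/
def RangeFibre.incl {x : Restrict U} (g : RangeFibre x) : RangeFibre x.val := ⟨g.src.val, g.hom⟩

/-- `𝒢_U^U` carries the subspace topology. -/
instance : TopologicalSpace (Arr (Restrict U)) :=
  TopologicalSpace.induced Arr.incl inferInstance

theorem Arr.isInducing_incl : IsInducing (Arr.incl : Arr (Restrict U) → Arr X) := ⟨rfl⟩

theorem Arr.incl_injective : Function.Injective (Arr.incl : Arr (Restrict U) → Arr X) := by
  rintro ⟨⟨x, hx⟩, ⟨y, hy⟩, f⟩ ⟨⟨x', hx'⟩, ⟨y', hy'⟩, f'⟩ h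
  injection h with h1 h2 h3
  change x = x' at h1
  change y = y' at h2
  subst h1 h2
  have h4 : f = f' := eq_of_heq h3
  rw [h4]

theorem Arr.mem_range_incl (γ : Arr X) :
    γ ∈ Set.range (Arr.incl : Arr (Restrict U) → Arr X) ↔ γ.src ∈ U ∧ γ.tgt ∈ U := by
  constructor
  · rintro ⟨γ, rfl⟩
    exact ⟨γ.src.val_mem, γ.tgt.val_mem⟩
  · rintro ⟨h1, h2⟩
    exact ⟨⟨⟨γ.src, h1⟩, ⟨γ.tgt, h2⟩, γ.hom⟩, rfl⟩

theorem RangeFibre.isInducing_incl {x : Restrict U} :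
    IsInducing (RangeFibre.incl : RangeFibre x → RangeFibre x.val) := by
  have h1 : IsInducing (RangeFibre.toArr : RangeFibre x.val → Arr X) := ⟨rfl⟩
  have h2 : IsInducing (RangeFibre.toArr : RangeFibre x → Arr (Restrict U)) := ⟨rfl⟩
  exact h1.of_comp_iff.1 (Arr.isInducing_incl.comp h2)

theorem RangeFibre.incl_injective {x : Restrict U} :
    Function.Injective (RangeFibre.incl : RangeFibre x → RangeFibre x.val) := by
  rintro ⟨⟨y, hy⟩, f⟩ ⟨⟨y', hy'⟩, f'⟩ h
  injection h with h1 h3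
  change y = y' at h1
  subst h1
  have h4 : f = f' := eq_of_heq h3
  rw [h4]

theorem RangeFibre.mem_range_incl {x : Restrict U} (g : RangeFibre x.val) :
    g ∈ Set.range (RangeFibre.incl : RangeFibre x → RangeFibre x.val) ↔ g.src ∈ U := by
  constructor
  · rintro ⟨g, rfl⟩
    exact g.src.val_mem
  · intro h
    exact ⟨⟨⟨g.src, h⟩, g.hom⟩, rfl⟩

variable [TopologicalGroupoid X]

theorem Arr.isOpenEmbedding_incl : IsOpenEmbedding (Arr.incl : Arr (Restrict U) → Arr X) := by
  refine ⟨⟨Arr.isInducing_incl, Arr.incl_injective⟩, ?_⟩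
  have : Set.range (Arr.incl : Arr (Restrict U) → Arr X) =
      (Arr.src ⁻¹' (U : Set X)) ∩ (Arr.tgt ⁻¹' (U : Set X)) :=
    Set.ext fun γ => Arr.mem_range_incl γ
  rw [this]
  exact (U.isOpen.preimage TopologicalGroupoid.continuous_src).inter
    (U.isOpen.preimage TopologicalGroupoid.continuous_tgt)

theorem RangeFibre.isOpenEmbedding_incl {x : Restrict U} :
    IsOpenEmbedding (RangeFibre.incl : RangeFibre x → RangeFibre x.val) := by
  refine ⟨⟨RangeFibre.isInducing_incl, RangeFibre.incl_injective⟩, ?_⟩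
  have : Set.range (RangeFibre.incl : RangeFibre x → RangeFibre x.val) =
      (fun g : RangeFibre x.val => g.toArr.src) ⁻¹' (U : Set X) :=
    Set.ext fun γ => RangeFibre.mem_range_incl γ
  rw [this]
  exact U.isOpen.preimage (TopologicalGroupoid.continuous_src.comp continuous_induced_dom)

instance : TopologicalGroupoid (Restrict U) where
  continuous_src := Restrict.isInducing_val.continuous_iff.2
    (TopologicalGroupoid.continuous_src.comp Arr.isInducing_incl.continuous)
  continuous_tgt := Restrict.isInducing_val.continuous_iff.2
    (TopologicalGroupoid.continuous_tgt.comp Arr.isInducing_incl.continuous)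
  continuous_unit := Arr.isInducing_incl.continuous_iff.2
    (TopologicalGroupoid.continuous_unit.comp Restrict.continuous_val)
  continuous_inv := Arr.isInducing_incl.continuous_iff.2
    (TopologicalGroupoid.continuous_inv.comp Arr.isInducing_incl.continuous)
  continuous_comp := by
    let q : ComposablePair (Restrict U) → ComposablePair X := fun p =>
      ⟨p.x.val, p.y.val, p.z.val, p.first, p.second⟩
    have h1 : Continuous (Prod.map Arr.incl Arr.incl :
        Arr (Restrict U) × Arr (Restrict U) → Arr X × Arr X) :=
      Arr.isInducing_incl.continuous.prodMap Arr.isInducing_incl.continuous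
    have h2 : Continuous (ComposablePair.toProd : ComposablePair (Restrict U) → _) :=
      continuous_induced_dom
    have hq : Continuous q := continuous_induced_rng.2 (h1.comp h2)
    exact Arr.isInducing_incl.continuous_iff.2 (TopologicalGroupoid.continuous_comp.comp hq)

instance [T2Space (Arr X)] : T2Space (Arr (Restrict U)) :=
  Arr.isOpenEmbedding_incl.isEmbedding.t2Space

instance [LocallyCompactSpace (Arr X)] : LocallyCompactSpace (Arr (Restrict U)) :=
  Arr.isOpenEmbedding_incl.locallyCompactSpace

variable [T2Space (Arr X)]

/-- Extension by zero, `C_c(𝒢_U^U) → C_c(𝒢)`. -/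
noncomputable def extendByZero (U : TopologicalSpace.Opens X) :
    C_c(Arr (Restrict U), ℂ) →ₗ[ℂ] C_c(Arr X, ℂ) where
  toFun f :=
    { toFun := Function.extend Arr.incl f 0
      continuous_toFun := continuous_of_tsupport fun γ hγ => by
        obtain ⟨δ, -, rfl⟩ := f.hasCompactSupport'.tsupport_extend_zero_subset
          Arr.isInducing_incl.continuous hγ
        rw [← Arr.isOpenEmbedding_incl.continuousAt_iff,
          Function.extend_comp Arr.incl_injective]
        exact f.continuous.continuousAt
      hasCompactSupport' :=
        f.hasCompactSupport'.extend_zero Arr.isInducing_incl.continuous }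
  map_add' f g := by
    ext γ
    change Function.extend Arr.incl (f + g) 0 γ =
      Function.extend Arr.incl f 0 γ + Function.extend Arr.incl g 0 γ
    by_cases h : ∃ δ : Arr (Restrict U), Arr.incl δ = γ
    · obtain ⟨δ, rfl⟩ := h
      simp only [Arr.incl_injective.extend_apply]; rfl
    · simp [Function.extend_apply' _ _ _ h]
  map_smul' c f := by
    ext γ
    change Function.extend Arr.incl (c • f) 0 γ = c * Function.extend Arr.incl f 0 γ
    by_cases h : ∃ δ : Arr (Restrict U), Arr.incl δ = γ
    · obtain ⟨δ, rfl⟩ := h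
      simp only [Arr.incl_injective.extend_apply]; rfl
    · simp [Function.extend_apply' _ _ _ h]

theorem extendByZero_incl (f : C_c(Arr (Restrict U), ℂ)) (γ : Arr (Restrict U)) :
    extendByZero U f γ.incl = f γ := Arr.incl_injective.extend_apply _ _ _

theorem extendByZero_of_notMem (f : C_c(Arr (Restrict U), ℂ)) (γ : Arr X)
    (h : γ.src ∉ U ∨ γ.tgt ∉ U) : extendByZero U f γ = 0 := by
  refine Function.extend_apply' _ _ _ fun h' => ?_
  have := (Arr.mem_range_incl γ).1 h'
  tauto

variable (haar : HaarSystem X)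

theorem integral_comap_incl {x : Restrict U} (F : RangeFibre x.val → ℂ)
    (hF : ∀ g, g.src ∉ U → F g = 0) :
    ∫ g : RangeFibre x, F g.incl ∂((haar.measure x.val).comap RangeFibre.incl) =
      ∫ g, F g ∂(haar.measure x.val) := by
  have he : MeasurableEmbedding (RangeFibre.incl : RangeFibre x → RangeFibre x.val) :=
    RangeFibre.isOpenEmbedding_incl.measurableEmbedding
  rw [← he.integral_map, he.map_comap]
  exact setIntegral_eq_integral_of_forall_compl_eq_zero fun g hg =>
    hF g fun h => hg ((RangeFibre.mem_range_incl g).2 h)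

/-- The Haar system that `𝒢_U^U` inherits from `𝒢`: the measures are restricted to the open
subsets `(𝒢_U^U)^x` of `𝒢^x`. -/
noncomputable def HaarSystem.restrict (U : TopologicalSpace.Opens X) :
    HaarSystem (Restrict U) where
  measure x := (haar.measure x.val).comap RangeFibre.incl
  regular x := by
    have := haar.regular x.val
    exact Measure.Regular.comap' _ RangeFibre.isOpenEmbedding_incl
  faithful x := by
    have := haar.faithful x.val
    exact Measure.IsOpenPosMeasure.comap _ RangeFibre.isOpenEmbedding_incl
  continuous_integral f := by
    refine ((haar.continuous_integral (extendByZero U f)).comp Restrict.continuous_val).congr ?_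
    intro x
    refine (integral_comap_incl haar (fun g => extendByZero U f g.toArr) fun g hg =>
      extendByZero_of_notMem f _ (Or.inl hg)).symm.trans ?_
    exact integral_congr_ae (Eventually.of_forall fun g => extendByZero_incl f g.toArr)
  invariant {x y} γ f := by
    have h := haar.invariant (x := x.val) (y := y.val) γ (extendByZero U f)
    rw [← integral_comap_incl haar (fun g => extendByZero U f g.toArr) fun g hg =>
      extendByZero_of_notMem f _ (Or.inl hg), ← integral_comap_incl haar
      (fun g : RangeFibre x.val => extendByZero U f
        (⟨g.src, y.val, CategoryStruct.comp (obj := X) g.hom γ⟩ : Arr X)) fun g hg =>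
      extendByZero_of_notMem f _ (Or.inl hg)] at h
    refine Eq.trans ?_ (h.trans ?_)
    · exact integral_congr_ae (Eventually.of_forall fun g => (extendByZero_incl f g.toArr).symm)
    · exact integral_congr_ae (Eventually.of_forall fun g =>
        extendByZero_incl f ⟨g.src, y, g.hom ≫ γ⟩)

theorem extendByZero_convolution (f g h : C_c(Arr (Restrict U), ℂ))
    (hh : ∀ γ, h γ = scalarConvolution (haar.restrict U) f g γ) (γ' : Arr X) :
    extendByZero U h γ' =
      scalarConvolution haar (extendByZero U f) (extendByZero U g) γ' := by
  unfold scalarConvolution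
  by_cases hs : γ'.src ∈ U
  · by_cases ht : γ'.tgt ∈ U
    · obtain ⟨δ, rfl⟩ := (Arr.mem_range_incl γ').2 ⟨hs, ht⟩
      rw [extendByZero_incl, hh]
      symm
      refine (integral_comap_incl (x := δ.tgt) haar _ fun k hk => ?_).symm.trans ?_
      · rw [extendByZero_of_notMem f _ (Or.inl hk), zero_mul]
      · refine integral_congr_ae (Eventually.of_forall fun k => ?_)
        exact congrArg₂ (· * ·) (extendByZero_incl f k.toArr)
          (extendByZero_incl g ⟨δ.src, k.src, δ.hom ≫ Groupoid.inv k.hom⟩)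
    · rw [extendByZero_of_notMem h _ (Or.inr ht)]
      symm
      refine integral_eq_zero_of_ae (Eventually.of_forall fun k => ?_)
      change _ * _ = (0 : ℂ)
      rw [extendByZero_of_notMem f k.toArr (Or.inr ht), zero_mul]
  · rw [extendByZero_of_notMem h _ (Or.inl hs)]
    symm
    refine integral_eq_zero_of_ae (Eventually.of_forall fun k => ?_)
    change _ * _ = (0 : ℂ)
    rw [extendByZero_of_notMem g ⟨γ'.src, k.src, γ'.hom ≫ Groupoid.inv k.hom⟩ (Or.inl hs), mul_zero]

/-- The restriction of an unconditional norm to `C_c(𝒢_U^U) ⊆ C_c(𝒢)`. -/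
noncomputable def UnconditionalNorm.restrict {haar : HaarSystem X} (N : UnconditionalNorm haar)
    (U : TopologicalSpace.Opens X) : UnconditionalNorm (haar.restrict U) where
  norm := N.norm.comp (extendByZero U)
  eq_zero f hf := by
    have h := N.eq_zero _ hf
    ext γ
    rw [← extendByZero_incl f γ, h]
    rfl
  submultiplicative f g h hh :=
    N.submultiplicative _ _ _ (extendByZero_convolution haar f g h hh)
  unconditional f g hfg := N.unconditional _ _ fun γ => by
    by_cases hγ : γ.src ∈ U ∧ γ.tgt ∈ U
    · obtain ⟨δ, rfl⟩ := (Arr.mem_range_incl γ).2 hγ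
      rw [extendByZero_incl, extendByZero_incl]
      exact hfg δ
    · rw [extendByZero_of_notMem f γ (by tauto), norm_zero]
      exact norm_nonneg _

end Restriction

section RestrictionOfFields

variable {X : Type u} [Groupoid.{v} X] [TopologicalSpace X] [TopologicalSpace (Arr X)]
  {B : X → Type w}
  [∀ x, NonUnitalNormedRing (B x)] [∀ x, NormedSpace ℂ (B x)]
  [∀ x, IsScalarTower ℂ (B x) (B x)] [∀ x, SMulCommClass ℂ (B x) (B x)]
  [∀ x, CompleteSpace (B x)]

/-- The restriction `B|_U` of a `𝒢`-Banach algebra, a `𝒢_U^U`-Banach algebra. -/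
noncomputable def GBanachAlgebra.restrict [TopologicalGroupoid X] (β : GBanachAlgebra X B)
    (U : TopologicalSpace.Opens X) :
    GBanachAlgebra (Restrict U) (fun u : Restrict U => B u.val) where
  toUscField := β.toUscField.pullback Restrict.val Restrict.continuous_val
  mul_mem ξ hξ η hη u₀ ε hε := by
    have husc := (β.toUscField.pullback Restrict.val
      (Restrict.continuous_val (U := U))).upperSemicontinuous_norm ξ hξ u₀ (‖ξ u₀‖ + 1)
      (by linarith)
    obtain ⟨b, hb, h1⟩ := hη u₀ (ε / (2 * (‖ξ u₀‖ + 1))) (by positivity)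
    have husc' := (Restrict.continuous_val (U := U)).continuousAt.eventually
      (β.upperSemicontinuous_norm b hb u₀.val (‖b u₀.val‖ + 1) (by linarith))
    obtain ⟨a, ha, h2⟩ := hξ u₀ (ε / (2 * (‖b u₀.val‖ + 1))) (by positivity)
    refine ⟨_, β.mul_mem a ha b hb, ?_⟩
    filter_upwards [husc, h1, husc', h2] with u hu1 hu2 hu3 hu4
    have e : ξ u * η u - a u.val * b u.val =
        ξ u * (η u - b u.val) + (ξ u - a u.val) * b u.val := by
      rw [mul_sub, sub_mul]; abel
    rw [e]
    have h3 : ‖ξ u * (η u - b u.val)‖ ≤ ε / 2 := by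
      refine (norm_mul_le _ _).trans ((mul_le_mul hu1.le hu2 (norm_nonneg _)
        (by positivity)).trans (le_of_eq ?_))
      field_simp
    have h4 : ‖(ξ u - a u.val) * b u.val‖ ≤ ε / 2 := by
      refine (norm_mul_le _ _).trans ((mul_le_mul hu4 hu3.le (norm_nonneg _)
        (by positivity)).trans (le_of_eq ?_))
      field_simp
    exact (norm_add_le _ _).trans (by linarith)
  act {x y} γ := β.act (x := x.val) (y := y.val) γ
  act_id x b := β.act_id x.val b
  act_comp {x y z} γ' γ b := β.act_comp (x := x.val) (y := y.val) (z := z.val) γ' γ b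
  act_mul {x y} γ a b := β.act_mul (x := x.val) (y := y.val) γ a b
  act_continuous ζ hζ γ₀ ε hε := by
    obtain ⟨ξ, hξ, h1⟩ := hζ γ₀ (ε / 4) (by positivity)
    obtain ⟨b, hb, h2⟩ := hξ γ₀.src (ε / 4) (by positivity)
    have hb' : (fun γ : Arr X => b γ.src) ∈
        β.toUscField.pullbackSections (Arr.src : Arr X → X) := fun γ₀ ε hε =>
      ⟨b, hb, Eventually.of_forall fun γ => by simp [hε.le]⟩
    obtain ⟨c, hc, h3⟩ := β.act_continuous _ hb' γ₀.incl (ε / 2) (by positivity)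
    refine ⟨fun u => c u.val, fun u₀ ε hε => ⟨c, hc, Eventually.of_forall fun u => by
      simp [hε.le]⟩, ?_⟩
    have h2' := (TopologicalGroupoid.continuous_src (X := Restrict U)).continuousAt.eventually h2
    have h3' := (Arr.isInducing_incl (U := U)).continuous.continuousAt.eventually h3
    filter_upwards [h1, h2', h3'] with γ g1 g2 g3
    let T : B γ.src.val ≃ₗᵢ[ℂ] B γ.tgt.val := β.act (x := γ.src.val) (y := γ.tgt.val) γ.hom
    change ‖T (ζ γ) - c γ.tgt.val‖ ≤ ε
    change ‖T (b γ.src.val) - c γ.tgt.val‖ ≤ ε / 2 at g3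
    have g4 : ‖T (ζ γ) - T (b γ.src.val)‖ ≤ ε / 2 := by
      rw [← map_sub, T.norm_map]
      have := norm_sub_le_norm_sub_add_norm_sub (ζ γ) (ξ γ.src) (b γ.src.val)
      linarith
    have := norm_sub_le_norm_sub_add_norm_sub (T (ζ γ)) (T (b γ.src.val)) (c γ.tgt.val)
    linarith

variable [TopologicalGroupoid X] [T2Space (Arr X)] [LocallyCompactSpace (Arr X)]
  {haar : HaarSystem X} {β : GBanachAlgebra X B} {N : UnconditionalNorm haar}
  {U : TopologicalSpace.Opens X}

/-- `ξ'` is the extension of `ξ ∈ Γ_c(𝒢_U^U, r^*B|_U)` by zero to all of `𝒢`. -/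
def IsExtensionByZero (ξ : CompactSections (β.restrict U) (N.restrict U))
    (ξ' : CompactSections β N) : Prop :=
  (∀ γ : Arr (Restrict U), ξ'.val γ.incl = ξ.val γ) ∧
    ∀ γ : Arr X, (γ.src ∉ U ∨ γ.tgt ∉ U) → ξ'.val γ = 0

end RestrictionOfFields

/-- A subset `U` of the unit space is full if every element of the groupoid is a product `γ₁ γ₂`
where the source of `γ₁` (which is the range of `γ₂`) lies in `U`. -/
def IsFull {X : Type u} [Groupoid.{v} X] (U : Set X) : Prop :=
  ∀ {x y : X} (γ : x ⟶ y), ∃ z ∈ U, ∃ (γ₁ : z ⟶ y) (γ₂ : x ⟶ z), γ₂ ≫ γ₁ = γ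

/-! ### Multipliers and Morita equivalence of Banach algebras -/

section BanachAlgebras

/-- An idempotent multiplier `P = (P^<, P^>)` of a Banach algebra `A`: `P^< a = P a` and
`P^> a = a P`. In contrast to the case of C*-algebras, the linearity over `A` of the two
components of a double centralizer has to be required. -/
structure IsIdempotentMultiplier {A : Type*} [NonUnitalNormedRing A] [NormedSpace ℂ A]
    [IsScalarTower ℂ A A] [SMulCommClass ℂ A A] (P : 𝓜(ℂ, A)) : Prop where
  idempotent : P * P = P
  fst_mul : ∀ a b : A, P.fst (a * b) = P.fst a * b
  snd_mul : ∀ a b : A, P.snd (a * b) = a * P.snd b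

/-- The structure of a Morita equivalence between the Banach algebras `A` and `B` on a pair of
Banach spaces `(E^<, E^>) = (L, R)`: the sum of `A`, `R`, `L`, `B` is a Banach algebra of
two-by-two matrices with rows `(A, R)` and `(L, B)`, and all products between two entries are
bounded by one and non-degenerate. -/
structure MoritaEquivalence (A B L R : Type*)
    [NonUnitalNormedRing A] [NormedSpace ℂ A] [NonUnitalNormedRing B] [NormedSpace ℂ B]
    [NormedAddCommGroup L] [NormedSpace ℂ L] [NormedAddCommGroup R] [NormedSpace ℂ R] where
  /-- `A × E^> → E^>` -/
  aR : A →L[ℂ] R →L[ℂ] R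
  /-- `E^> × B → E^>` -/
  rB : R →L[ℂ] B →L[ℂ] R
  /-- `B × E^< → E^<` -/
  bL : B →L[ℂ] L →L[ℂ] L
  /-- `E^< × A → E^<` -/
  lA : L →L[ℂ] A →L[ℂ] L
  /-- `E^> × E^< → A` -/
  rL : R →L[ℂ] L →L[ℂ] A
  /-- `E^< × E^> → B` -/
  lR : L →L[ℂ] R →L[ℂ] B
  norm_aR : ∀ a r, ‖aR a r‖ ≤ ‖a‖ * ‖r‖
  norm_rB : ∀ r b, ‖rB r b‖ ≤ ‖r‖ * ‖b‖
  norm_bL : ∀ b l, ‖bL b l‖ ≤ ‖b‖ * ‖l‖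
  norm_lA : ∀ l a, ‖lA l a‖ ≤ ‖l‖ * ‖a‖
  norm_rL : ∀ r l, ‖rL r l‖ ≤ ‖r‖ * ‖l‖
  norm_lR : ∀ l r, ‖lR l r‖ ≤ ‖l‖ * ‖r‖
  assoc_aaR : ∀ a a' r, aR (a * a') r = aR a (aR a' r)
  assoc_aRb : ∀ a r b, rB (aR a r) b = aR a (rB r b)
  assoc_rBb : ∀ r b b', rB (rB r b) b' = rB r (b * b')
  assoc_bbL : ∀ b b' l, bL (b * b') l = bL b (bL b' l)
  assoc_bLa : ∀ b l a, lA (bL b l) a = bL b (lA l a)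
  assoc_lAa : ∀ l a a', lA (lA l a) a' = lA l (a * a')
  assoc_aRL : ∀ a r l, rL (aR a r) l = a * rL r l
  assoc_rLa : ∀ r l a, rL r l * a = rL r (lA l a)
  assoc_rBL : ∀ r b l, rL (rB r b) l = rL r (bL b l)
  assoc_bLR : ∀ b l r, lR (bL b l) r = b * lR l r
  assoc_lRb : ∀ l r b, lR l r * b = lR l (rB r b)
  assoc_lAR : ∀ l a r, lR (lA l a) r = lR l (aR a r)
  assoc_rLR : ∀ r l r', aR (rL r l) r' = rB r (lR l r')
  assoc_lRL : ∀ l r l', bL (lR l r) l' = lA l (rL r l')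
  dense_aR : Dense (Submodule.span ℂ {x : R | ∃ a r, aR a r = x} : Set R)
  dense_rB : Dense (Submodule.span ℂ {x : R | ∃ r b, rB r b = x} : Set R)
  dense_bL : Dense (Submodule.span ℂ {x : L | ∃ b l, bL b l = x} : Set L)
  dense_lA : Dense (Submodule.span ℂ {x : L | ∃ l a, lA l a = x} : Set L)
  dense_rL : Dense (Submodule.span ℂ {x : A | ∃ r l, rL r l = x} : Set A)
  dense_lR : Dense (Submodule.span ℂ {x : B | ∃ l r, lR l r = x} : Set B)

/-- Two Banach algebras are Morita equivalent if there is a Morita equivalence between them. -/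
def MoritaEquivalent (A B : Type u)
    [NonUnitalNormedRing A] [NormedSpace ℂ A] [NonUnitalNormedRing B] [NormedSpace ℂ B] : Prop :=
  ∃ (L R : Type u) (_ : NormedAddCommGroup L) (_ : NormedSpace ℂ L) (_ : CompleteSpace L)
    (_ : NormedAddCommGroup R) (_ : NormedSpace ℂ R) (_ : CompleteSpace R),
    Nonempty (MoritaEquivalence A B L R)

end BanachAlgebras

end GroupoidDescent

open GroupoidDescent

/-!
Let `χ` be the characteristic function of `U`, which is continuous since `U` is open and closed.
Multiplication of sections by `χ ∘ r` and by `χ ∘ s` does not increase the norm, because the norm is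
unconditional, and the pair of these two maps is the idempotent multiplier `P`. The sections in
`P Γ_c P` are those that live on `𝒢_U^U`, and extension by zero is isometric because functions in
`C_c(𝒢)` can be restricted to the open and closed subset `𝒢_U^U` (`exists_extensionHom`,
`range_extensionHom_eq`).

The product itself has to be constructed. Convolution preserves `Γ_c(𝒢, r^*B)`: integration along
the fibres of the range map turns continuous sections over `{(z, γ) : r(γ) = p(z)}` into continuous
sections (`UscField.integral_mem_pullbackSections`). Applied to the trivial bundle `ℂ`, this also
shows that `C_c(𝒢)` is closed under convolution, so that the submultiplicativity of the
unconditional norm carries over to sections (`CompactSections.norm_conv_le`). Associativity is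
Fubini's theorem together with the left invariance of the Haar system.

The main point is fullness (`dense_span_corner`): the convolutions `ξ * η` with `ξ` supported in
`s⁻¹(U)` span a dense subspace. The closure of their span is a module over the continuous functions
on `𝒢`: by the Stone–Weierstrass theorem, `φ(γ γ'')` is a limit of sums of products `u(γ) v(γ'')`,
and `u`, `v` can be absorbed into `ξ`, `η` (`CompactSections.mulFun_conv_mem`). Fullness of `U` and
non-degeneracy of `B` show that the values of these convolutions at each `γ = γ₁γ₂` are dense in the
fibre: let `ξ` be concentrated near `γ₁`, where `s(γ₁) ∈ U` (`CompactSections.exists_val_approx`).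
A `C(𝒢)`-module of sections with dense values contains, up to closure, all of `Γ_c(𝒢, r^*B)`, by a
partition of unity (`CompactSections.mem_of_conv_mem`).

Finally, for every full corner `P A P` of a Banach algebra `A`, the closed subspaces `P A` and `A P`
form a Morita equivalence between `P A P` and `A` (`moritaEquivalent_of_fullCorner`).
-/

namespace GroupoidDescent

/-! ### Topology of the groupoid and invariance of the Haar measures -/

section Topology

variable {X : Type u} [Groupoid.{v} X] [TopologicalSpace X] [TopologicalSpace (Arr X)]

theorem RangeFibre.isInducing_toArr (y : X) :
    IsInducing (RangeFibre.toArr : RangeFibre y → Arr X) := ⟨rfl⟩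

theorem RangeFibre.continuous_toArr (y : X) :
    Continuous (RangeFibre.toArr : RangeFibre y → Arr X) := continuous_induced_dom

theorem RangeFibre.toArr_injective (y : X) :
    Function.Injective (RangeFibre.toArr : RangeFibre y → Arr X) := by
  rintro ⟨a, f⟩ ⟨b, g⟩ h
  injection h with h1 h2 h3
  change a = b at h1
  subst h1
  have h4 : f = g := eq_of_heq h3
  rw [h4]

theorem RangeFibre.range_toArr (y : X) :
    Set.range (RangeFibre.toArr : RangeFibre y → Arr X) = {γ | γ.tgt = y} := by
  ext ⟨a, b, f⟩
  constructor
  · rintro ⟨g, hg⟩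
    exact (congrArg Arr.tgt hg).symm
  · rintro (rfl : b = y)
    exact ⟨⟨a, f⟩, rfl⟩

variable [TopologicalGroupoid X]

theorem continuous_arr_inv {Y : Type*} [TopologicalSpace Y] {a b : Y → X} {h : ∀ y, a y ⟶ b y}
    (hh : Continuous fun y => (⟨a y, b y, h y⟩ : Arr X)) :
    Continuous fun y => (⟨b y, a y, Groupoid.inv (h y)⟩ : Arr X) :=
  TopologicalGroupoid.continuous_inv.comp hh

theorem continuous_arr_comp {Y : Type*} [TopologicalSpace Y] {a b c : Y → X}
    {h : ∀ y, a y ⟶ b y} {k : ∀ y, b y ⟶ c y}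
    (hh : Continuous fun y => (⟨a y, b y, h y⟩ : Arr X))
    (hk : Continuous fun y => (⟨b y, c y, k y⟩ : Arr X)) :
    Continuous fun y => (⟨a y, c y, h y ≫ k y⟩ : Arr X) := by
  have : Continuous fun y => (⟨a y, b y, c y, h y, k y⟩ : ComposablePair X) :=
    continuous_induced_rng.2 (hh.prodMk hk)
  exact TopologicalGroupoid.continuous_comp.comp this

theorem continuous_arr_div {Y : Type*} [TopologicalSpace Y] {a b c : Y → X}
    {h : ∀ y, a y ⟶ c y} {k : ∀ y, b y ⟶ c y}
    (hh : Continuous fun y => (⟨a y, c y, h y⟩ : Arr X))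
    (hk : Continuous fun y => (⟨b y, c y, k y⟩ : Arr X)) :
    Continuous fun y => (⟨a y, b y, h y ≫ Groupoid.inv (k y)⟩ : Arr X) :=
  continuous_arr_comp hh (continuous_arr_inv hk)

/-- Left translation by `γ`, as a homeomorphism of the range fibres. -/
def RangeFibre.translate {x y : X} (γ : x ⟶ y) : RangeFibre x ≃ₜ RangeFibre y where
  toFun g := ⟨g.src, g.hom ≫ γ⟩
  invFun g := ⟨g.src, g.hom ≫ Groupoid.inv γ⟩
  left_inv g := by simp
  right_inv g := by simp
  continuous_toFun := (RangeFibre.isInducing_toArr y).continuous_iff.2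
    (continuous_arr_comp (RangeFibre.continuous_toArr x) continuous_const)
  continuous_invFun := (RangeFibre.isInducing_toArr x).continuous_iff.2
    (continuous_arr_comp (RangeFibre.continuous_toArr y) continuous_const)

variable [T2Space (Arr X)]

/-- The unit space embeds into the Hausdorff space `𝒢`. -/
theorem t2Space_unitSpace (X : Type u) [Groupoid.{v} X] [TopologicalSpace X]
    [TopologicalSpace (Arr X)] [TopologicalGroupoid X] [T2Space (Arr X)] : T2Space X :=
  T2Space.of_injective_continuous (f := fun x : X => (⟨x, x, 𝟙 x⟩ : Arr X))
    (fun _ _ h => congrArg Arr.src h) TopologicalGroupoid.continuous_unit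

theorem RangeFibre.isClosedEmbedding_toArr (y : X) :
    IsClosedEmbedding (RangeFibre.toArr : RangeFibre y → Arr X) := by
  have := t2Space_unitSpace X
  refine ⟨⟨RangeFibre.isInducing_toArr y, RangeFibre.toArr_injective y⟩, ?_⟩
  rw [RangeFibre.range_toArr]
  exact isClosed_singleton.preimage TopologicalGroupoid.continuous_tgt

instance (y : X) : T2Space (RangeFibre y) :=
  (RangeFibre.isClosedEmbedding_toArr y).isEmbedding.t2Space

theorem ComposablePair.isClosedEmbedding_toProd :
    IsClosedEmbedding (ComposablePair.toProd : ComposablePair X → Arr X × Arr X) := by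
  have := t2Space_unitSpace X
  refine ⟨⟨⟨rfl⟩, ?_⟩, ?_⟩
  · rintro ⟨a, b, c, f, g⟩ ⟨a', b', c', f', g'⟩ h
    injection h with h1 h2
    injection h1 with h3 h4 h5
    injection h2 with h6 h7 h8
    change a = a' at h3
    change b = b' at h4
    change c = c' at h7
    subst h3 h4 h7
    have h9 : f = f' := eq_of_heq h5
    have h10 : g = g' := eq_of_heq h8
    rw [h9, h10]
  · have : Set.range (ComposablePair.toProd : ComposablePair X → Arr X × Arr X) =
        {p | p.1.tgt = p.2.src} := by
      ext ⟨⟨a, b, f⟩, ⟨c, d, g⟩⟩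
      constructor
      · rintro ⟨p, hp⟩
        have h1 := congrArg (fun q => q.1.tgt) hp
        have h2 := congrArg (fun q => q.2.src) hp
        exact h1.symm.trans h2
      · rintro (rfl : b = c)
        exact ⟨⟨a, b, d, f, g⟩, rfl⟩
    rw [this]
    exact isClosed_eq (TopologicalGroupoid.continuous_tgt.comp continuous_fst)
      (TopologicalGroupoid.continuous_src.comp continuous_snd)

/-- The set of products `γ γ''` with `γ ∈ K` and `γ'' ∈ L`. -/
def mulSet (K L : Set (Arr X)) : Set (Arr X) :=
  ComposablePair.comp '' (ComposablePair.toProd ⁻¹' (L ×ˢ K))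

theorem isCompact_mulSet {K L : Set (Arr X)} (hK : IsCompact K) (hL : IsCompact L) :
    IsCompact (mulSet K L) :=
  (ComposablePair.isClosedEmbedding_toProd.isCompact_preimage (hL.prod hK)).image
    TopologicalGroupoid.continuous_comp

theorem mem_mulSet {K L : Set (Arr X)} {a b c : X} {h : a ⟶ c} {k : b ⟶ c}
    (hk : (⟨b, c, k⟩ : Arr X) ∈ K) (hh : (⟨a, b, h ≫ Groupoid.inv k⟩ : Arr X) ∈ L) :
    (⟨a, c, h⟩ : Arr X) ∈ mulSet K L :=
  ⟨⟨a, b, c, h ≫ Groupoid.inv k, k⟩, ⟨hh, hk⟩, by simp [ComposablePair.comp]⟩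

end Topology

section Measure

/-- Two regular measures on a closed subset of a locally compact space agree if they agree on the
restrictions of all compactly supported functions on the ambient space. -/
theorem measure_eq_of_integral_eq_of_isClosedEmbedding {Y Z : Type*} [TopologicalSpace Y]
    [TopologicalSpace Z] [T2Space Z] [LocallyCompactSpace Z] [MeasurableSpace Y] [BorelSpace Y]
    {e : Y → Z} (he : IsClosedEmbedding e) {μ ν : Measure Y} [μ.Regular] [ν.Regular]
    (h : ∀ f : C_c(Z, ℂ), ∫ y, f (e y) ∂μ = ∫ y, f (e y) ∂ν) : μ = ν := by
  have : T2Space Y := he.isEmbedding.t2Space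
  have key : ∀ (μ ν : Measure Y) [μ.Regular] [ν.Regular],
      (∀ f : C_c(Z, ℂ), ∫ y, f (e y) ∂μ = ∫ y, f (e y) ∂ν) →
      ∀ K : Set Y, IsCompact K → μ K ≤ ν K := by
    intro μ ν _ _ h K hK
    rw [K.measure_eq_iInf_isOpen ν]
    refine le_iInf fun V => le_iInf fun hKV => le_iInf fun hV => ?_
    obtain ⟨V', hV', rfl⟩ := he.isInducing.isOpen_iff.1 hV
    obtain ⟨f, hf1, hf0, hfc, hf⟩ := exists_continuous_one_zero_of_isCompact
      (hK.image he.continuous) hV'.isClosed_compl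
      (Set.disjoint_compl_right_iff_subset.2 (Set.image_subset_iff.2 hKV))
    have hc : Continuous fun y => f (e y) := f.continuous.comp he.continuous
    have hcs : HasCompactSupport fun y => f (e y) := hfc.comp_isClosedEmbedding he
    have hint : ∀ (ρ : Measure Y) [ρ.Regular], ENNReal.ofReal (∫ y, f (e y) ∂ρ) =
        ∫⁻ y, ENNReal.ofReal (f (e y)) ∂ρ := fun ρ _ =>
      ofReal_integral_eq_lintegral_ofReal (hc.integrable_of_hasCompactSupport hcs)
        (Eventually.of_forall fun y => (hf _).1)
    have heq : ∫ y, f (e y) ∂μ = ∫ y, f (e y) ∂ν := by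
      have := h ⟨⟨fun z => (f z : ℂ), by fun_prop⟩, hfc.comp_left Complex.ofReal_zero⟩
      change ∫ y, ((f (e y) : ℝ) : ℂ) ∂μ = ∫ y, ((f (e y) : ℝ) : ℂ) ∂ν at this
      rw [integral_complex_ofReal, integral_complex_ofReal] at this
      exact_mod_cast this
    calc μ K = ∫⁻ y, K.indicator 1 y ∂μ := (lintegral_indicator_one hK.measurableSet).symm
      _ ≤ ∫⁻ y, ENNReal.ofReal (f (e y)) ∂μ := by
        refine lintegral_mono fun y => ?_
        by_cases hy : y ∈ K
        · have : f (e y) = 1 := hf1 ⟨y, hy, rfl⟩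
          simp [hy, this]
        · simp [hy]
      _ = ∫⁻ y, ENNReal.ofReal (f (e y)) ∂ν := by rw [← hint μ, ← hint ν, heq]
      _ ≤ ∫⁻ y, (e ⁻¹' V').indicator 1 y ∂ν := by
        refine lintegral_mono fun y => ?_
        by_cases hy : e y ∈ V'
        · have : y ∈ e ⁻¹' V' := hy
          simpa [this] using (hf (e y)).2
        · have : f (e y) = 0 := hf0 hy
          simp [this]
      _ = ν (e ⁻¹' V') := lintegral_indicator_one hV.measurableSet
  apply Measure.OuterRegular.ext_isOpen
  apply Measure.InnerRegularWRT.eq_of_innerRegularWRT_of_forall_eq Measure.Regular.innerRegular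
    Measure.Regular.innerRegular
  exact fun K hK => le_antisymm (key μ ν h K hK) (key ν μ (fun f => (h f).symm) K hK)

variable {X : Type u} [Groupoid.{v} X] [TopologicalSpace X] [TopologicalSpace (Arr X)]

instance (haar : HaarSystem X) (x : X) : (haar.measure x).Regular := haar.regular x

instance (haar : HaarSystem X) (x : X) : (haar.measure x).IsOpenPosMeasure := haar.faithful x

variable [TopologicalGroupoid X] [T2Space (Arr X)] [LocallyCompactSpace (Arr X)]

/-- The invariance of the integrals of `C_c(𝒢)` determines that of the measures, as these are
regular. -/
theorem HaarSystem.map_translate (haar : HaarSystem X) {x y : X} (γ : x ⟶ y) :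
    (haar.measure x).map (RangeFibre.translate γ) = haar.measure y := by
  have : ((haar.measure x).map (RangeFibre.translate γ)).Regular :=
    Measure.Regular.map (RangeFibre.translate γ)
  refine measure_eq_of_integral_eq_of_isClosedEmbedding
    (RangeFibre.isClosedEmbedding_toArr y) fun f => ?_
  rw [(RangeFibre.translate γ).measurableEmbedding.integral_map, haar.invariant γ f]
  rfl

/-- Left invariance of the Haar system for functions with values in an arbitrary Banach space. -/
theorem HaarSystem.integral_translate (haar : HaarSystem X) {x y : X} (γ : x ⟶ y) {E : Type*}
    [NormedAddCommGroup E] [NormedSpace ℝ E] (F : RangeFibre y → E) :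
    ∫ g, F (RangeFibre.translate γ g) ∂(haar.measure x) = ∫ g, F g ∂(haar.measure y) := by
  rw [← (RangeFibre.translate γ).measurableEmbedding.integral_map, haar.map_translate]

end Measure

/-! ### Sections of pulled back fields and their fibrewise integrals -/

section Sections

variable {X : Type*} [TopologicalSpace X] {E : X → Type*} [∀ x, NormedAddCommGroup (E x)]
  [∀ x, NormedSpace ℂ (E x)] [∀ x, CompleteSpace (E x)] (F : UscField X E)
  {Y : Type*} [TopologicalSpace Y] {p : Y → X}

theorem UscField.pullbackSections_of_sections {b : ∀ x, E x} (hb : b ∈ F.sections) (p : Y → X) :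
    (fun y => b (p y)) ∈ F.pullbackSections p := fun _ _ hε =>
  ⟨b, hb, Eventually.of_forall fun y => by simp [hε.le]⟩

theorem UscField.pullbackSections_comp {ζ : ∀ y, E (p y)} (hζ : ζ ∈ F.pullbackSections p)
    {Y' : Type*} [TopologicalSpace Y'] {f : Y' → Y} (hf : Continuous f) :
    (fun y => ζ (f y)) ∈ F.pullbackSections fun y => p (f y) := fun y₀ ε hε => by
  obtain ⟨b, hb, h⟩ := hζ (f y₀) ε hε
  exact ⟨b, hb, hf.continuousAt.eventually h⟩

theorem UscField.pullbackSections_smul (hp : Continuous p) {φ : Y → ℂ} (hφ : Continuous φ)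
    {ζ : ∀ y, E (p y)} (hζ : ζ ∈ F.pullbackSections p) :
    (fun y => φ y • ζ y) ∈ F.pullbackSections p := by
  intro y₀ ε hε
  have h1 : ∀ᶠ y in 𝓝 y₀, ‖φ y‖ < ‖φ y₀‖ + 1 :=
    hφ.norm.continuousAt.eventually_lt continuousAt_const (by linarith)
  obtain ⟨b, hb, h2⟩ := hζ y₀ (ε / (2 * (‖φ y₀‖ + 1))) (by positivity)
  have h3 := hp.continuousAt.eventually
    (F.upperSemicontinuous_norm b hb (p y₀) (‖b (p y₀)‖ + 1) (by linarith))
  have h4 : ∀ᶠ y in 𝓝 y₀, ‖φ y - φ y₀‖ < ε / (2 * (‖b (p y₀)‖ + 1)) :=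
    (hφ.sub continuous_const).norm.continuousAt.eventually_lt continuousAt_const (by
      change ‖φ y₀ - φ y₀‖ < _
      rw [sub_self, norm_zero]; positivity)
  refine ⟨_, F.sections.smul_mem (φ y₀) hb, ?_⟩
  filter_upwards [h1, h2, h3, h4] with y h1 h2 h3 h4
  have e : φ y • ζ y - (φ y₀ • b) (p y) = φ y • (ζ y - b (p y)) + (φ y - φ y₀) • b (p y) := by
    simp only [Pi.smul_apply, smul_sub, sub_smul]; abel
  rw [e]
  have h5 : ‖φ y • (ζ y - b (p y))‖ ≤ ε / 2 := by
    rw [norm_smul]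
    refine (mul_le_mul h1.le h2 (norm_nonneg _) (by positivity)).trans (le_of_eq ?_)
    field_simp
  have h6 : ‖(φ y - φ y₀) • b (p y)‖ ≤ ε / 2 := by
    rw [norm_smul]
    refine (mul_le_mul h4.le h3.le (norm_nonneg _) (by positivity)).trans (le_of_eq ?_)
    field_simp
  exact (norm_add_le _ _).trans (by linarith)

/-- A section of the pullback along a constant map is a continuous function into the fibre. -/
theorem UscField.continuous_of_pullbackSections_const {x : X} {ζ : Y → E x}
    (hζ : ζ ∈ F.pullbackSections fun _ : Y => x) : Continuous ζ := by
  refine continuous_iff_continuousAt.2 fun y₀ => Metric.continuousAt_iff'.2 fun ε hε => ?_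
  obtain ⟨b, -, h⟩ := hζ y₀ (ε / 3) (by positivity)
  have h0 := h.self_of_nhds
  filter_upwards [h] with y h
  rw [dist_eq_norm]
  have := norm_sub_le_norm_sub_add_norm_sub (ζ y) (b x) (ζ y₀)
  rw [norm_sub_rev (b x)] at this
  linarith

end Sections

section Algebra

variable {X : Type u} [Groupoid.{v} X] [TopologicalSpace X] [TopologicalSpace (Arr X)]
  {B : X → Type w} [∀ x, NonUnitalNormedRing (B x)] [∀ x, NormedSpace ℂ (B x)]
  [∀ x, IsScalarTower ℂ (B x) (B x)] [∀ x, SMulCommClass ℂ (B x) (B x)]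
  [∀ x, CompleteSpace (B x)] (β : GBanachAlgebra X B) {Y : Type*} [TopologicalSpace Y]

theorem GBanachAlgebra.pullbackSections_mul {p : Y → X} (hp : Continuous p)
    {ξ η : ∀ y, B (p y)} (hξ : ξ ∈ β.toUscField.pullbackSections p)
    (hη : η ∈ β.toUscField.pullbackSections p) :
    (fun y => ξ y * η y) ∈ β.toUscField.pullbackSections p := by
  intro u₀ ε hε
  have husc := (β.toUscField.pullback p hp).upperSemicontinuous_norm ξ hξ u₀ (‖ξ u₀‖ + 1)
    (by linarith)
  obtain ⟨b, hb, h1⟩ := hη u₀ (ε / (2 * (‖ξ u₀‖ + 1))) (by positivity)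
  have husc' := hp.continuousAt.eventually
    (β.upperSemicontinuous_norm b hb (p u₀) (‖b (p u₀)‖ + 1) (by linarith))
  obtain ⟨a, ha, h2⟩ := hξ u₀ (ε / (2 * (‖b (p u₀)‖ + 1))) (by positivity)
  refine ⟨_, β.mul_mem a ha b hb, ?_⟩
  filter_upwards [husc, h1, husc', h2] with u hu1 hu2 hu3 hu4
  have e : ξ u * η u - a (p u) * b (p u) =
      ξ u * (η u - b (p u)) + (ξ u - a (p u)) * b (p u) := by
    rw [mul_sub, sub_mul]; abel
  rw [e]
  have h3 : ‖ξ u * (η u - b (p u))‖ ≤ ε / 2 := by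
    refine (norm_mul_le _ _).trans ((mul_le_mul hu1.le hu2 (norm_nonneg _)
      (by positivity)).trans (le_of_eq ?_))
    field_simp
  have h4 : ‖(ξ u - a (p u)) * b (p u)‖ ≤ ε / 2 := by
    refine (norm_mul_le _ _).trans ((mul_le_mul hu4 hu3.le (norm_nonneg _)
      (by positivity)).trans (le_of_eq ?_))
    field_simp
  exact (norm_add_le _ _).trans (by linarith)

theorem GBanachAlgebra.pullbackSections_act {a b : Y → X} {h : ∀ y, a y ⟶ b y}
    (hh : Continuous fun y => (⟨a y, b y, h y⟩ : Arr X)) {ζ : ∀ y, B (a y)}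
    (hζ : ζ ∈ β.toUscField.pullbackSections a) :
    (fun y => β.act (h y) (ζ y)) ∈ β.toUscField.pullbackSections b := by
  intro y₀ ε hε
  obtain ⟨c, hc, h1⟩ := hζ y₀ (ε / 2) (by positivity)
  obtain ⟨d, hd, h2⟩ := β.act_continuous _
    (β.toUscField.pullbackSections_of_sections hc (Arr.src : Arr X → X))
    ⟨a y₀, b y₀, h y₀⟩ (ε / 2) (by positivity)
  refine ⟨d, hd, ?_⟩
  filter_upwards [h1, hh.continuousAt.eventually h2] with y h1 h2
  have h3 : ‖β.act (h y) (ζ y) - β.act (h y) (c (a y))‖ ≤ ε / 2 := by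
    rw [← map_sub, LinearIsometryEquiv.norm_map]; exact h1
  have := norm_sub_le_norm_sub_add_norm_sub (β.act (h y) (ζ y)) (β.act (h y) (c (a y))) (d (b y))
  exact this.trans (by linarith)

end Algebra

section ParametricIntegral

variable {X : Type u} [Groupoid.{v} X] [TopologicalSpace X] [TopologicalSpace (Arr X)]

/-- The fibre product `{(z, γ) : r(γ) = p(z)}` of `p : Z → X` with the range map. -/
structure FibreProduct {Z : Type*} (p : Z → X) where
  pt : Z
  arr : RangeFibre (p pt)

/-- A point of the fibre product, regarded as a point of `Z × 𝒢`. -/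
def FibreProduct.toProd {Z : Type*} {p : Z → X} (w : FibreProduct p) : Z × Arr X :=
  (w.pt, w.arr.toArr)

instance {Z : Type*} [TopologicalSpace Z] (p : Z → X) : TopologicalSpace (FibreProduct p) :=
  TopologicalSpace.induced FibreProduct.toProd inferInstance

variable {Z : Type*} [TopologicalSpace Z] {p : Z → X}

theorem FibreProduct.continuous_toProd :
    Continuous (FibreProduct.toProd : FibreProduct p → Z × Arr X) := continuous_induced_dom

theorem FibreProduct.continuous_pt : Continuous fun w : FibreProduct p => w.pt :=
  continuous_fst.comp FibreProduct.continuous_toProd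

theorem FibreProduct.continuous_arr : Continuous fun w : FibreProduct p => w.arr.toArr :=
  continuous_snd.comp FibreProduct.continuous_toProd

theorem FibreProduct.continuous_mk (z : Z) :
    Continuous fun g : RangeFibre (p z) => (⟨z, g⟩ : FibreProduct p) :=
  continuous_induced_rng.2 (continuous_const.prodMk (RangeFibre.continuous_toArr _))

variable [TopologicalGroupoid X] [T2Space (Arr X)] [LocallyCompactSpace (Arr X)]

theorem hasCompactSupport_rangeFibre {M : Type*} [Zero M] {y : X} {K : Set (Arr X)}
    (hK : IsCompact K) {f : RangeFibre y → M} (hf : ∀ g, g.toArr ∉ K → f g = 0) :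
    HasCompactSupport f :=
  HasCompactSupport.intro ((RangeFibre.isClosedEmbedding_toArr y).isCompact_preimage hK) hf

variable {E : X → Type*} [∀ x, NormedAddCommGroup (E x)]
  [∀ x, NormedSpace ℂ (E x)] [∀ x, CompleteSpace (E x)] {F : UscField X E}
  {Φ : ∀ w : FibreProduct p, E (p w.pt)}

theorem UscField.integrable_slice (haar : HaarSystem X)
    (hΦ : Φ ∈ F.pullbackSections fun w : FibreProduct p => p w.pt) {K : Set (Arr X)} (hK : IsCompact K)
    (hsupp : ∀ w, w.arr.toArr ∉ K → Φ w = 0) (z : Z) :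
    Integrable (ε := E (p z)) (fun g : RangeFibre (p z) => Φ ⟨z, g⟩) (haar.measure (p z)) :=
  have hc : Continuous (Y := E (p z)) (fun g : RangeFibre (p z) => Φ ⟨z, g⟩) :=
    F.continuous_of_pullbackSections_const (x := p z)
      (F.pullbackSections_comp hΦ (FibreProduct.continuous_mk z))
  hc.integrable_of_hasCompactSupport
    (hasCompactSupport_rangeFibre hK fun g hg => hsupp ⟨z, g⟩ hg)

/-- Integration along the fibres of the range map turns continuous sections with uniformly compact
support into continuous sections: with a partition of unity, such a section is approximated by
sums of products of scalar functions on `𝒢` and sections over `X`, for which the claim is the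
continuity of the Haar system. -/
theorem UscField.integral_mem_pullbackSections (haar : HaarSystem X) (hp : Continuous p)
    (hΦ : Φ ∈ F.pullbackSections fun w : FibreProduct p => p w.pt) {K : Set (Arr X)} (hK : IsCompact K)
    (hsupp : ∀ w, w.arr.toArr ∉ K → Φ w = 0) :
    (fun z => ∫ g : RangeFibre (p z), Φ ⟨z, g⟩ ∂(haar.measure (p z))) ∈
      F.pullbackSections p := by
  have := t2Space_unitSpace X
  refine (F.pullback p hp).mem_of_local _ fun z₀ ε hε => ?_
  obtain ⟨χ, hχ1, -, hχc, hχ⟩ := exists_continuous_one_zero_of_isCompact hK isClosed_empty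
    (Set.disjoint_empty _)
  have hcont : ∀ f : C(Arr X, ℝ), HasCompactSupport f →
      Continuous fun x => ∫ g : RangeFibre x, f g.toArr ∂(haar.measure x) := by
    intro f hf
    have h := haar.continuous_integral
      ⟨⟨fun γ => (f γ : ℂ), by fun_prop⟩, hf.comp_left Complex.ofReal_zero⟩
    refine (Complex.continuous_re.comp h).congr fun x => ?_
    change (∫ g : RangeFibre x, ((f g.toArr : ℝ) : ℂ) ∂(haar.measure x)).re = _
    rw [integral_complex_ofReal, Complex.ofReal_re]
  have hint : ∀ f : C(Arr X, ℝ), HasCompactSupport f → ∀ x,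
      Integrable (fun g : RangeFibre x => f g.toArr) (haar.measure x) := fun f hf x =>
    (f.continuous.comp (RangeFibre.continuous_toArr x)).integrable_of_hasCompactSupport
      (hf.comp_isClosedEmbedding (RangeFibre.isClosedEmbedding_toArr x))
  -- The error on each fibre is at most `δ * I(p(z))`, where `I` is the integral of the cutoff `χ`.
  set I : X → ℝ := fun x => ∫ g : RangeFibre x, χ g.toArr ∂(haar.measure x) with hI
  have hI0 : ∀ x, 0 ≤ I x := fun x => integral_nonneg fun g => (hχ _).1
  set M := I (p z₀) + 1 with hM
  have hMpos : 0 < M := by have := hI0 (p z₀); linarith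
  set δ := ε / M with hδ
  have hδpos : 0 < δ := by positivity
  have hlocal : ∀ γ₀ : Arr X, ∃ (V : Set (Arr X)) (W : Set Z) (b : ∀ x, E x),
      (IsOpen V ∧ γ₀ ∈ V) ∧ W ∈ 𝓝 z₀ ∧ b ∈ F.sections ∧
      ∀ z ∈ W, ∀ g : RangeFibre (p z), g.toArr ∈ V → ‖Φ ⟨z, g⟩ - b (p z)‖ ≤ δ := by
    intro γ₀
    -- The section is only defined where `r(γ) = p(z)`; near other points there is nothing to show.
    by_cases h : γ₀.tgt = p z₀
    · obtain ⟨a, t, f⟩ := γ₀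
      change t = p z₀ at h
      subst h
      obtain ⟨b, hb, h1⟩ := hΦ ⟨z₀, ⟨a, f⟩⟩ δ hδpos
      rw [nhds_induced, eventually_comap] at h1
      change ∀ᶠ q in 𝓝 (z₀, (⟨a, p z₀, f⟩ : Arr X)), _ at h1
      rw [nhds_prod_eq, eventually_prod_iff] at h1
      obtain ⟨P, hP, Q, hQ, h2⟩ := h1
      obtain ⟨V, hVQ, hV, hmem⟩ := eventually_nhds_iff.1 hQ
      exact ⟨V, {z | P z}, b, ⟨hV, hmem⟩, hP, hb, fun z hz g hg =>
        h2 hz (hVQ _ hg) ⟨z, g⟩ rfl⟩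
    · obtain ⟨S, T, hS, hT, hmS, hmT, hST⟩ := t2_separation h
      refine ⟨Arr.tgt ⁻¹' S, p ⁻¹' T, 0,
        ⟨hS.preimage TopologicalGroupoid.continuous_tgt, hmS⟩,
        hp.continuousAt (hT.mem_nhds hmT), F.sections.zero_mem, fun z hz g hg => ?_⟩
      exact (Set.disjoint_left.1 hST hg hz).elim
  choose V W b hV hW hb hVW using hlocal
  obtain ⟨t, ht⟩ := hK.elim_finite_subcover V (fun γ => (hV γ).1)
    fun γ _ => Set.mem_iUnion.2 ⟨γ, (hV γ).2⟩
  obtain ⟨ρ, hρV, -⟩ := PartitionOfUnity.exists_isSubordinate_of_locallyFinite_t2space hK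
    (fun i : t => V i) (fun i => (hV i).1) (locallyFinite_of_finite _) (by
      rw [Set.iUnion_subtype]; exact ht)
  have hρ1 : ∀ γ ∈ K, ∑ i, ρ i γ = 1 := fun γ hγ => by
    rw [← finsum_eq_sum_of_fintype]; exact ρ.sum_eq_one hγ
  have hρle : ∀ γ, ∑ i, ρ i γ ≤ 1 := fun γ => by
    rw [← finsum_eq_sum_of_fintype]; exact ρ.sum_le_one γ
  have hρV' : ∀ (i : t) γ, γ ∉ V i → ρ i γ = 0 := fun i γ hγ =>
    image_eq_zero_of_notMem_tsupport fun h => hγ (hρV i h)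
  have hcs : ∀ i, HasCompactSupport (χ * ρ i) := fun i => hχc.mul_right
  refine ⟨fun z => ∑ i, ((∫ g : RangeFibre (p z), (χ * ρ i) g.toArr ∂(haar.measure (p z)) : ℝ) : ℂ)
    • b i (p z), ?_, ?_⟩
  · have : (fun z => ∑ i, ((∫ g : RangeFibre (p z), (χ * ρ i) g.toArr
        ∂(haar.measure (p z)) : ℝ) : ℂ) • b i (p z)) =
        ∑ i, fun z => ((∫ g : RangeFibre (p z), (χ * ρ i) g.toArr
        ∂(haar.measure (p z)) : ℝ) : ℂ) • b i (p z) := by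
      ext z; rw [Finset.sum_apply]
    rw [this]
    exact Submodule.sum_mem _ fun i _ => F.pullbackSections_smul hp
      (Complex.continuous_ofReal.comp ((hcont _ (hcs i)).comp hp))
      (F.pullbackSections_of_sections (hb i) p)
  · have h1 : ∀ᶠ z in 𝓝 z₀, I (p z) < M :=
      ((hcont χ hχc).comp hp).continuousAt.eventually_lt continuousAt_const
        (by change I (p z₀) < M; linarith)
    have h2 : ∀ᶠ z in 𝓝 z₀, ∀ i : t, z ∈ W i := eventually_all.2 fun i => hW i
    filter_upwards [h1, h2] with z h1 h2
    have hsum : ∑ i, ((∫ g : RangeFibre (p z), (χ * ρ i) g.toArr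
        ∂(haar.measure (p z)) : ℝ) : ℂ) • b i (p z) =
        ∫ g : RangeFibre (p z), ∑ i, (χ * ρ i) g.toArr • b i (p z) ∂(haar.measure (p z)) := by
      rw [integral_finsetSum _ fun i _ => (hint _ (hcs i) _).smul_const _]
      refine Finset.sum_congr rfl fun i _ => ?_
      rw [integral_smul_const, Complex.coe_smul]
    rw [hsum, ← integral_sub (F.integrable_slice haar hΦ hK hsupp z)
      (integrable_finsetSum _ fun i _ => (hint _ (hcs i) _).smul_const _)]
    have hpt : ∀ g : RangeFibre (p z),
        ‖Φ ⟨z, g⟩ - ∑ i, (χ * ρ i) g.toArr • b i (p z)‖ ≤ δ * χ g.toArr := by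
      intro g
      have e : Φ ⟨z, g⟩ = ∑ i, (χ * ρ i) g.toArr • Φ ⟨z, g⟩ := by
        rw [← Finset.sum_smul]
        by_cases hg : g.toArr ∈ K
        · have h3 : χ g.toArr = 1 := hχ1 hg
          simp only [ContinuousMap.mul_apply, h3, one_mul, hρ1 _ hg, one_smul]
        · rw [hsupp ⟨z, g⟩ hg, smul_zero]
      rw [e, ← Finset.sum_sub_distrib]
      refine (norm_sum_le _ _).trans ?_
      have h3 : ∀ i ∈ Finset.univ, ‖(χ * ρ i) g.toArr • Φ ⟨z, g⟩ - (χ * ρ i) g.toArr • b i (p z)‖ ≤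
          δ * χ g.toArr * ρ i g.toArr := by
        intro i _
        rw [← smul_sub, norm_smul, ContinuousMap.mul_apply, Real.norm_of_nonneg
          (mul_nonneg (hχ _).1 (ρ.nonneg i _))]
        by_cases hg : g.toArr ∈ V i
        · have := mul_le_mul_of_nonneg_left (hVW i z (h2 i) g hg)
            (mul_nonneg (hχ g.toArr).1 (ρ.nonneg i g.toArr))
          linarith
        · simp [hρV' i _ hg]
      refine (Finset.sum_le_sum h3).trans ?_
      rw [← Finset.mul_sum]
      exact mul_le_of_le_one_right (mul_nonneg hδpos.le (hχ _).1) (hρle _)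
    refine (norm_integral_le_of_norm_le ((hint χ hχc _).const_mul δ)
      (Eventually.of_forall hpt)).trans ?_
    rw [integral_const_mul]
    calc δ * I (p z) ≤ δ * M := by gcongr
      _ = ε := by rw [hδ]; field_simp

end ParametricIntegral

/-! ### The convolution product of compactly supported sections -/

section Convolution

variable {X : Type u} [Groupoid.{v} X] [TopologicalSpace X] [TopologicalSpace (Arr X)]
  {haar : HaarSystem X} {B : X → Type w}
  [∀ x, NonUnitalNormedRing (B x)] [∀ x, NormedSpace ℂ (B x)]
  [∀ x, IsScalarTower ℂ (B x) (B x)] [∀ x, SMulCommClass ℂ (B x) (B x)]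
  [∀ x, CompleteSpace (B x)]
  [TopologicalGroupoid X] [T2Space (Arr X)] [LocallyCompactSpace (Arr X)]
  {β : GBanachAlgebra X B} {N : UnconditionalNorm haar}

namespace CompactSections

@[ext]
theorem ext {ξ η : CompactSections β N} (h : ∀ γ, ξ.val γ = η.val γ) : ξ = η :=
  Subtype.ext (funext h)

@[simp]
theorem val_add (ξ η : CompactSections β N) (γ : Arr X) : (ξ + η).val γ = ξ.val γ + η.val γ := rfl

@[simp]
theorem val_sub (ξ η : CompactSections β N) (γ : Arr X) : (ξ - η).val γ = ξ.val γ - η.val γ := rfl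

@[simp]
theorem val_smul (c : ℂ) (ξ : CompactSections β N) (γ : Arr X) : (c • ξ).val γ = c • ξ.val γ := rfl

@[simp]
theorem val_sum {ι : Type*} (s : Finset ι) (ξ : ι → CompactSections β N) (γ : Arr X) :
    (∑ i ∈ s, ξ i).val γ = ∑ i ∈ s, (ξ i).val γ := by
  classical
  induction s using Finset.induction_on with
  | empty => rfl
  | insert i s hi ih => rw [Finset.sum_insert hi, Finset.sum_insert hi, val_add, ih]

theorem val_mem (ξ : CompactSections β N) :
    ξ.val ∈ β.toUscField.pullbackSections (Arr.tgt : Arr X → X) := ξ.2.1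

/-- The closed support of a section. -/
def supp (ξ : CompactSections β N) : Set (Arr X) := tsupport fun γ => ‖ξ.val γ‖

theorem isCompact_supp (ξ : CompactSections β N) : IsCompact ξ.supp := ξ.2.2

theorem val_eq_zero (ξ : CompactSections β N) {γ : Arr X} (h : γ ∉ ξ.supp) : ξ.val γ = 0 :=
  norm_eq_zero.1 (image_eq_zero_of_notMem_tsupport (f := fun γ => ‖ξ.val γ‖) h)

/-- A continuous section that vanishes off a compact set, as an element of `Γ_c(𝒢, r^*B)`. -/
def ofCompact (f : ∀ γ : Arr X, B γ.tgt)
    (hf : f ∈ β.toUscField.pullbackSections (Arr.tgt : Arr X → X)) {K : Set (Arr X)}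
    (hK : IsCompact K) (h0 : ∀ γ, γ ∉ K → f γ = 0) : CompactSections β N :=
  ⟨f, hf, HasCompactSupport.intro hK fun γ hγ => by rw [h0 γ hγ, norm_zero]⟩

theorem norm_le_of_dominated {ξ : CompactSections β N} {ψ : C_c(Arr X, ℂ)}
    (h : ∀ γ, (ψ γ).im = 0 ∧ ‖ξ.val γ‖ ≤ (ψ γ).re) : ‖ξ‖ ≤ N.norm ψ := N.extended_le h

theorem norm_mono {ξ η : CompactSections β N} (h : ∀ γ, ‖ξ.val γ‖ ≤ ‖η.val γ‖) : ‖ξ‖ ≤ ‖η‖ :=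
  η.le_norm _ fun _ hψ => norm_le_of_dominated fun γ => ⟨(hψ γ).1, (h γ).trans (hψ γ).2⟩

/-- The integrand of the convolution product, a section over the fibre product of the range map
with itself. -/
def convIntegrand (ξ η : CompactSections β N) (w : FibreProduct (Arr.tgt : Arr X → X)) :
    B w.pt.tgt :=
  ξ.val w.arr.toArr *
    β.act w.arr.hom (η.val ⟨w.pt.src, w.arr.src, w.pt.hom ≫ Groupoid.inv w.arr.hom⟩)

theorem convIntegrand_mem (ξ η : CompactSections β N) :
    ξ.convIntegrand η ∈ β.toUscField.pullbackSections
      fun w : FibreProduct (Arr.tgt : Arr X → X) => w.pt.tgt := by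
  refine β.pullbackSections_mul (TopologicalGroupoid.continuous_tgt.comp FibreProduct.continuous_pt)
    (β.pullbackSections_comp ξ.val_mem FibreProduct.continuous_arr)
    (β.pullbackSections_act (a := fun w : FibreProduct (Arr.tgt : Arr X → X) => w.arr.src)
      (b := fun w => w.pt.tgt) (h := fun w => w.arr.hom) FibreProduct.continuous_arr ?_)
  exact β.pullbackSections_comp η.val_mem
    (continuous_arr_div (a := fun w : FibreProduct (Arr.tgt : Arr X → X) => w.pt.src)
      (b := fun w => w.arr.src) (c := fun w => w.pt.tgt) (h := fun w => w.pt.hom)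
      (k := fun w => w.arr.hom) FibreProduct.continuous_pt FibreProduct.continuous_arr)

theorem convIntegrand_eq_zero (ξ η : CompactSections β N)
    (w : FibreProduct (Arr.tgt : Arr X → X)) (h : w.arr.toArr ∉ ξ.supp) :
    ξ.convIntegrand η w = 0 := by
  rw [convIntegrand, ξ.val_eq_zero h, zero_mul]

theorem integrable_convIntegrand (ξ η : CompactSections β N) (γ' : Arr X) :
    Integrable (ε := B γ'.tgt) (fun g : RangeFibre γ'.tgt => ξ.val g.toArr *
      β.act g.hom (η.val ⟨γ'.src, g.src, γ'.hom ≫ Groupoid.inv g.hom⟩)) (haar.measure γ'.tgt) :=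
  β.toUscField.integrable_slice haar (ξ.convIntegrand_mem η) ξ.isCompact_supp
    (ξ.convIntegrand_eq_zero η) γ'

theorem convolution_eq_zero (ξ η : CompactSections β N) {γ' : Arr X}
    (h : γ' ∉ mulSet ξ.supp η.supp) : convolution ξ η γ' = 0 := by
  refine integral_eq_zero_of_ae (Eventually.of_forall fun g => ?_)
  change _ * _ = (0 : B γ'.tgt)
  by_cases h1 : g.toArr ∈ ξ.supp
  · have h2 : (⟨γ'.src, g.src, γ'.hom ≫ Groupoid.inv g.hom⟩ : Arr X) ∉ η.supp := fun h2 =>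
      h (mem_mulSet h1 h2)
    rw [η.val_eq_zero h2, map_zero, mul_zero]
  · rw [ξ.val_eq_zero h1, zero_mul]

/-- The convolution product of two compactly supported sections. -/
noncomputable def conv (ξ η : CompactSections β N) : CompactSections β N :=
  ofCompact (convolution ξ η)
    (β.toUscField.integral_mem_pullbackSections haar TopologicalGroupoid.continuous_tgt
      (ξ.convIntegrand_mem η) ξ.isCompact_supp (ξ.convIntegrand_eq_zero η))
    (isCompact_mulSet ξ.isCompact_supp η.isCompact_supp) fun _ h => ξ.convolution_eq_zero η h

theorem val_conv (ξ η : CompactSections β N) (γ' : Arr X) :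
    (ξ.conv η).val γ' = ∫ g : RangeFibre γ'.tgt, ξ.val g.toArr *
      β.act g.hom (η.val ⟨γ'.src, g.src, γ'.hom ≫ Groupoid.inv g.hom⟩) ∂(haar.measure γ'.tgt) := rfl

theorem conv_add_left (ξ ξ' η : CompactSections β N) :
    (ξ + ξ').conv η = ξ.conv η + ξ'.conv η := by
  ext γ'
  rw [val_add, val_conv, val_conv, val_conv,
    ← integral_add (ξ.integrable_convIntegrand η γ') (ξ'.integrable_convIntegrand η γ')]
  simp only [val_add, add_mul]

theorem conv_add_right (ξ η η' : CompactSections β N) :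
    ξ.conv (η + η') = ξ.conv η + ξ.conv η' := by
  ext γ'
  rw [val_add, val_conv, val_conv, val_conv,
    ← integral_add (ξ.integrable_convIntegrand η γ') (ξ.integrable_convIntegrand η' γ')]
  simp only [val_add, map_add, mul_add]

theorem conv_smul_left (c : ℂ) (ξ η : CompactSections β N) : (c • ξ).conv η = c • ξ.conv η := by
  ext γ'
  rw [val_smul, val_conv, val_conv, ← integral_smul]
  simp only [val_smul, smul_mul_assoc]

theorem conv_smul_right (c : ℂ) (ξ η : CompactSections β N) : ξ.conv (c • η) = c • ξ.conv η := by
  ext γ'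
  rw [val_smul, val_conv, val_conv, ← integral_smul]
  simp only [val_smul, map_smul, mul_smul_comm]

/-- Associativity of the convolution product: Fubini's theorem and the left invariance of the Haar
system. -/
theorem conv_assoc (ξ₁ ξ₂ ξ₃ : CompactSections β N) :
    (ξ₁.conv ξ₂).conv ξ₃ = ξ₁.conv (ξ₂.conv ξ₃) := by
  ext ⟨s, x, h⟩
  -- Both sides are iterated integrals of `ξ₁(δ) δ(ξ₂(δ⁻¹γ)) γ(ξ₃(γ⁻¹γ'))`; on the right this needs
  -- the substitution `γ = δκ` in the inner integral.
  let G : RangeFibre x → RangeFibre x → B x := fun γ δ =>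
    (ξ₁.val δ.toArr * β.act δ.hom (ξ₂.val ⟨γ.src, δ.src, γ.hom ≫ Groupoid.inv δ.hom⟩)) *
      β.act γ.hom (ξ₃.val ⟨s, γ.src, h ≫ Groupoid.inv γ.hom⟩)
  have hl : ((ξ₁.conv ξ₂).conv ξ₃).val ⟨s, x, h⟩ =
      ∫ γ, ∫ δ, G γ δ ∂(haar.measure x) ∂(haar.measure x) := by
    refine integral_congr_ae (Eventually.of_forall fun γ => ?_)
    exact ((((ContinuousLinearMap.mul ℂ (B x)).flip
      (β.act γ.hom (ξ₃.val ⟨s, γ.src, h ≫ Groupoid.inv γ.hom⟩)))).integral_comp_comm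
      (ξ₁.integrable_convIntegrand ξ₂ γ.toArr)).symm
  have hr : (ξ₁.conv (ξ₂.conv ξ₃)).val ⟨s, x, h⟩ =
      ∫ δ, ∫ γ, G γ δ ∂(haar.measure x) ∂(haar.measure x) := by
    refine integral_congr_ae (Eventually.of_forall fun δ => ?_)
    have h1 := (((ContinuousLinearMap.mul ℂ (B x)) (ξ₁.val δ.toArr)).comp
      (β.act δ.hom).toContinuousLinearEquiv.toContinuousLinearMap).integral_comp_comm
      (ξ₂.integrable_convIntegrand ξ₃ ⟨s, δ.src, h ≫ Groupoid.inv δ.hom⟩)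
    refine h1.symm.trans (Eq.trans ?_ (haar.integral_translate δ.hom fun γ => G γ δ))
    refine integral_congr_ae (Eventually.of_forall fun κ => ?_)
    have e1 : (κ.hom ≫ δ.hom) ≫ Groupoid.inv δ.hom = κ.hom := by simp
    have e2 : h ≫ Groupoid.inv (κ.hom ≫ δ.hom) =
        (h ≫ Groupoid.inv δ.hom) ≫ Groupoid.inv κ.hom := by simp
    change ξ₁.val δ.toArr * β.act δ.hom (ξ₂.val κ.toArr * β.act κ.hom
        (ξ₃.val ⟨s, κ.src, (h ≫ Groupoid.inv δ.hom) ≫ Groupoid.inv κ.hom⟩)) =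
      (ξ₁.val δ.toArr * β.act δ.hom
        (ξ₂.val ⟨κ.src, δ.src, (κ.hom ≫ δ.hom) ≫ Groupoid.inv δ.hom⟩)) *
      β.act (κ.hom ≫ δ.hom) (ξ₃.val ⟨s, κ.src, h ≫ Groupoid.inv (κ.hom ≫ δ.hom)⟩)
    rw [e1, e2, β.act_mul, β.act_comp, mul_assoc]
  rw [hl, hr]
  refine integral_integral_swap_of_hasCompactSupport ?_ ?_
  · refine β.toUscField.continuous_of_pullbackSections_const (x := x) ?_
    have c1 : Continuous fun q : RangeFibre x × RangeFibre x => q.1.toArr :=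
      (RangeFibre.continuous_toArr x).comp continuous_fst
    have c2 : Continuous fun q : RangeFibre x × RangeFibre x => q.2.toArr :=
      (RangeFibre.continuous_toArr x).comp continuous_snd
    refine β.pullbackSections_mul continuous_const
      (β.pullbackSections_mul continuous_const (β.pullbackSections_comp ξ₁.val_mem c2)
      (β.pullbackSections_act (a := fun q : RangeFibre x × RangeFibre x => q.2.src)
        (b := fun _ => x) (h := fun q => q.2.hom) c2 ?_))
      (β.pullbackSections_act (a := fun q : RangeFibre x × RangeFibre x => q.1.src)
        (b := fun _ => x) (h := fun q => q.1.hom) c1 ?_)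
    · exact β.pullbackSections_comp ξ₂.val_mem
        (continuous_arr_div (a := fun q : RangeFibre x × RangeFibre x => q.1.src)
        (b := fun q => q.2.src) (c := fun _ => x) (h := fun q => q.1.hom)
        (k := fun q => q.2.hom) c1 c2)
    · exact β.pullbackSections_comp ξ₃.val_mem
        (continuous_arr_div (a := fun _ : RangeFibre x × RangeFibre x => s)
        (b := fun q => q.1.src) (c := fun _ => x) (h := fun _ => h)
        (k := fun q => q.1.hom) continuous_const c1)
  · refine HasCompactSupport.intro
      (((RangeFibre.isClosedEmbedding_toArr x).isCompact_preimage
        (isCompact_mulSet ξ₁.isCompact_supp ξ₂.isCompact_supp)).prod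
        ((RangeFibre.isClosedEmbedding_toArr x).isCompact_preimage ξ₁.isCompact_supp)) ?_
    rintro ⟨γ, δ⟩ hq
    change (_ * _) * _ = (0 : B x)
    by_cases h1 : δ.toArr ∈ ξ₁.supp
    · have h2 : (⟨γ.src, δ.src, γ.hom ≫ Groupoid.inv δ.hom⟩ : Arr X) ∉ ξ₂.supp := fun h2 =>
        hq ⟨mem_mulSet h1 h2, h1⟩
      rw [ξ₂.val_eq_zero h2, map_zero, mul_zero, zero_mul]
    · rw [ξ₁.val_eq_zero h1, zero_mul, zero_mul]

end CompactSections

end Convolution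

/-! ### Submultiplicativity of the norm and the product on the completion -/

section Scalar

variable {X : Type u} [Groupoid.{v} X] [TopologicalSpace X] [TopologicalSpace (Arr X)]

/-- The constant field with fibre `ℂ`, whose sections are the continuous functions. -/
noncomputable def trivialField (X : Type u) [TopologicalSpace X] : UscField X fun _ => ℂ where
  sections :=
    { carrier := {f | Continuous f}
      zero_mem' := continuous_zero
      add_mem' := fun hf hg => Continuous.add hf hg
      smul_mem' := fun c _ hf => Continuous.const_smul hf c }
  dense_eval x := by
    have : {e : ℂ | ∃ ξ : X → ℂ, Continuous ξ ∧ ξ x = e} = Set.univ :=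
      Set.eq_univ_of_forall fun e => ⟨fun _ => e, continuous_const, rfl⟩
    exact this ▸ dense_univ
  upperSemicontinuous_norm ξ hξ := (Continuous.norm hξ).upperSemicontinuous
  mem_of_local ξ h := by
    refine continuous_iff_continuousAt.2 fun x₀ => Metric.continuousAt_iff'.2 fun ε hε => ?_
    obtain ⟨b, hb, h⟩ := h x₀ (ε / 4) (by positivity)
    have h0 := h.self_of_nhds
    have hb : Continuous b := hb
    filter_upwards [h, Metric.continuousAt_iff'.1 hb.continuousAt (ε / 4)
      (by positivity)] with y h h1
    rw [dist_eq_norm] at h1 ⊢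
    have h2 := norm_sub_le_norm_sub_add_norm_sub (ξ y) (b y) (ξ x₀)
    have h3 := norm_sub_le_norm_sub_add_norm_sub (b y) (b x₀) (ξ x₀)
    rw [norm_sub_rev (b x₀)] at h3
    linarith

theorem continuous_of_mem_trivialField_pullbackSections {Y : Type*} [TopologicalSpace Y] {p : Y → X}
    (hp : Continuous p) {ζ : Y → ℂ} (hζ : ζ ∈ (trivialField X).pullbackSections p) : Continuous ζ := by
  refine continuous_iff_continuousAt.2 fun y₀ => Metric.continuousAt_iff'.2 fun ε hε => ?_
  obtain ⟨b, hb, h⟩ := hζ y₀ (ε / 4) (by positivity)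
  have h0 := h.self_of_nhds
  have hb : Continuous b := hb
  filter_upwards [h, Metric.continuousAt_iff'.1 (hb.comp hp).continuousAt (ε / 4)
    (by positivity)] with y h h1
  rw [dist_eq_norm] at h1 ⊢
  change ‖b (p y) - b (p y₀)‖ < _ at h1
  have h2 := norm_sub_le_norm_sub_add_norm_sub (ζ y) (b (p y)) (ζ y₀)
  have h3 := norm_sub_le_norm_sub_add_norm_sub (b (p y)) (b (p y₀)) (ζ y₀)
  rw [norm_sub_rev (b (p y₀))] at h3
  linarith

theorem mem_trivialField_pullbackSections {Y : Type*} [TopologicalSpace Y] {p : Y → X}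
    {ζ : Y → ℂ} (hζ : Continuous ζ) : ζ ∈ (trivialField X).pullbackSections p := fun y₀ ε hε => by
  refine ⟨fun _ => ζ y₀, continuous_const (X := X), ?_⟩
  filter_upwards [Metric.continuousAt_iff'.1 hζ.continuousAt ε hε] with y h
  rw [dist_eq_norm] at h
  exact h.le

variable [TopologicalGroupoid X]

/-- The trivial `𝒢`-Banach algebra `ℂ`, for which `Γ_c(𝒢, r^*B)` is `C_c(𝒢)`. -/
noncomputable def trivialAlgebra (X : Type u) [Groupoid.{v} X] [TopologicalSpace X] [TopologicalSpace (Arr X)]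
    [TopologicalGroupoid X] : GBanachAlgebra X fun _ => ℂ where
  toUscField := trivialField X
  mul_mem _ hξ _ hη := Continuous.mul hξ hη
  act _ := LinearIsometryEquiv.refl ℂ ℂ
  act_id _ _ := rfl
  act_comp _ _ _ := rfl
  act_mul _ _ _ := rfl
  act_continuous _ hζ := mem_trivialField_pullbackSections
    (continuous_of_mem_trivialField_pullbackSections TopologicalGroupoid.continuous_src hζ)

variable [T2Space (Arr X)] [LocallyCompactSpace (Arr X)] {haar : HaarSystem X}

/-- A function in `C_c(𝒢)`, as a section of the trivial bundle. -/
noncomputable def scalarSection (N : UnconditionalNorm haar) (f : C_c(Arr X, ℂ)) :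
    CompactSections (trivialAlgebra X) N :=
  CompactSections.ofCompact f (mem_trivialField_pullbackSections f.continuous) f.hasCompactSupport
    fun _ h => image_eq_zero_of_notMem_tsupport h

/-- The convolution product on `C_c(𝒢)`. -/
noncomputable def scalarConv (N : UnconditionalNorm haar) (f g : C_c(Arr X, ℂ)) :
    C_c(Arr X, ℂ) where
  toFun := ((scalarSection N f).conv (scalarSection N g)).val
  continuous_toFun := continuous_of_mem_trivialField_pullbackSections
    TopologicalGroupoid.continuous_tgt
    (CompactSections.val_mem ((scalarSection N f).conv (scalarSection N g)))
  hasCompactSupport' := HasCompactSupport.intro (CompactSections.isCompact_supp _)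
    fun _ h => CompactSections.val_eq_zero _ h

theorem scalarConv_apply (N : UnconditionalNorm haar) (f g : C_c(Arr X, ℂ)) (γ' : Arr X) :
    scalarConv N f g γ' = scalarConvolution haar f g γ' := rfl

/-- An integrand that is dominated by the integrand of a convolution of functions in `C_c(𝒢)` has
an integral dominated by that convolution. -/
theorem norm_integral_le_scalarConv (N : UnconditionalNorm haar) {ψ₁ ψ₂ : C_c(Arr X, ℂ)}
    (h₁ : ∀ γ, (ψ₁ γ).im = 0) (h₂ : ∀ γ, (ψ₂ γ).im = 0) (γ' : Arr X) {E : Type*}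
    [NormedAddCommGroup E] [NormedSpace ℝ E] {G : RangeFibre γ'.tgt → E} {ε : ℝ}
    (hG : ∀ g, ‖G g‖ ≤
      ε * ((ψ₁ g.toArr).re * (ψ₂ ⟨γ'.src, g.src, γ'.hom ≫ Groupoid.inv g.hom⟩).re)) :
    (scalarConv N ψ₁ ψ₂ γ').im = 0 ∧
      ‖∫ g, G g ∂(haar.measure γ'.tgt)‖ ≤ ε * (scalarConv N ψ₁ ψ₂ γ').re := by
  have hint : Integrable (fun g : RangeFibre γ'.tgt => ψ₁ g.toArr *
      ψ₂ ⟨γ'.src, g.src, γ'.hom ≫ Groupoid.inv g.hom⟩) (haar.measure γ'.tgt) :=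
    (scalarSection N ψ₁).integrable_convIntegrand (scalarSection N ψ₂) γ'
  have hre : ∀ g : RangeFibre γ'.tgt,
      ψ₁ g.toArr * ψ₂ ⟨γ'.src, g.src, γ'.hom ≫ Groupoid.inv g.hom⟩ =
      (((ψ₁ g.toArr).re * (ψ₂ ⟨γ'.src, g.src, γ'.hom ≫ Groupoid.inv g.hom⟩).re : ℝ) : ℂ) :=
    fun g => by
      apply Complex.ext
      · simp [h₁, h₂]
      · simp [h₁, h₂]
  have hval : scalarConv N ψ₁ ψ₂ γ' = ((∫ g : RangeFibre γ'.tgt, (ψ₁ g.toArr).re *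
      (ψ₂ ⟨γ'.src, g.src, γ'.hom ≫ Groupoid.inv g.hom⟩).re ∂(haar.measure γ'.tgt) : ℝ) : ℂ) := by
    rw [scalarConv_apply, scalarConvolution, ← integral_complex_ofReal]
    exact integral_congr_ae (Eventually.of_forall hre)
  have hint' : Integrable (fun g : RangeFibre γ'.tgt => (ψ₁ g.toArr).re *
      (ψ₂ ⟨γ'.src, g.src, γ'.hom ≫ Groupoid.inv g.hom⟩).re) (haar.measure γ'.tgt) := by
    refine hint.re.congr (Eventually.of_forall fun g => ?_)
    change RCLike.re (ψ₁ g.toArr * ψ₂ _) = _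
    rw [hre g]
    exact Complex.ofReal_re _
  rw [hval, Complex.ofReal_im, Complex.ofReal_re]
  refine ⟨rfl, ?_⟩
  rw [← integral_const_mul]
  exact norm_integral_le_of_norm_le (hint'.const_mul ε) (Eventually.of_forall hG)

variable {B : X → Type w}
  [∀ x, NonUnitalNormedRing (B x)] [∀ x, NormedSpace ℂ (B x)]
  [∀ x, IsScalarTower ℂ (B x) (B x)] [∀ x, SMulCommClass ℂ (B x) (B x)]
  [∀ x, CompleteSpace (B x)] {β : GBanachAlgebra X B} {N : UnconditionalNorm haar}

theorem CompactSections.norm_conv_le (ξ η : CompactSections β N) : ‖ξ.conv η‖ ≤ ‖ξ‖ * ‖η‖ := by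
  have h1 : ∀ ψ₁ ψ₂ : C_c(Arr X, ℂ), (∀ γ, (ψ₁ γ).im = 0 ∧ ‖ξ.val γ‖ ≤ (ψ₁ γ).re) →
      (∀ γ, (ψ₂ γ).im = 0 ∧ ‖η.val γ‖ ≤ (ψ₂ γ).re) → ‖ξ.conv η‖ ≤ N.norm ψ₁ * N.norm ψ₂ := by
    intro ψ₁ ψ₂ h₁ h₂
    refine (norm_le_of_dominated fun γ' => ?_).trans
      (N.submultiplicative ψ₁ ψ₂ (scalarConv N ψ₁ ψ₂) fun γ => rfl)
    rw [val_conv, ← one_mul (scalarConv N ψ₁ ψ₂ γ').re]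
    refine norm_integral_le_scalarConv N (fun γ => (h₁ γ).1) (fun γ => (h₂ γ).1) γ' fun g => ?_
    rw [one_mul]
    refine (norm_mul_le _ _).trans ?_
    rw [LinearIsometryEquiv.norm_map]
    exact mul_le_mul (h₁ _).2 (h₂ _).2 (norm_nonneg _) ((norm_nonneg _).trans (h₁ _).2)
  -- Pass to the infimum over the dominating functions, one factor at a time.
  have key : ∀ (c a b : ℝ), 0 ≤ b → 0 ≤ a → (∀ r > a, c ≤ r * b) → c ≤ a * b := by
    intro c a b hb ha h
    refine le_of_forall_pos_le_add fun ε hε => ?_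
    have := h (a + ε / (b + 1)) (by have : 0 < ε / (b + 1) := by positivity
                                    linarith)
    have h2 : ε / (b + 1) * b ≤ ε := by
      rw [div_mul_eq_mul_div, div_le_iff₀ (by positivity)]; nlinarith
    nlinarith
  have happrox : ∀ ζ : CompactSections β N, ∀ r > ‖ζ‖, ∃ ψ : C_c(Arr X, ℂ),
      (∀ γ, (ψ γ).im = 0 ∧ ‖ζ.val γ‖ ≤ (ψ γ).re) ∧ N.norm ψ ≤ r := by
    intro ζ r hr
    by_contra! hcon
    exact absurd (ζ.le_norm r fun ψ hψ => (hcon ψ hψ).le) (not_le.2 hr)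
  refine key _ _ _ (norm_nonneg _) (norm_nonneg _) fun r hr => ?_
  obtain ⟨ψ₁, h₁, hr₁⟩ := happrox ξ r hr
  rw [mul_comm]
  refine key _ _ _ ((norm_nonneg _).trans hr.le) (norm_nonneg _) fun t ht => ?_
  obtain ⟨ψ₂, h₂, ht₂⟩ := happrox η t ht
  refine (h1 ψ₁ ψ₂ h₁ h₂).trans ?_
  rw [mul_comm]
  exact mul_le_mul ht₂ hr₁ (apply_nonneg _ _) ((norm_nonneg _).trans ht.le)

end Scalar

section Completion

/-- A contractive bilinear map of seminormed spaces extends to the completions. -/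
theorem exists_completion_bilinear {E F G : Type*} [SeminormedAddCommGroup E] [NormedSpace ℂ E]
    [SeminormedAddCommGroup F] [NormedSpace ℂ F] [NormedAddCommGroup G] [NormedSpace ℂ G]
    [CompleteSpace G] (f : E →ₗ[ℂ] F →ₗ[ℂ] G) (hf : ∀ x y, ‖f x y‖ ≤ ‖x‖ * ‖y‖) :
    ∃ g : UniformSpace.Completion E →L[ℂ] UniformSpace.Completion F →L[ℂ] G,
      (∀ (x : E) (y : F), g x y = f x y) ∧ ∀ a b, ‖g a b‖ ≤ ‖a‖ * ‖b‖ := by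
  let f₁ : E →L[ℂ] F →L[ℂ] G := f.mkContinuous₂ 1 fun x y => by rw [one_mul]; exact hf x y
  let f₂ : UniformSpace.Completion E →L[ℂ] F →L[ℂ] G :=
    f₁.extend UniformSpace.Completion.toComplL
  let f₃ : UniformSpace.Completion F →L[ℂ] UniformSpace.Completion E →L[ℂ] G :=
    f₂.flip.extend UniformSpace.Completion.toComplL
  have hE : ∀ x : E, f₂ (x : UniformSpace.Completion E) = f₁ x := fun x =>
    ContinuousLinearMap.extend_eq f₁ (e := UniformSpace.Completion.toComplL)
      UniformSpace.Completion.denseRange_coe (UniformSpace.Completion.isUniformInducing_coe E) x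
  have hF : ∀ y : F, f₃ (y : UniformSpace.Completion F) = f₂.flip y := fun y =>
    ContinuousLinearMap.extend_eq f₂.flip (e := UniformSpace.Completion.toComplL)
      UniformSpace.Completion.denseRange_coe (UniformSpace.Completion.isUniformInducing_coe F) y
  have hval : ∀ (x : E) (y : F), f₃.flip x y = f x y := by
    intro x y
    rw [ContinuousLinearMap.flip_apply, hF, ContinuousLinearMap.flip_apply, hE]
    rfl
  refine ⟨f₃.flip, hval, fun a b => ?_⟩
  induction a, b using UniformSpace.Completion.induction_on₂ with
  | hp => exact isClosed_le (by fun_prop) (by fun_prop)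
  | ih x y =>
    rw [hval, UniformSpace.Completion.norm_coe, UniformSpace.Completion.norm_coe]
    exact hf x y

variable {X : Type u} [Groupoid.{v} X] [TopologicalSpace X] [TopologicalSpace (Arr X)]
  {haar : HaarSystem X} {B : X → Type w}
  [∀ x, NonUnitalNormedRing (B x)] [∀ x, NormedSpace ℂ (B x)]
  [∀ x, IsScalarTower ℂ (B x) (B x)] [∀ x, SMulCommClass ℂ (B x) (B x)]
  [∀ x, CompleteSpace (B x)]
  [TopologicalGroupoid X] [T2Space (Arr X)] [LocallyCompactSpace (Arr X)]

/-- The convolution product extends to the completion `𝒜(𝒢, B)`. -/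
theorem nonempty_convolutionProduct (β : GBanachAlgebra X B) (N : UnconditionalNorm haar) :
    Nonempty (ConvolutionProduct β N) := by
  let f : CompactSections β N →ₗ[ℂ] CompactSections β N →ₗ[ℂ] Descent β N :=
    (LinearMap.mk₂ ℂ CompactSections.conv CompactSections.conv_add_left
      CompactSections.conv_smul_left CompactSections.conv_add_right
      CompactSections.conv_smul_right).compr₂
      (UniformSpace.Completion.toComplₗᵢ (𝕜 := ℂ) (E := CompactSections β N)).toLinearMap
  have hfv : ∀ ξ η, f ξ η = ((ξ.conv η : CompactSections β N) : Descent β N) := fun _ _ => rfl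
  obtain ⟨g, hg, hle⟩ := exists_completion_bilinear f fun ξ η => by
    rw [hfv, UniformSpace.Completion.norm_coe]; exact ξ.norm_conv_le η
  refine ⟨⟨g, fun a b c => ?_, hle, fun ξ η => ⟨ξ.conv η, fun _ => rfl, hg ξ η⟩⟩⟩
  induction a, b, c using UniformSpace.Completion.induction_on₃ with
  | hp => exact isClosed_eq (by fun_prop) (by fun_prop)
  | ih ξ₁ ξ₂ ξ₃ =>
    rw [hg, hg, hfv, hfv, hg, hg, hfv, hfv, CompactSections.conv_assoc]

variable {β : GBanachAlgebra X B} {N : UnconditionalNorm haar}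

theorem ConvolutionProduct.ofSection_mul (m : ConvolutionProduct β N)
    (ξ η : CompactSections β N) :
    m.ofSection ξ * m.ofSection η = m.ofSection (ξ.conv η) := by
  obtain ⟨ζ, h1, h2⟩ := m.mul_coe ξ η
  have : ζ = ξ.conv η := CompactSections.ext h1
  exact h2.trans (by rw [this]; rfl)

theorem ConvolutionProduct.denseRange_ofSection (m : ConvolutionProduct β N) :
    DenseRange m.ofSection := UniformSpace.Completion.denseRange_coe

theorem ConvolutionProduct.isUniformInducing_ofSection (m : ConvolutionProduct β N) :
    IsUniformInducing m.ofSection := UniformSpace.Completion.isUniformInducing_coe _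

theorem ConvolutionProduct.norm_ofSection (m : ConvolutionProduct β N)
    (ξ : CompactSections β N) : ‖m.ofSection ξ‖ = ‖ξ‖ := UniformSpace.Completion.norm_coe ξ

/-- The canonical map `Γ_c(𝒢, r^*B) → 𝒜(𝒢, B)` as a linear isometry. -/
noncomputable def ConvolutionProduct.ofSectionₗᵢ (m : ConvolutionProduct β N) :
    CompactSections β N →ₗᵢ[ℂ] m.Algebra :=
  (UniformSpace.Completion.toComplₗᵢ : CompactSections β N →ₗᵢ[ℂ] Descent β N)

/-- A contraction of spaces of sections extends to the completions. -/
theorem ConvolutionProduct.exists_extension (m : ConvolutionProduct β N) {G : Type*}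
    [NormedAddCommGroup G] [NormedSpace ℂ G] [CompleteSpace G]
    (T : CompactSections β N →ₗ[ℂ] G) (hT : ∀ ξ, ‖T ξ‖ ≤ ‖ξ‖) :
    ∃ S : m.Algebra →L[ℂ] G, ∀ ξ, S (m.ofSection ξ) = T ξ :=
  ⟨(T.mkContinuous 1 fun ξ => by rw [one_mul]; exact hT ξ).extend
      m.ofSectionₗᵢ.toContinuousLinearMap, fun ξ =>
    ContinuousLinearMap.extend_eq _ (e := m.ofSectionₗᵢ.toContinuousLinearMap)
      m.denseRange_ofSection m.isUniformInducing_ofSection ξ⟩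

end Completion

/-! ### Extension by zero from an open and closed subset of the unit space -/

section Extension

variable {X : Type u} [Groupoid.{v} X] [TopologicalSpace X] [TopologicalSpace (Arr X)]
  {haar : HaarSystem X} {B : X → Type w}
  [∀ x, NonUnitalNormedRing (B x)] [∀ x, NormedSpace ℂ (B x)]
  [∀ x, IsScalarTower ℂ (B x) (B x)] [∀ x, SMulCommClass ℂ (B x) (B x)]
  [∀ x, CompleteSpace (B x)]
  [TopologicalGroupoid X] [T2Space (Arr X)] [LocallyCompactSpace (Arr X)]
  {β : GBanachAlgebra X B} {N : UnconditionalNorm haar} {U : TopologicalSpace.Opens X}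

theorem isClosed_src_tgt_mem (hU : IsClosed (U : Set X)) :
    IsClosed {γ : Arr X | γ.src ∈ U ∧ γ.tgt ∈ U} :=
  (hU.preimage TopologicalGroupoid.continuous_src).inter
    (hU.preimage TopologicalGroupoid.continuous_tgt)

theorem Arr.isClosedEmbedding_incl (hU : IsClosed (U : Set X)) :
    IsClosedEmbedding (Arr.incl : Arr (Restrict U) → Arr X) := by
  refine ⟨Arr.isOpenEmbedding_incl.isEmbedding, ?_⟩
  have : Set.range (Arr.incl : Arr (Restrict U) → Arr X) = {γ : Arr X | γ.src ∈ U ∧ γ.tgt ∈ U} :=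
    Set.ext fun γ => Arr.mem_range_incl γ
  rw [this]
  exact isClosed_src_tgt_mem hU

theorem integral_incl (haar : HaarSystem X) {x : Restrict U} {E : Type*} [NormedAddCommGroup E]
    [NormedSpace ℝ E] (F : RangeFibre x.val → E) (hF : ∀ g, g.src ∉ U → F g = 0) :
    ∫ g : RangeFibre x, F g.incl ∂((haar.restrict U).measure x) =
      ∫ g, F g ∂(haar.measure x.val) := by
  have he : MeasurableEmbedding (RangeFibre.incl : RangeFibre x → RangeFibre x.val) :=
    RangeFibre.isOpenEmbedding_incl.measurableEmbedding
  change ∫ g : RangeFibre x, F g.incl ∂((haar.measure x.val).comap RangeFibre.incl) = _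
  rw [← he.integral_map, he.map_comap]
  exact setIntegral_eq_integral_of_forall_compl_eq_zero fun g hg =>
    hF g fun h => hg ((RangeFibre.mem_range_incl g).2 h)

namespace CompactSections

open scoped Classical in
/-- The values of the extension of a section by zero. -/
noncomputable def extendVal (ξ : CompactSections (β.restrict U) (N.restrict U)) (γ : Arr X) :
    B γ.tgt :=
  if h : γ.src ∈ U ∧ γ.tgt ∈ U then
    ξ.val (⟨⟨γ.src, h.1⟩, ⟨γ.tgt, h.2⟩, γ.hom⟩ : Arr (Restrict U))
  else 0

theorem extendVal_incl (ξ : CompactSections (β.restrict U) (N.restrict U))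
    (δ : Arr (Restrict U)) : ξ.extendVal δ.incl = ξ.val δ :=
  dif_pos ⟨δ.src.val_mem, δ.tgt.val_mem⟩

theorem extendVal_eq_zero (ξ : CompactSections (β.restrict U) (N.restrict U)) {γ : Arr X}
    (h : γ.src ∉ U ∨ γ.tgt ∉ U) : ξ.extendVal γ = 0 :=
  dif_neg (by tauto)

theorem extendVal_mem (hU : IsClosed (U : Set X))
    (ξ : CompactSections (β.restrict U) (N.restrict U)) :
    ξ.extendVal ∈ β.toUscField.pullbackSections (Arr.tgt : Arr X → X) := by
  intro γ₀ ε hε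
  by_cases h : γ₀.src ∈ U ∧ γ₀.tgt ∈ U
  · obtain ⟨δ₀, rfl⟩ := (Arr.mem_range_incl γ₀).2 h
    obtain ⟨b, hb, h1⟩ := ξ.val_mem δ₀ (ε / 2) (by positivity)
    obtain ⟨c, hc, h2⟩ := hb δ₀.tgt (ε / 2) (by positivity)
    refine ⟨c, hc, ?_⟩
    rw [← Arr.isOpenEmbedding_incl.map_nhds_eq, eventually_map]
    filter_upwards [h1, (TopologicalGroupoid.continuous_tgt (X := Restrict U)).continuousAt.eventually
      h2] with δ h1 h2
    rw [extendVal_incl]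
    have := norm_sub_le_norm_sub_add_norm_sub (ξ.val δ) (b δ.tgt) (c δ.tgt.val)
    exact this.trans (by linarith)
  · refine ⟨0, β.sections.zero_mem, ?_⟩
    filter_upwards [(isClosed_src_tgt_mem hU).isOpen_compl.mem_nhds h] with γ hγ
    have h0 : ξ.extendVal γ = 0 := dif_neg hγ
    rw [h0, Pi.zero_apply, sub_zero, norm_zero]
    exact hε.le

/-- The extension of a section by zero. -/
noncomputable def extend (hU : IsClosed (U : Set X))
    (ξ : CompactSections (β.restrict U) (N.restrict U)) : CompactSections β N :=
  ofCompact ξ.extendVal (ξ.extendVal_mem hU)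
    (ξ.isCompact_supp.image Arr.isInducing_incl.continuous) fun γ hγ => by
      by_cases h : γ.src ∈ U ∧ γ.tgt ∈ U
      · obtain ⟨δ, rfl⟩ := (Arr.mem_range_incl γ).2 h
        rw [extendVal_incl]
        exact ξ.val_eq_zero fun h => hγ ⟨δ, h, rfl⟩
      · exact dif_neg h

variable (hU : IsClosed (U : Set X))

theorem val_extend_incl (ξ : CompactSections (β.restrict U) (N.restrict U))
    (δ : Arr (Restrict U)) : (ξ.extend hU).val δ.incl = ξ.val δ := ξ.extendVal_incl δ

theorem val_extend_eq_zero (ξ : CompactSections (β.restrict U) (N.restrict U)) {γ : Arr X}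
    (h : γ.src ∉ U ∨ γ.tgt ∉ U) : (ξ.extend hU).val γ = 0 := ξ.extendVal_eq_zero h

theorem isExtensionByZero_extend (ξ : CompactSections (β.restrict U) (N.restrict U)) :
    IsExtensionByZero ξ (ξ.extend hU) :=
  ⟨ξ.val_extend_incl hU, fun _ h => ξ.val_extend_eq_zero hU h⟩

/-- Sections over `𝒢` agree if they agree on `𝒢_U^U` and vanish elsewhere. -/
theorem ext_of_incl {ζ ζ' : CompactSections β N}
    (h : ∀ δ : Arr (Restrict U), ζ.val δ.incl = ζ'.val δ.incl)
    (h0 : ∀ γ : Arr X, (γ.src ∉ U ∨ γ.tgt ∉ U) → ζ.val γ = 0)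
    (h0' : ∀ γ : Arr X, (γ.src ∉ U ∨ γ.tgt ∉ U) → ζ'.val γ = 0) : ζ = ζ' := by
  ext γ
  by_cases hγ : γ.src ∈ U ∧ γ.tgt ∈ U
  · obtain ⟨δ, rfl⟩ := (Arr.mem_range_incl γ).2 hγ
    exact h δ
  · rw [h0 γ (by tauto), h0' γ (by tauto)]

/-- The restriction of a section to `𝒢_U^U`. -/
noncomputable def restrict (ζ : CompactSections β N) : CompactSections (β.restrict U) (N.restrict U) :=
  ofCompact (β := β.restrict U) (fun δ : Arr (Restrict U) => ζ.val δ.incl)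
    (fun δ₀ ε hε => by
      obtain ⟨c, hc, h⟩ := ζ.val_mem δ₀.incl ε hε
      exact ⟨fun u => c u.val, β.toUscField.pullbackSections_of_sections hc Restrict.val,
        Arr.isInducing_incl.continuous.continuousAt.eventually h⟩)
    ((Arr.isClosedEmbedding_incl hU).isCompact_preimage ζ.isCompact_supp)
    fun _ h => ζ.val_eq_zero h

theorem val_restrict (ζ : CompactSections β N) (δ : Arr (Restrict U)) :
    (ζ.restrict hU).val δ = ζ.val δ.incl := rfl

theorem norm_extend (ξ : CompactSections (β.restrict U) (N.restrict U)) :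
    ‖ξ.extend hU‖ = ‖ξ‖ := by
  refine le_antisymm (ξ.le_norm _ fun ψ hψ => ?_) ((ξ.extend hU).le_norm _ fun ψ hψ => ?_)
  · refine norm_le_of_dominated (ψ := extendByZero U ψ) fun γ => ?_
    by_cases hγ : γ.src ∈ U ∧ γ.tgt ∈ U
    · obtain ⟨δ, rfl⟩ := (Arr.mem_range_incl γ).2 hγ
      rw [extendByZero_incl, val_extend_incl]
      exact hψ δ
    · rw [extendByZero_of_notMem ψ γ (by tauto), val_extend_eq_zero hU ξ (by tauto), norm_zero]
      exact ⟨rfl, le_rfl⟩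
  · let ψ' : C_c(Arr (Restrict U), ℂ) :=
      ⟨⟨fun δ => ψ δ.incl, ψ.continuous.comp Arr.isInducing_incl.continuous⟩,
        ψ.hasCompactSupport.comp_isClosedEmbedding (Arr.isClosedEmbedding_incl hU)⟩
    have h1 : ‖ξ‖ ≤ (N.restrict U).norm ψ' := norm_le_of_dominated fun δ => by
      have := hψ δ.incl
      rw [val_extend_incl] at this
      exact this
    refine h1.trans (N.unconditional (extendByZero U ψ') ψ fun γ => ?_)
    by_cases hγ : γ.src ∈ U ∧ γ.tgt ∈ U
    · obtain ⟨δ, rfl⟩ := (Arr.mem_range_incl γ).2 hγ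
      rw [extendByZero_incl]
      exact le_rfl
    · rw [extendByZero_of_notMem ψ' γ (by tauto), norm_zero]
      exact norm_nonneg _

/-- Extension by zero as a linear map. -/
noncomputable def extendₗ :
    CompactSections (β.restrict U) (N.restrict U) →ₗ[ℂ] CompactSections β N where
  toFun ξ := ξ.extend hU
  map_add' ξ η := by
    refine ext_of_incl (fun δ => ?_) (fun γ h => val_extend_eq_zero hU _ h) fun γ h => ?_
    · rw [val_add, val_extend_incl, val_extend_incl, val_extend_incl]; rfl
    · rw [val_add, val_extend_eq_zero hU _ h, val_extend_eq_zero hU _ h, add_zero]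
  map_smul' c ξ := by
    refine ext_of_incl (fun δ => ?_) (fun γ h => val_extend_eq_zero hU _ h) fun γ h => ?_
    · rw [RingHom.id_apply, val_smul, val_extend_incl, val_extend_incl]; rfl
    · rw [RingHom.id_apply, val_smul, val_extend_eq_zero hU _ h, smul_zero]

theorem extend_conv (ξ η : CompactSections (β.restrict U) (N.restrict U)) :
    (ξ.conv η).extend hU = (ξ.extend hU).conv (η.extend hU) := by
  refine ext_of_incl (fun δ => ?_) (fun γ h => val_extend_eq_zero hU _ h) fun γ h => ?_
  · have h := integral_incl (x := δ.tgt) haar (E := B δ.tgt.val)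
      (fun g => (ξ.extend hU).val g.toArr * β.act g.hom
        ((η.extend hU).val ⟨δ.src.val, g.src,
          CategoryStruct.comp (obj := X) δ.hom (Groupoid.inv (obj := X) g.hom)⟩)) fun g hg => by
      rw [val_extend_eq_zero hU ξ (γ := g.toArr) (Or.inl hg)]
      exact zero_mul _
    rw [val_extend_incl]
    change @Eq (B δ.tgt.val) _ _
    refine Eq.trans ?_ h
    refine integral_congr_ae (Eventually.of_forall fun g => ?_)
    have h1 := ξ.val_extend_incl hU g.toArr
    have h2 := η.val_extend_incl hU ⟨δ.src, g.src, δ.hom ≫ Groupoid.inv g.hom⟩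
    exact congrArg₂ (· * ·) h1.symm
      (congrArg (β.act (x := g.src.val) (y := δ.tgt.val) g.hom) h2.symm)
  · rw [val_conv]
    refine integral_eq_zero_of_ae (Eventually.of_forall fun g => ?_)
    change _ * _ = (0 : B γ.tgt)
    rcases h with h | h
    · rw [val_extend_eq_zero hU η (γ := ⟨γ.src, g.src, γ.hom ≫ Groupoid.inv g.hom⟩) (Or.inl h),
        map_zero, mul_zero]
    · rw [val_extend_eq_zero hU ξ (γ := g.toArr) (Or.inr h), zero_mul]

end CompactSections

/-- Extension by zero induces an isometric homomorphism of Banach algebras. -/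
theorem exists_extensionHom (hU : IsClosed (U : Set X)) (𝒜 : ConvolutionProduct β N)
    (𝒜U : ConvolutionProduct (β.restrict U) (N.restrict U)) :
    ∃ J : 𝒜U.Algebra →ₙₐ[ℂ] 𝒜.Algebra, Isometry J ∧
      ∀ ξ, J (𝒜U.ofSection ξ) = 𝒜.ofSection (ξ.extend hU) := by
  obtain ⟨S, hS⟩ := 𝒜U.exists_extension
    (𝒜.ofSectionₗᵢ.toLinearMap ∘ₗ CompactSections.extendₗ hU) fun ξ => by
      change ‖𝒜.ofSection (ξ.extend hU)‖ ≤ _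
      rw [𝒜.norm_ofSection, ξ.norm_extend]
  have hS' : ∀ ξ, S (𝒜U.ofSection ξ) = 𝒜.ofSection (ξ.extend hU) := hS
  have hnorm : ∀ a, ‖S a‖ = ‖a‖ := by
    refine fun a => 𝒜U.denseRange_ofSection.induction_on (p := fun a => ‖S a‖ = ‖a‖) a
      (isClosed_eq (by fun_prop) (by fun_prop)) fun ξ => ?_
    rw [hS', 𝒜.norm_ofSection, 𝒜U.norm_ofSection, ξ.norm_extend]
  have hmul : ∀ a b, S (a * b) = S a * S b := by
    refine fun a b => 𝒜U.denseRange_ofSection.induction_on₂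
      (p := fun a b => S (a * b) = S a * S b) (isClosed_eq (by fun_prop) (by fun_prop))
      (fun ξ η => ?_) a b
    rw [𝒜U.ofSection_mul, hS', hS', hS', 𝒜.ofSection_mul, CompactSections.extend_conv]
  exact ⟨{ toFun := S, map_smul' := map_smul S, map_zero' := map_zero S, map_add' := map_add S,
           map_mul' := hmul }, AddMonoidHomClass.isometry_of_norm S hnorm, hS'⟩

end Extension

/-! ### The idempotent multiplier -/

section Multiplier

variable {X : Type u} [Groupoid.{v} X] [TopologicalSpace X] [TopologicalSpace (Arr X)]
  {haar : HaarSystem X} {B : X → Type w}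
  [∀ x, NonUnitalNormedRing (B x)] [∀ x, NormedSpace ℂ (B x)]
  [∀ x, IsScalarTower ℂ (B x) (B x)] [∀ x, SMulCommClass ℂ (B x) (B x)]
  [∀ x, CompleteSpace (B x)]
  [TopologicalGroupoid X] [T2Space (Arr X)] [LocallyCompactSpace (Arr X)]
  {β : GBanachAlgebra X B} {N : UnconditionalNorm haar} {U : TopologicalSpace.Opens X}

/-- A continuous function on the unit space, pulled back along the range map. -/
noncomputable def compTgt (χ : C(X, ℂ)) : C(Arr X, ℂ) := χ.comp ⟨Arr.tgt, TopologicalGroupoid.continuous_tgt⟩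

/-- A continuous function on the unit space, pulled back along the source map. -/
noncomputable def compSrc (χ : C(X, ℂ)) : C(Arr X, ℂ) := χ.comp ⟨Arr.src, TopologicalGroupoid.continuous_src⟩

/-- The characteristic function of an open and closed subset of the unit space. -/
noncomputable def clopenIndicator (hU : IsClosed (U : Set X)) : C(X, ℂ) where
  toFun := (U : Set X).indicator 1
  continuous_toFun := (IsClopen.continuous_indicator ⟨hU, U.isOpen⟩ continuous_one)

theorem clopenIndicator_of_mem (hU : IsClosed (U : Set X)) {x : X} (hx : x ∈ U) :
    clopenIndicator hU x = 1 := Set.indicator_of_mem (s := (U : Set X)) hx _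

theorem clopenIndicator_of_notMem (hU : IsClosed (U : Set X)) {x : X} (hx : x ∉ U) :
    clopenIndicator hU x = 0 := Set.indicator_of_notMem (s := (U : Set X)) hx _

theorem norm_clopenIndicator_le (hU : IsClosed (U : Set X)) (x : X) :
    ‖clopenIndicator hU x‖ ≤ 1 := by
  by_cases hx : x ∈ U
  · rw [clopenIndicator_of_mem hU hx, norm_one]
  · rw [clopenIndicator_of_notMem hU hx, norm_zero]; exact zero_le_one

theorem clopenIndicator_mul_self (hU : IsClosed (U : Set X)) (x : X) :
    clopenIndicator hU x * clopenIndicator hU x = clopenIndicator hU x := by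
  by_cases hx : x ∈ U
  · rw [clopenIndicator_of_mem hU hx, one_mul]
  · rw [clopenIndicator_of_notMem hU hx, zero_mul]

namespace CompactSections

/-- The product of a section with a continuous scalar function on the groupoid. -/
noncomputable def mulFun (φ : C(Arr X, ℂ)) : CompactSections β N →ₗ[ℂ] CompactSections β N where
  toFun ξ := ofCompact (fun γ => φ γ • ξ.val γ)
    (β.toUscField.pullbackSections_smul TopologicalGroupoid.continuous_tgt φ.continuous ξ.val_mem)
    ξ.isCompact_supp fun γ h => by rw [ξ.val_eq_zero h, smul_zero]
  map_add' ξ η := by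
    ext γ
    exact smul_add _ _ _
  map_smul' c ξ := by
    ext γ
    exact smul_comm _ _ _

@[simp]
theorem val_mulFun (φ : C(Arr X, ℂ)) (ξ : CompactSections β N) (γ : Arr X) :
    (mulFun φ ξ).val γ = φ γ • ξ.val γ := rfl

theorem norm_mulFun_le {φ : C(Arr X, ℂ)} (hφ : ∀ γ, ‖φ γ‖ ≤ 1) (ξ : CompactSections β N) :
    ‖mulFun φ ξ‖ ≤ ‖ξ‖ := norm_mono fun γ => by
  rw [val_mulFun, norm_smul]
  exact mul_le_of_le_one_left (norm_nonneg _) (hφ γ)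

theorem mulFun_tgt_conv (χ : C(X, ℂ)) (ξ η : CompactSections β N) :
    (mulFun (compTgt χ) ξ).conv η = mulFun (compTgt χ) (ξ.conv η) := by
  ext γ'
  rw [val_mulFun, val_conv, val_conv, ← integral_smul]
  exact integral_congr_ae (Eventually.of_forall fun g => smul_mul_assoc _ _ _)

theorem conv_mulFun_src (χ : C(X, ℂ)) (ξ η : CompactSections β N) :
    ξ.conv (mulFun (compSrc χ) η) = mulFun (compSrc χ) (ξ.conv η) := by
  ext γ'
  rw [val_mulFun, val_conv, val_conv, ← integral_smul]
  refine integral_congr_ae (Eventually.of_forall fun g => ?_)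
  simp only [val_mulFun, map_smul, mul_smul_comm]
  rfl

theorem mulFun_src_conv (χ : C(X, ℂ)) (ξ η : CompactSections β N) :
    (mulFun (compSrc χ) ξ).conv η = ξ.conv (mulFun (compTgt χ) η) := by
  ext γ'
  rw [val_conv, val_conv]
  refine integral_congr_ae (Eventually.of_forall fun g => ?_)
  simp only [val_mulFun, map_smul, mul_smul_comm, smul_mul_assoc]
  rfl

end CompactSections

/-- Multiplication by the characteristic functions of `r⁻¹(U)` and of `s⁻¹(U)` is an idempotent
multiplier of `𝒜(𝒢, B)`. -/
theorem exists_idempotentMultiplier (hU : IsClosed (U : Set X)) (𝒜 : ConvolutionProduct β N) :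
    ∃ P : 𝓜(ℂ, 𝒜.Algebra), IsIdempotentMultiplier P ∧ ∀ ξ,
      P.fst (𝒜.ofSection ξ) =
        𝒜.ofSection (CompactSections.mulFun (compTgt (clopenIndicator hU)) ξ) ∧
      P.snd (𝒜.ofSection ξ) =
        𝒜.ofSection (CompactSections.mulFun (compSrc (clopenIndicator hU)) ξ) := by
  set χ := clopenIndicator hU with hχ
  have hex : ∀ φ : C(Arr X, ℂ), (∀ γ, ‖φ γ‖ ≤ 1) → ∃ S : 𝒜.Algebra →L[ℂ] 𝒜.Algebra,
      ∀ ξ, S (𝒜.ofSection ξ) = 𝒜.ofSection (CompactSections.mulFun φ ξ) := fun φ hφ =>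
    𝒜.exists_extension (𝒜.ofSectionₗᵢ.toLinearMap ∘ₗ CompactSections.mulFun φ) fun ξ => by
      change ‖𝒜.ofSection _‖ ≤ _
      rw [𝒜.norm_ofSection]
      exact CompactSections.norm_mulFun_le hφ ξ
  obtain ⟨L, hL⟩ := hex (compTgt χ) fun γ => norm_clopenIndicator_le hU γ.tgt
  obtain ⟨R, hR⟩ := hex (compSrc χ) fun γ => norm_clopenIndicator_le hU γ.src
  have hcentral : ∀ a b, R a * b = a * L b := fun a b =>
    𝒜.denseRange_ofSection.induction_on₂ (p := fun a b => R a * b = a * L b)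
      (isClosed_eq (by fun_prop) (by fun_prop)) (fun ξ η => by
        rw [hL, hR, 𝒜.ofSection_mul, 𝒜.ofSection_mul, CompactSections.mulFun_src_conv]) a b
  have hLL : ∀ a, L (L a) = L a := fun a =>
    𝒜.denseRange_ofSection.induction_on (p := fun a => L (L a) = L a) a
      (isClosed_eq (by fun_prop) (by fun_prop)) fun ξ => by
        rw [hL, hL]
        congr 1
        ext γ
        simp only [CompactSections.val_mulFun, smul_smul]
        exact congrArg (· • ξ.val γ) (clopenIndicator_mul_self hU γ.tgt)
  have hRR : ∀ a, R (R a) = R a := fun a =>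
    𝒜.denseRange_ofSection.induction_on (p := fun a => R (R a) = R a) a
      (isClosed_eq (by fun_prop) (by fun_prop)) fun ξ => by
        rw [hR, hR]
        congr 1
        ext γ
        simp only [CompactSections.val_mulFun, smul_smul]
        exact congrArg (· • ξ.val γ) (clopenIndicator_mul_self hU γ.src)
  have hLmul : ∀ a b, L (a * b) = L a * b := fun a b =>
    𝒜.denseRange_ofSection.induction_on₂ (p := fun a b => L (a * b) = L a * b)
      (isClosed_eq (by fun_prop) (by fun_prop)) (fun ξ η => by
        rw [𝒜.ofSection_mul, hL, hL, 𝒜.ofSection_mul, CompactSections.mulFun_tgt_conv]) a b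
  have hRmul : ∀ a b, R (a * b) = a * R b := fun a b =>
    𝒜.denseRange_ofSection.induction_on₂ (p := fun a b => R (a * b) = a * R b)
      (isClosed_eq (by fun_prop) (by fun_prop)) (fun ξ η => by
        rw [𝒜.ofSection_mul, hR, hR, 𝒜.ofSection_mul, CompactSections.conv_mulFun_src]) a b
  refine ⟨⟨(L, R), hcentral⟩, ⟨?_, hLmul, hRmul⟩, fun ξ => ⟨hL ξ, hR ξ⟩⟩
  refine DoubleCentralizer.ext _ _ _ _ (Prod.ext ?_ ?_)
  · ext a; exact hLL a
  · ext a; exact hRR a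

/-- The image of `𝒜(𝒢_U^U, B|_U)` in `𝒜(𝒢, B)` is the corner `P 𝒜(𝒢, B) P`. -/
theorem range_extensionHom_eq (hU : IsClosed (U : Set X)) {𝒜 : ConvolutionProduct β N}
    {𝒜U : ConvolutionProduct (β.restrict U) (N.restrict U)} {P : 𝓜(ℂ, 𝒜.Algebra)}
    {J : 𝒜U.Algebra →ₙₐ[ℂ] 𝒜.Algebra} (hJ : Isometry J)
    (hJext : ∀ ξ, J (𝒜U.ofSection ξ) = 𝒜.ofSection (ξ.extend hU))
    (hP : ∀ ξ, P.fst (𝒜.ofSection ξ) =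
        𝒜.ofSection (CompactSections.mulFun (compTgt (clopenIndicator hU)) ξ) ∧
      P.snd (𝒜.ofSection ξ) =
        𝒜.ofSection (CompactSections.mulFun (compSrc (clopenIndicator hU)) ξ)) :
    Set.range J = Set.range fun a : 𝒜.Algebra => P.fst (P.snd a) := by
  have hcut : ∀ ζ, P.fst (P.snd (𝒜.ofSection ζ)) = J (𝒜U.ofSection (ζ.restrict hU)) := by
    intro ζ
    rw [(hP _).2, (hP _).1, hJext]
    congr 1
    refine CompactSections.ext_of_incl (fun δ => ?_) (fun γ h => ?_)
      fun γ h => CompactSections.val_extend_eq_zero hU _ h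
    · rw [CompactSections.val_extend_incl, CompactSections.val_restrict,
        CompactSections.val_mulFun, CompactSections.val_mulFun]
      have h1 : compTgt (clopenIndicator hU) δ.incl = 1 :=
        clopenIndicator_of_mem hU δ.tgt.val_mem
      have h2 : compSrc (clopenIndicator hU) δ.incl = 1 :=
        clopenIndicator_of_mem hU δ.src.val_mem
      rw [h1, h2, one_smul, one_smul]
    · rw [CompactSections.val_mulFun, CompactSections.val_mulFun]
      rcases h with h | h
      · have h2 : compSrc (clopenIndicator hU) γ = 0 := clopenIndicator_of_notMem hU h
        rw [h2, zero_smul, smul_zero]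
      · have h2 : compTgt (clopenIndicator hU) γ = 0 := clopenIndicator_of_notMem hU h
        rw [h2, zero_smul]
  refine Set.Subset.antisymm ?_ ?_
  · rintro _ ⟨a, rfl⟩
    refine ⟨J a, ?_⟩
    refine 𝒜U.denseRange_ofSection.induction_on (p := fun a => P.fst (P.snd (J a)) = J a) a
      (isClosed_eq (P.fst.continuous.comp (P.snd.continuous.comp hJ.continuous)) hJ.continuous)
      fun ξ => ?_
    have e : (ξ.extend hU).restrict hU = ξ := CompactSections.ext fun δ => ξ.val_extend_incl hU δ
    rw [hJext, hcut, e, hJext]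
  · rintro _ ⟨a, rfl⟩
    exact 𝒜.denseRange_ofSection.induction_on (p := fun a => P.fst (P.snd a) ∈ Set.range J) a
      (hJ.isClosedEmbedding.isClosed_range.preimage (P.fst.continuous.comp P.snd.continuous))
      fun ξ => ⟨_, (hcut ξ).symm⟩

end Multiplier

/-! ### Fullness of the corner -/

section Fullness

variable {X : Type u} [Groupoid.{v} X] [TopologicalSpace X] [TopologicalSpace (Arr X)]
  {haar : HaarSystem X} {B : X → Type w}
  [∀ x, NonUnitalNormedRing (B x)] [∀ x, NormedSpace ℂ (B x)]
  [∀ x, IsScalarTower ℂ (B x) (B x)] [∀ x, SMulCommClass ℂ (B x) (B x)]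
  [∀ x, CompleteSpace (B x)]
  [TopologicalGroupoid X] [T2Space (Arr X)] [LocallyCompactSpace (Arr X)]
  {β : GBanachAlgebra X B} {N : UnconditionalNorm haar} {U : TopologicalSpace.Opens X}

/-- The composable pair `(γ, γ⁻¹γ')` of a point `(γ', γ)` of the fibre product. -/
def FibreProduct.pair (w : FibreProduct (Arr.tgt : Arr X → X)) : ComposablePair X :=
  ⟨w.pt.src, w.arr.src, w.pt.tgt, w.pt.hom ≫ Groupoid.inv w.arr.hom, w.arr.hom⟩

theorem FibreProduct.continuous_pair :
    Continuous (FibreProduct.pair : FibreProduct (Arr.tgt : Arr X → X) → ComposablePair X) :=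
  continuous_induced_rng.2 ((continuous_arr_div
    (a := fun w : FibreProduct (Arr.tgt : Arr X → X) => w.pt.src)
    (b := fun w => w.arr.src) (c := fun w => w.pt.tgt) (h := fun w => w.pt.hom)
    (k := fun w => w.arr.hom) FibreProduct.continuous_pt FibreProduct.continuous_arr).prodMk
    FibreProduct.continuous_arr)

namespace CompactSections

/-- The convolution product with its integrand multiplied by a function `H(γ, γ⁻¹γ')` of the
composable pair. -/
noncomputable def convWith (ξ η : CompactSections β N) :
    C(ComposablePair X, ℂ) →ₗ[ℂ] CompactSections β N :=
  have hmem : ∀ H : C(ComposablePair X, ℂ),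
      (fun w : FibreProduct (Arr.tgt : Arr X → X) => H w.pair • ξ.convIntegrand η w) ∈
        β.toUscField.pullbackSections fun w : FibreProduct (Arr.tgt : Arr X → X) => w.pt.tgt :=
    fun H => β.toUscField.pullbackSections_smul
      (TopologicalGroupoid.continuous_tgt.comp FibreProduct.continuous_pt)
      (H.continuous.comp FibreProduct.continuous_pair) (ξ.convIntegrand_mem η)
  have hzero : ∀ (H : C(ComposablePair X, ℂ)) (w : FibreProduct (Arr.tgt : Arr X → X)),
      w.arr.toArr ∉ ξ.supp → H w.pair • ξ.convIntegrand η w = 0 := fun H w hw => by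
    rw [ξ.convIntegrand_eq_zero η w hw, smul_zero]
  { toFun := fun H => ofCompact
      (fun γ' => ∫ g : RangeFibre γ'.tgt, H (FibreProduct.pair ⟨γ', g⟩) •
        ξ.convIntegrand η ⟨γ', g⟩ ∂(haar.measure γ'.tgt))
      (β.toUscField.integral_mem_pullbackSections haar TopologicalGroupoid.continuous_tgt
        (hmem H) ξ.isCompact_supp (hzero H))
      (isCompact_mulSet ξ.isCompact_supp η.isCompact_supp) fun γ' h => by
        refine integral_eq_zero_of_ae (Eventually.of_forall fun g => ?_)
        change _ • (_ * _) = (0 : B γ'.tgt)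
        by_cases h1 : g.toArr ∈ ξ.supp
        · have h2 : (⟨γ'.src, g.src, γ'.hom ≫ Groupoid.inv g.hom⟩ : Arr X) ∉ η.supp :=
            fun h2 => h (mem_mulSet h1 h2)
          rw [η.val_eq_zero h2, map_zero, mul_zero, smul_zero]
        · rw [ξ.val_eq_zero h1, zero_mul, smul_zero]
    map_add' := fun H H' => by
      ext γ'
      refine Eq.trans ?_ (integral_add
        (β.toUscField.integrable_slice haar (hmem H) ξ.isCompact_supp (hzero H) γ')
        (β.toUscField.integrable_slice haar (hmem H') ξ.isCompact_supp (hzero H') γ'))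
      exact integral_congr_ae (Eventually.of_forall fun g => add_smul _ _ _)
    map_smul' := fun c H => by
      ext γ'
      refine Eq.trans ?_ (integral_smul c _)
      exact integral_congr_ae (Eventually.of_forall fun g => mul_smul _ _ _) }

theorem val_convWith (ξ η : CompactSections β N) (H : C(ComposablePair X, ℂ)) (γ' : Arr X) :
    (ξ.convWith η H).val γ' = ∫ g : RangeFibre γ'.tgt, H (FibreProduct.pair ⟨γ', g⟩) •
      ξ.convIntegrand η ⟨γ', g⟩ ∂(haar.measure γ'.tgt) := rfl

/-- The set of composable pairs on which the integrand of a convolution can be nonzero. -/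
def suppPairs (ξ η : CompactSections β N) : Set (ComposablePair X) :=
  ComposablePair.toProd ⁻¹' (η.supp ×ˢ ξ.supp)

theorem isCompact_suppPairs (ξ η : CompactSections β N) : IsCompact (ξ.suppPairs η) :=
  ComposablePair.isClosedEmbedding_toProd.isCompact_preimage
    (η.isCompact_supp.prod ξ.isCompact_supp)

theorem norm_convWith_le (ξ η : CompactSections β N) {ψ₁ ψ₂ : C_c(Arr X, ℂ)}
    (h₁ : ∀ γ, (ψ₁ γ).im = 0 ∧ ‖ξ.val γ‖ ≤ (ψ₁ γ).re)
    (h₂ : ∀ γ, (ψ₂ γ).im = 0 ∧ ‖η.val γ‖ ≤ (ψ₂ γ).re) {H : C(ComposablePair X, ℂ)} {ε : ℝ}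
    (hε : 0 ≤ ε) (hH : ∀ q ∈ ξ.suppPairs η, ‖H q‖ ≤ ε) :
    ‖ξ.convWith η H‖ ≤ ε * (N.norm ψ₁ * N.norm ψ₂) := by
  have h : ‖ξ.convWith η H‖ ≤ N.norm ((ε : ℂ) • scalarConv N ψ₁ ψ₂) := by
    refine norm_le_of_dominated fun γ' => ?_
    have key := norm_integral_le_scalarConv N (fun γ => (h₁ γ).1) (fun γ => (h₂ γ).1) γ'
      (E := B γ'.tgt) (ε := ε)
      (G := fun g => H (FibreProduct.pair ⟨γ', g⟩) • ξ.convIntegrand η ⟨γ', g⟩) fun g => by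
        have hpos₁ : 0 ≤ (ψ₁ g.toArr).re := (norm_nonneg _).trans (h₁ _).2
        have hpos₂ : 0 ≤ (ψ₂ ⟨γ'.src, g.src, γ'.hom ≫ Groupoid.inv g.hom⟩).re :=
          (norm_nonneg _).trans (h₂ _).2
        by_cases hg : FibreProduct.pair ⟨γ', g⟩ ∈ ξ.suppPairs η
        · rw [norm_smul]
          refine mul_le_mul (hH _ hg) ?_ (norm_nonneg _) hε
          refine (norm_mul_le _ _).trans ?_
          rw [LinearIsometryEquiv.norm_map]
          exact mul_le_mul (h₁ _).2 (h₂ _).2 (norm_nonneg _) hpos₁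
        · have h0 : ξ.convIntegrand η ⟨γ', g⟩ = 0 := by
            by_cases h1 : g.toArr ∈ ξ.supp
            · have h2 : (⟨γ'.src, g.src, γ'.hom ≫ Groupoid.inv g.hom⟩ : Arr X) ∉ η.supp :=
                fun h2 => hg ⟨h2, h1⟩
              rw [convIntegrand, η.val_eq_zero h2, map_zero, mul_zero]
            · exact ξ.convIntegrand_eq_zero η ⟨γ', g⟩ h1
          rw [h0, smul_zero, norm_zero]
          positivity
    rw [CompactlySupportedContinuousMap.coe_smul, Pi.smul_apply, smul_eq_mul,
      Complex.im_ofReal_mul, Complex.re_ofReal_mul, key.1, mul_zero]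
    exact ⟨rfl, key.2⟩
  refine h.trans ?_
  rw [map_smul_eq_mul, Complex.norm_real, Real.norm_of_nonneg hε]
  exact mul_le_mul_of_nonneg_left (N.submultiplicative _ _ _ fun γ => rfl) hε

/-- The function `(γ, γ'') ↦ u(γ) v(γ'')` on composable pairs. -/
noncomputable def pairTensor (u v : C(Arr X, ℂ)) : C(ComposablePair X, ℂ) :=
  have h : Continuous (ComposablePair.toProd : ComposablePair X → Arr X × Arr X) :=
    continuous_induced_dom
  u.comp ⟨fun q => q.toProd.2, continuous_snd.comp h⟩ *
    v.comp ⟨fun q => q.toProd.1, continuous_fst.comp h⟩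

theorem convWith_pairTensor (ξ η : CompactSections β N) (u v : C(Arr X, ℂ)) :
    ξ.convWith η (pairTensor u v) = (mulFun u ξ).conv (mulFun v η) := by
  ext γ'
  rw [val_convWith, val_conv]
  refine integral_congr_ae (Eventually.of_forall fun g => ?_)
  change (u g.toArr * v ⟨γ'.src, g.src, γ'.hom ≫ Groupoid.inv g.hom⟩) • (_ * _) = _
  simp only [val_mulFun, map_smul, smul_mul_assoc, mul_smul_comm, mul_smul]
  rw [smul_comm]

theorem convWith_comp (ξ η : CompactSections β N) (φ : C(Arr X, ℂ)) :
    ξ.convWith η (φ.comp ⟨ComposablePair.comp, TopologicalGroupoid.continuous_comp⟩) =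
      mulFun φ (ξ.conv η) := by
  ext γ'
  rw [val_convWith, val_mulFun, val_conv, ← integral_smul]
  refine integral_congr_ae (Eventually.of_forall fun g => ?_)
  have h : (FibreProduct.pair ⟨γ', g⟩).comp = γ' := by
    simp [FibreProduct.pair, ComposablePair.comp]
  change φ (FibreProduct.pair ⟨γ', g⟩).comp • _ = _
  rw [h]
  rfl

/-- By the Stone–Weierstrass theorem, functions on composable pairs are approximated on compact
sets by linear combinations of products `u(γ) v(γ'')`. -/
theorem exists_span_pairTensor_approx {K : Set (ComposablePair X)} (hK : IsCompact K)
    (F : C(ComposablePair X, ℂ)) {ε : ℝ} (hε : 0 < ε) :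
    ∃ H ∈ Submodule.span ℂ {H : C(ComposablePair X, ℂ) | ∃ u v, H = pairTensor u v},
      ∀ q ∈ K, ‖F q - H q‖ ≤ ε := by
  have : CompactSpace K := isCompact_iff_compactSpace.1 hK
  let M : Submonoid C(ComposablePair X, ℂ) :=
    { carrier := {H | ∃ u v, H = pairTensor u v}
      one_mem' := ⟨1, 1, by ext q; exact (one_mul _).symm⟩
      mul_mem' := by
        rintro _ _ ⟨u, v, rfl⟩ ⟨u', v', rfl⟩
        exact ⟨u * u', v * v', by ext q; exact mul_mul_mul_comm _ _ _ _⟩ }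
  have hstar : star (M : Set C(ComposablePair X, ℂ)) = M := by
    have hsub : star (M : Set C(ComposablePair X, ℂ)) ⊆ M := by
      rintro H ⟨u, v, h⟩
      refine ⟨star u, star v, ?_⟩
      rw [← star_star H, h]
      ext q
      exact star_mul' _ _
    refine hsub.antisymm fun H hH => hsub ?_
    rw [Set.mem_star, star_star]
    exact hH
  let A : StarSubalgebra ℂ C(ComposablePair X, ℂ) := StarAlgebra.adjoin ℂ M
  have hA : ∀ H ∈ A, H ∈ Submodule.span ℂ (M : Set C(ComposablePair X, ℂ)) := by
    intro H hH
    have h1 : H ∈ Algebra.adjoin ℂ (M : Set C(ComposablePair X, ℂ)) := by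
      have h2 : H ∈ A.toSubalgebra := hH
      rwa [StarAlgebra.adjoin_toSubalgebra, hstar, Set.union_self] at h2
    rw [← Subalgebra.mem_toSubmodule, Algebra.adjoin_eq_span, Submonoid.closure_eq] at h1
    exact h1
  let ρ : C(ComposablePair X, ℂ) →⋆ₐ[ℂ] C(K, ℂ) :=
    ContinuousMap.compStarAlgHom' ℂ ℂ ⟨Subtype.val, continuous_subtype_val⟩
  have hρ : ∀ H (q : K), ρ H q = H q := fun _ _ => rfl
  have hsep : (A.map ρ).SeparatesPoints := by
    intro p q hpq
    have hne : (p : ComposablePair X).toProd ≠ (q : ComposablePair X).toProd := fun h =>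
      hpq (Subtype.ext (ComposablePair.isClosedEmbedding_toProd.injective h))
    have hury : ∀ a b : Arr X, a ≠ b → ∃ f : C(Arr X, ℂ), f a ≠ f b := by
      intro a b hab
      obtain ⟨f, hf1, hf0, -, -⟩ := exists_continuous_one_zero_of_isCompact
        (isCompact_singleton (x := a)) (isClosed_singleton (x := b))
        (Set.disjoint_singleton.2 hab)
      refine ⟨⟨fun γ => (f γ : ℂ), by fun_prop⟩, ?_⟩
      have h1 : f a = 1 := hf1 rfl
      have h0 : f b = 0 := hf0 rfl
      simp [h1, h0]
    have hmem : ∀ u v, ρ (pairTensor u v) ∈ A.map ρ := fun u v =>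
      ⟨_, StarAlgebra.subset_adjoin ℂ _ ⟨u, v, rfl⟩, rfl⟩
    by_cases h2 : (p : ComposablePair X).toProd.2 = (q : ComposablePair X).toProd.2
    · obtain ⟨f, hf⟩ := hury _ _ fun h1 => hne (Prod.ext h1 h2)
      refine ⟨_, ⟨ρ (pairTensor 1 f), hmem 1 f, rfl⟩, fun h => hf ?_⟩
      change 1 * f _ = 1 * f _ at h
      simpa using h
    · obtain ⟨f, hf⟩ := hury _ _ h2
      refine ⟨_, ⟨ρ (pairTensor f 1), hmem f 1, rfl⟩, fun h => hf ?_⟩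
      change f _ * 1 = f _ * 1 at h
      simpa using h
  have htop := ContinuousMap.starSubalgebra_topologicalClosure_eq_top_of_separatesPoints _ hsep
  have hF : ρ F ∈ (A.map ρ).topologicalClosure := htop ▸ StarSubalgebra.mem_top
  obtain ⟨_, ⟨H, hH, rfl⟩, hd⟩ := Metric.mem_closure_iff.1 hF ε hε
  refine ⟨H, hA H hH, fun q hq => ?_⟩
  have h3 := (ContinuousMap.dist_apply_le_dist (f := ρ F) (g := ρ H) ⟨q, hq⟩).trans hd.le
  rw [dist_eq_norm] at h3
  exact h3

variable {S : Submodule ℂ (CompactSections β N)}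

/-- A closed space of sections that contains all convolution products `ξ * η` with `ξ` supported in
`s⁻¹(U)` contains all products of these by continuous functions on the groupoid: the function
`φ(γ γ'')` is approximated by sums of products `u(γ) v(γ'')`, which can be absorbed into the
factors of the convolution. -/
theorem mulFun_conv_mem
    (hclosed : ∀ ζ : CompactSections β N, (∀ ε > 0, ∃ ζ' ∈ S, ‖ζ - ζ'‖ ≤ ε) → ζ ∈ S)
    (hconv : ∀ ξ η : CompactSections β N, (∀ γ : Arr X, γ.src ∉ U → ξ.val γ = 0) → ξ.conv η ∈ S)
    {ξ : CompactSections β N} (hξ : ∀ γ : Arr X, γ.src ∉ U → ξ.val γ = 0)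
    (η : CompactSections β N) (φ : C(Arr X, ℂ)) : mulFun φ (ξ.conv η) ∈ S := by
  refine hclosed _ fun ε hε => ?_
  obtain ⟨ψ₁, h₁⟩ := ξ.exists_dominating
  obtain ⟨ψ₂, h₂⟩ := η.exists_dominating
  have hn : 0 ≤ N.norm ψ₁ * N.norm ψ₂ := mul_nonneg (apply_nonneg _ _) (apply_nonneg _ _)
  obtain ⟨H, hH, hle⟩ := exists_span_pairTensor_approx (ξ.isCompact_suppPairs η)
    (φ.comp ⟨ComposablePair.comp, TopologicalGroupoid.continuous_comp⟩)
    (ε := ε / (N.norm ψ₁ * N.norm ψ₂ + 1)) (by positivity)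
  refine ⟨ξ.convWith η H, ?_, ?_⟩
  · have hspan : Submodule.span ℂ {H : C(ComposablePair X, ℂ) | ∃ u v, H = pairTensor u v} ≤
        S.comap (ξ.convWith η) := by
      refine Submodule.span_le.2 ?_
      rintro _ ⟨u, v, rfl⟩
      change ξ.convWith η (pairTensor u v) ∈ S
      rw [convWith_pairTensor]
      exact hconv _ _ fun γ hγ => by rw [val_mulFun, hξ γ hγ, smul_zero]
    exact hspan hH
  · rw [← convWith_comp, ← map_sub]
    refine (norm_convWith_le ξ η h₁ h₂ (by positivity) hle).trans ?_
    rw [div_mul_eq_mul_div, div_le_iff₀ (by positivity)]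
    nlinarith

/-- The section `γ ↦ f(γ) b(r(γ))`. -/
noncomputable def ofBase (f : C(Arr X, ℝ)) (hf : HasCompactSupport f) {b : ∀ x, B x}
    (hb : b ∈ β.sections) : CompactSections β N :=
  ofCompact (fun γ => (f γ : ℂ) • b γ.tgt)
    (β.toUscField.pullbackSections_smul TopologicalGroupoid.continuous_tgt
      (Complex.continuous_ofReal.comp f.continuous)
      (β.toUscField.pullbackSections_of_sections hb Arr.tgt)) hf fun γ hγ => by
        rw [image_eq_zero_of_notMem_tsupport hγ, Complex.ofReal_zero, zero_smul]

/-- If `ξ` is concentrated near `γ₁`, a multiple of `(ξ * η)(γ₁γ₂)` is close to the product of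
`ξ(γ₁)` and `γ₁(η(γ₂))`. -/
theorem exists_conv_approx {x y z : X} (hz : z ∈ U) (γ₁ : z ⟶ x) (γ₂ : y ⟶ z)
    (hconv : ∀ ξ η : CompactSections β N, (∀ γ : Arr X, γ.src ∉ U → ξ.val γ = 0) → ξ.conv η ∈ S)
    {a d : ∀ x, B x} (ha : a ∈ β.sections) (hd : d ∈ β.sections) {ε : ℝ} (hε : 0 < ε) :
    ∃ m ∈ S, ‖m.val ⟨y, x, γ₂ ≫ γ₁⟩ - a x * β.act γ₁ (d z)‖ ≤ ε := by
  obtain ⟨k, hk1, -, hkc, -⟩ := exists_continuous_one_zero_of_isCompact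
    (isCompact_singleton (x := (⟨y, z, γ₂⟩ : Arr X))) isClosed_empty (Set.disjoint_empty _)
  -- `G` is continuous with value `γ₁ d(z)` at `γ₁`, and `f` is a bump function at `γ₁` on whose
  -- support `G` is nearly constant.
  let η : CompactSections β N := ofBase k hkc hd
  let G : RangeFibre x → B x := fun g =>
    β.act g.hom (η.val ⟨y, g.src, (γ₂ ≫ γ₁) ≫ Groupoid.inv g.hom⟩)
  have hG : Continuous G := by
    refine β.toUscField.continuous_of_pullbackSections_const (x := x) ?_
    refine β.pullbackSections_act (a := fun g : RangeFibre x => g.src)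
      (b := fun _ => x) (h := fun g => g.hom) (RangeFibre.continuous_toArr x) ?_
    exact β.pullbackSections_comp η.val_mem
      (continuous_arr_div (a := fun _ : RangeFibre x => y) (b := fun g => g.src)
      (c := fun _ => x) (h := fun _ => γ₂ ≫ γ₁) (k := fun g => g.hom)
      continuous_const (RangeFibre.continuous_toArr x))
  have hG₁ : G ⟨z, γ₁⟩ = β.act γ₁ (d z) := by
    have e : (γ₂ ≫ γ₁) ≫ Groupoid.inv γ₁ = γ₂ := by simp
    have hk : k ⟨y, z, γ₂⟩ = 1 := hk1 rfl
    change β.act γ₁ ((k ⟨y, z, (γ₂ ≫ γ₁) ≫ Groupoid.inv γ₁⟩ : ℂ) • d z) = _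
    rw [e, hk, Complex.ofReal_one, one_smul]
  set δ := ε / (‖a x‖ + 1) with hδ
  have hδpos : 0 < δ := by positivity
  obtain ⟨O, hO, hOG⟩ := (RangeFibre.isInducing_toArr x).isOpen_iff.1
    (Metric.isOpen_ball.preimage hG (t := Metric.ball (G ⟨z, γ₁⟩) δ))
  have hmem : (⟨z, x, γ₁⟩ : Arr X) ∈ O := by
    have : (⟨z, γ₁⟩ : RangeFibre x) ∈ RangeFibre.toArr ⁻¹' O := by
      rw [hOG]; exact Metric.mem_ball_self hδpos
    exact this
  have hO' : IsOpen (O ∩ Arr.src ⁻¹' (U : Set X)) :=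
    hO.inter (U.isOpen.preimage TopologicalGroupoid.continuous_src)
  obtain ⟨f, hf1, hf0, hfc, hf⟩ := exists_continuous_one_zero_of_isCompact
    (isCompact_singleton (x := (⟨z, x, γ₁⟩ : Arr X))) hO'.isClosed_compl
    (Set.disjoint_compl_right_iff_subset.2 (Set.singleton_subset_iff.2 ⟨hmem, hz⟩))
  let ξ : CompactSections β N := ofBase f hfc ha
  have hξ : ∀ γ : Arr X, γ.src ∉ U → ξ.val γ = 0 := fun γ hγ => by
    have h0 : f γ = 0 := hf0 fun h => hγ h.2
    change (f γ : ℂ) • _ = _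
    rw [h0, Complex.ofReal_zero, zero_smul]
  have hfcont : Continuous fun g : RangeFibre x => f g.toArr :=
    f.continuous.comp (RangeFibre.continuous_toArr x)
  have hfcs : HasCompactSupport fun g : RangeFibre x => f g.toArr :=
    hfc.comp_isClosedEmbedding (RangeFibre.isClosedEmbedding_toArr x)
  have hfint := hfcont.integrable_of_hasCompactSupport (μ := haar.measure x) hfcs
  set c := ∫ g : RangeFibre x, f g.toArr ∂(haar.measure x) with hc
  have hcpos : 0 < c := hfcont.integral_pos_of_hasCompactSupport_nonneg_nonzero hfcs
    (fun g => (hf _).1) (x := ⟨z, γ₁⟩) (by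
      have : f (⟨z, x, γ₁⟩ : Arr X) = 1 := hf1 rfl
      change f (⟨z, x, γ₁⟩ : Arr X) ≠ 0
      rw [this]; exact one_ne_zero)
  let Ξ : RangeFibre x → B x := fun g => ξ.val g.toArr
  refine ⟨(c⁻¹ : ℂ) • ξ.conv η, S.smul_mem _ (hconv ξ η hξ), ?_⟩
  have hcne : (c : ℂ) ≠ 0 := Complex.ofReal_ne_zero.2 hcpos.ne'
  have hval : (ξ.conv η).val ⟨y, x, γ₂ ≫ γ₁⟩ =
      ∫ g : RangeFibre x, Ξ g * G g ∂(haar.measure x) := rfl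
  have hint : Integrable (ε := B x) (fun g : RangeFibre x => Ξ g * G g)
      (haar.measure x) := ξ.integrable_convIntegrand η ⟨y, x, γ₂ ≫ γ₁⟩
  have hconst : ∫ g : RangeFibre x, f g.toArr • (a x * G ⟨z, γ₁⟩) ∂(haar.measure x) =
      (c : ℂ) • (a x * G ⟨z, γ₁⟩) := by
    rw [integral_smul_const, Complex.coe_smul]
  have hdiff : ((c⁻¹ : ℂ) • ξ.conv η).val ⟨y, x, γ₂ ≫ γ₁⟩ - a x * β.act γ₁ (d z) =
      (c⁻¹ : ℂ) • ∫ g : RangeFibre x, (Ξ g * G g - f g.toArr • (a x * G ⟨z, γ₁⟩))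
        ∂(haar.measure x) := by
    rw [integral_sub hint (hfint.smul_const _), hconst, ← hval, smul_sub, smul_smul,
      inv_mul_cancel₀ hcne, one_smul, hG₁]
    rfl
  have hbound : ‖∫ g : RangeFibre x, (Ξ g * G g - f g.toArr • (a x * G ⟨z, γ₁⟩))
      ∂(haar.measure x)‖ ≤ ∫ g : RangeFibre x, ε * f g.toArr ∂(haar.measure x) := by
    refine norm_integral_le_of_norm_le (hfint.const_mul ε) (Eventually.of_forall fun g => ?_)
    have e : Ξ g * G g - f g.toArr • (a x * G ⟨z, γ₁⟩) =
        f g.toArr • (a x * (G g - G ⟨z, γ₁⟩)) := by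
      have h1 : Ξ g = f g.toArr • a x := Complex.coe_smul _ _
      rw [h1, mul_sub, smul_sub, smul_mul_assoc]
    have e' := congrArg norm e
    refine e'.trans_le ?_
    rw [norm_smul, Real.norm_of_nonneg (hf _).1]
    by_cases hg : g.toArr ∈ O
    · have hg' : G g ∈ Metric.ball (G ⟨z, γ₁⟩) δ := by
        have : g ∈ RangeFibre.toArr ⁻¹' O := hg
        rw [hOG] at this; exact this
      rw [mem_ball_iff_norm] at hg'
      have h2 : ‖a x * (G g - G ⟨z, γ₁⟩)‖ ≤ ε := by
        refine (norm_mul_le _ _).trans ?_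
        calc ‖a x‖ * ‖G g - G ⟨z, γ₁⟩‖ ≤ (‖a x‖ + 1) * δ :=
              mul_le_mul (by linarith) hg'.le (norm_nonneg _) (by positivity)
          _ = ε := by rw [hδ]; field_simp
      rw [mul_comm ε]
      exact mul_le_mul_of_nonneg_left h2 (hf _).1
    · have h0 : f g.toArr = 0 := hf0 fun h => hg h.1
      rw [h0, zero_mul, mul_zero]
  rw [hdiff, norm_smul, norm_inv, Complex.norm_real, Real.norm_of_nonneg hcpos.le,
    inv_mul_le_iff₀ hcpos]
  refine hbound.trans ?_
  rw [integral_const_mul, mul_comm]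

/-- If `U` is full and `B` is non-degenerate, the values at any groupoid element of the
convolution products `ξ * η` with `ξ` supported in `s⁻¹(U)` span a dense subspace of the fibre. -/
theorem exists_val_approx (hβ : β.NonDegenerate) (hfull : IsFull (U : Set X))
    (hconv : ∀ ξ η : CompactSections β N, (∀ γ : Arr X, γ.src ∉ U → ξ.val γ = 0) → ξ.conv η ∈ S)
    (γ₀ : Arr X) (b : B γ₀.tgt) {ε : ℝ} (hε : 0 < ε) : ∃ m ∈ S, ‖b - m.val γ₀‖ < ε := by
  obtain ⟨y, x, h⟩ := γ₀
  change B x at b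
  obtain ⟨z, hz, γ₁, γ₂, rfl⟩ := hfull h
  let ev : CompactSections β N →ₗ[ℂ] B x :=
    { toFun := fun m => m.val ⟨y, x, γ₂ ≫ γ₁⟩
      map_add' := fun _ _ => rfl
      map_smul' := fun _ _ => rfl }
  let V : Submodule ℂ (B x) := S.map ev
  have hda : DenseRange fun a : β.sections => a.1 x := by
    refine (β.dense_eval x).mono ?_
    rintro e ⟨ξ, hξ, rfl⟩
    exact ⟨⟨ξ, hξ⟩, rfl⟩
  have hdd : DenseRange fun d : β.sections => β.act γ₁ (d.1 z) := by
    have hdz : DenseRange fun d : β.sections => d.1 z := by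
      refine (β.dense_eval z).mono ?_
      rintro e ⟨ξ, hξ, rfl⟩
      exact ⟨⟨ξ, hξ⟩, rfl⟩
    exact (β.act γ₁).surjective.denseRange.comp hdz (β.act γ₁).continuous
  have hprod : ∀ a c : B x, a * c ∈ V.topologicalClosure := by
    intro a c
    have hcl : IsClosed {q : B x × B x | q.1 * q.2 ∈ V.topologicalClosure} :=
      V.isClosed_topologicalClosure.preimage (by fun_prop)
    have := (hda.prodMap hdd).induction_on (p := fun q : B x × B x =>
      q.1 * q.2 ∈ V.topologicalClosure) (a, c) hcl fun q => by
        refine Metric.mem_closure_iff.2 fun ε hε => ?_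
        obtain ⟨m, hm, hle⟩ := exists_conv_approx hz γ₁ γ₂ hconv q.1.2 q.2.2 (half_pos hε)
        refine ⟨_, ⟨m, hm, rfl⟩, ?_⟩
        rw [dist_comm, dist_eq_norm]
        exact lt_of_le_of_lt hle (half_lt_self hε)
    exact this
  have hspan : Submodule.span ℂ {c : B x | ∃ a b : B x, a * b = c} ≤ V.topologicalClosure := by
    refine Submodule.span_le.2 ?_
    rintro _ ⟨a, c, rfl⟩
    exact hprod a c
  have hb : b ∈ V.topologicalClosure :=
    closure_minimal hspan V.isClosed_topologicalClosure (hβ x b)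
  obtain ⟨_, ⟨m, hm, rfl⟩, hd⟩ := Metric.mem_closure_iff.1 hb ε hε
  rw [dist_eq_norm] at hd
  exact ⟨m, hm, hd⟩

/-- The convolution products `ξ * η` with `ξ` supported in `s⁻¹(U)` span a dense subspace: the
closure of their span is a module over the continuous functions on the groupoid whose values are
dense in each fibre, so that a partition of unity yields approximations of arbitrary sections. -/
theorem mem_of_conv_mem (hβ : β.NonDegenerate) (hfull : IsFull (U : Set X))
    (hclosed : ∀ ζ : CompactSections β N, (∀ ε > 0, ∃ ζ' ∈ S, ‖ζ - ζ'‖ ≤ ε) → ζ ∈ S)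
    (hconv : ∀ ξ η : CompactSections β N, (∀ γ : Arr X, γ.src ∉ U → ξ.val γ = 0) → ξ.conv η ∈ S)
    (ζ : CompactSections β N) : ζ ∈ S := by
  refine hclosed ζ fun ε hε => ?_
  -- `S'` is the largest module over the continuous functions on the groupoid inside `S`.
  let S' : Submodule ℂ (CompactSections β N) := ⨅ φ : C(Arr X, ℂ), S.comap (mulFun φ)
  have hS' : ∀ m, m ∈ S' ↔ ∀ φ : C(Arr X, ℂ), mulFun φ m ∈ S := fun m => by
    simp [S', Submodule.mem_iInf]
  have hconv' : ∀ ξ η : CompactSections β N, (∀ γ : Arr X, γ.src ∉ U → ξ.val γ = 0) →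
      ξ.conv η ∈ S' := fun ξ η hξ => (hS' _).2 fun φ => mulFun_conv_mem hclosed hconv hξ η φ
  obtain ⟨χ, hχ1, -, hχc, hχ⟩ := exists_continuous_one_zero_of_isCompact ζ.isCompact_supp
    isClosed_empty (Set.disjoint_empty _)
  let χ' : C_c(Arr X, ℂ) := ⟨⟨fun γ => (χ γ : ℂ), by fun_prop⟩, hχc.comp_left Complex.ofReal_zero⟩
  have hn : 0 ≤ N.norm χ' := apply_nonneg _ _
  -- A section dominated by `δ * χ` has norm at most `ε`.
  set δ := ε / (N.norm χ' + 1) with hδ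
  have hδpos : 0 < δ := by positivity
  choose m hm hmδ using fun γ₀ : Arr X => exists_val_approx hβ hfull hconv' γ₀ (ζ.val γ₀) hδpos
  have hopen : ∀ γ₀, IsOpen {γ | ‖ζ.val γ - (m γ₀).val γ‖ < δ} := fun γ₀ =>
    ((β.toUscField.pullback Arr.tgt TopologicalGroupoid.continuous_tgt).upperSemicontinuous_norm _
      (ζ - m γ₀).val_mem).isOpen_preimage δ
  obtain ⟨t, ht⟩ := ζ.isCompact_supp.elim_finite_subcover _ hopen
    fun γ _ => Set.mem_iUnion.2 ⟨γ, hmδ γ⟩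
  obtain ⟨ρ, hρV, -⟩ := PartitionOfUnity.exists_isSubordinate_of_locallyFinite_t2space
    ζ.isCompact_supp (fun i : t => {γ | ‖ζ.val γ - (m i).val γ‖ < δ}) (fun i => hopen i)
    (locallyFinite_of_finite _) (by rw [Set.iUnion_subtype]; exact ht)
  have hρ1 : ∀ γ ∈ ζ.supp, ∑ i, ρ i γ = 1 := fun γ hγ => by
    rw [← finsum_eq_sum_of_fintype]; exact ρ.sum_eq_one hγ
  have hρle : ∀ γ, ∑ i, ρ i γ ≤ 1 := fun γ => by
    rw [← finsum_eq_sum_of_fintype]; exact ρ.sum_le_one γ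
  have hρV' : ∀ (i : t) γ, ¬ ‖ζ.val γ - (m i).val γ‖ < δ → ρ i γ = 0 := fun i γ hγ =>
    image_eq_zero_of_notMem_tsupport fun h => hγ (hρV i h)
  let w : t → C(Arr X, ℂ) := fun i => ⟨fun γ => ((χ γ * ρ i γ : ℝ) : ℂ), by fun_prop⟩
  have hw : ∀ i γ, w i γ = ((χ γ * ρ i γ : ℝ) : ℂ) := fun _ _ => rfl
  refine ⟨∑ i, mulFun (w i) (m i), S.sum_mem fun i _ => (hS' _).1 (hm i) _, ?_⟩
  have hle : ‖ζ - ∑ i, mulFun (w i) (m i)‖ ≤ N.norm ((δ : ℂ) • χ') := by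
    refine norm_le_of_dominated fun γ => ?_
    rw [CompactlySupportedContinuousMap.coe_smul, Pi.smul_apply, smul_eq_mul,
      Complex.im_ofReal_mul, Complex.re_ofReal_mul]
    change δ * ((χ γ : ℝ) : ℂ).im = 0 ∧ _ ≤ δ * ((χ γ : ℝ) : ℂ).re
    rw [Complex.ofReal_im, Complex.ofReal_re]
    refine ⟨mul_zero _, ?_⟩
    have e : ζ.val γ = ∑ i, w i γ • ζ.val γ := by
      rw [← Finset.sum_smul]
      by_cases hγ : γ ∈ ζ.supp
      · have h3 : χ γ = 1 := hχ1 hγ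
        simp only [hw, h3, one_mul]
        rw [← Complex.ofReal_sum, hρ1 γ hγ, Complex.ofReal_one, one_smul]
      · rw [ζ.val_eq_zero hγ, smul_zero]
    have e2 : (ζ - ∑ i, mulFun (w i) (m i)).val γ =
        ∑ i, w i γ • (ζ.val γ - (m i).val γ) := by
      simp only [smul_sub, Finset.sum_sub_distrib]
      rw [← e, val_sub, val_sum]
      rfl
    rw [e2]
    refine (norm_sum_le _ _).trans ?_
    have h3 : ∀ i ∈ Finset.univ, ‖w i γ • (ζ.val γ - (m i).val γ)‖ ≤ δ * χ γ * ρ i γ := by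
      intro i _
      rw [norm_smul, hw, Complex.norm_real, Real.norm_of_nonneg
        (mul_nonneg (hχ _).1 (ρ.nonneg i _))]
      by_cases hg : ‖ζ.val γ - (m i).val γ‖ < δ
      · have := mul_le_mul_of_nonneg_left hg.le (mul_nonneg (hχ γ).1 (ρ.nonneg i γ))
        linarith
      · simp [hρV' i _ hg]
    refine (Finset.sum_le_sum h3).trans ?_
    rw [← Finset.mul_sum]
    exact mul_le_of_le_one_right (mul_nonneg hδpos.le (hχ _).1) (hρle _)
  refine hle.trans ?_
  rw [map_smul_eq_mul, Complex.norm_real, Real.norm_of_nonneg hδpos.le, hδ, div_mul_eq_mul_div,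
    div_le_iff₀ (by positivity)]
  nlinarith

end CompactSections

/-- The corner defined by an open, closed and full subset of the unit space is full. -/
theorem dense_span_corner (hβ : β.NonDegenerate) (hU : IsClosed (U : Set X))
    (hfull : IsFull (U : Set X)) {𝒜 : ConvolutionProduct β N} {P : 𝓜(ℂ, 𝒜.Algebra)}
    (hP : ∀ ξ, P.snd (𝒜.ofSection ξ) =
        𝒜.ofSection (CompactSections.mulFun (compSrc (clopenIndicator hU)) ξ)) :
    Dense (Submodule.span ℂ {c : 𝒜.Algebra | ∃ a b : 𝒜.Algebra, P.snd a * b = c} :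
        Set 𝒜.Algebra) := by
  set D := (Submodule.span ℂ {c : 𝒜.Algebra | ∃ a b : 𝒜.Algebra, P.snd a * b = c}) with hD
  let S : Submodule ℂ (CompactSections β N) :=
    D.topologicalClosure.comap 𝒜.ofSectionₗᵢ.toLinearMap
  have hS : ∀ ζ, ζ ∈ S ↔ 𝒜.ofSection ζ ∈ closure (D : Set 𝒜.Algebra) := fun ζ => Iff.rfl
  have hmem : ∀ ζ : CompactSections β N, ζ ∈ S := by
    refine CompactSections.mem_of_conv_mem hβ hfull (fun ζ h => ?_) fun ξ η hξ => ?_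
    · rw [hS, ← closure_closure, Metric.mem_closure_iff]
      intro ε hε
      obtain ⟨ζ', hζ', hle⟩ := h (ε / 2) (half_pos hε)
      refine ⟨𝒜.ofSection ζ', hζ', ?_⟩
      have h1 : 𝒜.ofSection ζ - 𝒜.ofSection ζ' = 𝒜.ofSection (ζ - ζ') :=
        (map_sub 𝒜.ofSectionₗᵢ ζ ζ').symm
      rw [dist_eq_norm, h1, 𝒜.norm_ofSection]
      exact lt_of_le_of_lt hle (half_lt_self hε)
    · rw [hS]
      refine subset_closure (Submodule.subset_span ⟨𝒜.ofSection ξ, 𝒜.ofSection η, ?_⟩)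
      have e : CompactSections.mulFun (compSrc (clopenIndicator hU)) ξ = ξ := by
        ext γ
        rw [CompactSections.val_mulFun]
        by_cases hγ : γ.src ∈ U
        · have h1 : compSrc (clopenIndicator hU) γ = 1 := clopenIndicator_of_mem hU hγ
          rw [h1, one_smul]
        · rw [hξ γ hγ, smul_zero]
      rw [hP, e, 𝒜.ofSection_mul]
  have hcl : ∀ a, a ∈ closure (D : Set 𝒜.Algebra) := fun a =>
    𝒜.denseRange_ofSection.induction_on (p := fun a => a ∈ closure (D : Set 𝒜.Algebra)) a
      isClosed_closure fun ζ => hmem ζ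
  exact hcl

end Fullness

/-! ### Full corners are Morita equivalent to the ambient algebra -/

section Corner

variable {A A' : Type u} [NonUnitalNormedRing A] [NormedSpace ℂ A] [IsScalarTower ℂ A A]
  [SMulCommClass ℂ A A] [NonUnitalNormedRing A'] [NormedSpace ℂ A'] {P : 𝓜(ℂ, A)}

namespace IsIdempotentMultiplier

theorem fst_fst (hP : IsIdempotentMultiplier P) (a : A) : P.fst (P.fst a) = P.fst a :=
  DFunLike.congr_fun (congrArg (fun Q : 𝓜(ℂ, A) => Q.fst) hP.idempotent) a

theorem snd_snd (hP : IsIdempotentMultiplier P) (a : A) : P.snd (P.snd a) = P.snd a :=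
  DFunLike.congr_fun (congrArg (fun Q : 𝓜(ℂ, A) => Q.snd) hP.idempotent) a

/-- The two components of a multiplier of a Banach algebra commute if the products `(aP)b` are
total; in general, associativity only gives this on products. -/
theorem fst_snd_comm (hP : IsIdempotentMultiplier P)
    (hd : Dense (Submodule.span ℂ {c : A | ∃ a b : A, P.snd a * b = c} : Set A)) (a : A) :
    P.fst (P.snd a) = P.snd (P.fst a) := by
  have h : P.fst ∘L P.snd = P.snd ∘L P.fst := by
    refine ContinuousLinearMap.ext_on hd ?_
    rintro _ ⟨a, b, rfl⟩
    change P.fst (P.snd (P.snd a * b)) = P.snd (P.fst (P.snd a * b))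
    rw [hP.snd_mul, hP.fst_mul, hP.fst_mul, hP.snd_mul]
  exact DFunLike.congr_fun h a

end IsIdempotentMultiplier

/-- The subspace `P A`. -/
noncomputable def rowSpace (P : 𝓜(ℂ, A)) : Submodule ℂ A := (P.fst - ContinuousLinearMap.id ℂ A).ker

/-- The subspace `A P`. -/
noncomputable def columnSpace (P : 𝓜(ℂ, A)) : Submodule ℂ A := (P.snd - ContinuousLinearMap.id ℂ A).ker

theorem mem_rowSpace {a : A} : a ∈ rowSpace P ↔ P.fst a = a := sub_eq_zero

theorem mem_columnSpace {a : A} : a ∈ columnSpace P ↔ P.snd a = a := sub_eq_zero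

theorem isClosed_rowSpace (P : 𝓜(ℂ, A)) : IsClosed (rowSpace P : Set A) :=
  ContinuousLinearMap.isClosed_ker _

theorem isClosed_columnSpace (P : 𝓜(ℂ, A)) : IsClosed (columnSpace P : Set A) :=
  ContinuousLinearMap.isClosed_ker _

/-- A contractive bilinear map as a continuous bilinear map. -/
noncomputable def contractiveBilinear {E F G : Type*} [NormedAddCommGroup E] [NormedSpace ℂ E]
    [NormedAddCommGroup F] [NormedSpace ℂ F] [NormedAddCommGroup G] [NormedSpace ℂ G]
    (f : E → F → G) (h₁ : ∀ x x' y, f (x + x') y = f x y + f x' y)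
    (h₂ : ∀ (c : ℂ) x y, f (c • x) y = c • f x y) (h₃ : ∀ x y y', f x (y + y') = f x y + f x y')
    (h₄ : ∀ (c : ℂ) x y, f x (c • y) = c • f x y) (h : ∀ x y, ‖f x y‖ ≤ ‖x‖ * ‖y‖) :
    E →L[ℂ] F →L[ℂ] G :=
  (LinearMap.mk₂ ℂ f h₁ h₂ h₃ h₄).mkContinuous₂ 1 fun x y => by rw [one_mul]; exact h x y

/-- If `C = P A P` is a full corner, then `P A` and `A P` form a Morita equivalence between `C`
and `A`. -/
theorem moritaEquivalent_of_fullCorner [CompleteSpace A] (hP : IsIdempotentMultiplier P)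
    {J : A' →ₙₐ[ℂ] A} (hJ : Isometry J)
    (hrange : Set.range J = Set.range fun a : A => P.fst (P.snd a))
    (hd : Dense (Submodule.span ℂ {c : A | ∃ a b : A, P.snd a * b = c} : Set A)) :
    MoritaEquivalent A' A := by
  have hcomm := hP.fst_snd_comm hd
  have hnorm : ∀ x, ‖J x‖ = ‖x‖ := fun x => by
    have := hJ.dist_eq x 0
    rwa [map_zero, dist_zero_right, dist_zero_right] at this
  have hpJ : ∀ x, P.fst (J x) = J x := fun x => by
    obtain ⟨a, ha⟩ : J x ∈ Set.range fun a : A => P.fst (P.snd a) := hrange ▸ ⟨x, rfl⟩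
    rw [← ha]; exact hP.fst_fst _
  have hqJ : ∀ x, P.snd (J x) = J x := fun x => by
    obtain ⟨a, ha⟩ : J x ∈ Set.range fun a : A => P.fst (P.snd a) := hrange ▸ ⟨x, rfl⟩
    rw [← ha]
    change P.snd (P.fst (P.snd a)) = P.fst (P.snd a)
    rw [← hcomm, hP.snd_snd]
  have hex : ∀ a, P.fst a = a → P.snd a = a → ∃ x, J x = a := fun a h1 h2 => by
    have : a ∈ Set.range J := hrange ▸ ⟨a, by change P.fst (P.snd a) = a; rw [h2, h1]⟩
    exact this
  have hinj := hJ.injective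
  have hleft : ∀ x (a : A), ‖J x * a‖ ≤ ‖x‖ * ‖a‖ := fun x a => hnorm x ▸ norm_mul_le (J x) a
  have hright : ∀ (a : A) x, ‖a * J x‖ ≤ ‖a‖ * ‖x‖ := fun a x => hnorm x ▸ norm_mul_le a (J x)
  let R := rowSpace P
  let L := columnSpace P
  have hR : ∀ r : R, P.fst (r : A) = r := fun r => mem_rowSpace.1 r.2
  have hL : ∀ l : L, P.snd (l : A) = l := fun l => mem_columnSpace.1 l.2
  have hJRL : ∀ (r : R) (l : L), ∃ x, J x = (r : A) * (l : A) := fun r l =>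
    hex _ (by rw [hP.fst_mul, hR]) (by rw [hP.snd_mul, hL])
  choose prod hprod using hJRL
  let p : A → R := fun a => ⟨P.fst a, mem_rowSpace.2 (hP.fst_fst a)⟩
  let q : A → L := fun a => ⟨P.snd a, mem_columnSpace.2 (hP.snd_snd a)⟩
  -- A continuous linear map with dense range maps the total set of all `(aP)b` to a total set.
  have hdense : ∀ {E : Type u} [NormedAddCommGroup E] [NormedSpace ℂ E] (T : A →ₗ[ℂ] E)
      (_ : Continuous T) (_ : Function.Surjective T) (s : Set E)
      (_ : ∀ a b, T (P.snd a * b) ∈ s), Dense (Submodule.span ℂ s : Set E) := by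
    intro E _ _ T hTc hTs s h
    refine (hTs.denseRange.dense_image hTc hd).mono ?_
    have : Submodule.span ℂ {c : A | ∃ a b : A, P.snd a * b = c} ≤
        (Submodule.span ℂ s).comap T := by
      refine Submodule.span_le.2 ?_
      rintro _ ⟨a, b, rfl⟩
      exact Submodule.subset_span (h a b)
    rintro _ ⟨c, hc, rfl⟩
    exact this hc
  let pₗ : A →ₗ[ℂ] R :=
    { toFun := p
      map_add' := fun a b => Subtype.ext (map_add P.fst a b)
      map_smul' := fun c a => Subtype.ext (map_smul P.fst c a) }
  let qₗ : A →ₗ[ℂ] L :=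
    { toFun := q
      map_add' := fun a b => Subtype.ext (map_add P.snd a b)
      map_smul' := fun c a => Subtype.ext (map_smul P.snd c a) }
  have hpc : Continuous pₗ := P.fst.continuous.subtype_mk _
  have hqc : Continuous qₗ := P.snd.continuous.subtype_mk _
  have hps : Function.Surjective pₗ := fun r => ⟨r, Subtype.ext (hR r)⟩
  have hqs : Function.Surjective qₗ := fun l => ⟨l, Subtype.ext (hL l)⟩
  -- `cut a` is the preimage of `P a P` under `J`.
  choose cut hcut using fun a : A =>
    hex (P.fst (P.snd a)) (hP.fst_fst _) (by rw [← hcomm, hP.snd_snd])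
  let cutₗ : A →ₗ[ℂ] A' :=
    { toFun := cut
      map_add' := fun a b => hinj (by simp only [hcut, map_add])
      map_smul' := fun c a => hinj (by simp only [hcut, map_smul, RingHom.id_apply]) }
  have hcc : Continuous cutₗ := hJ.isEmbedding.continuous_iff.2
    ((P.fst.continuous.comp P.snd.continuous).congr fun a => (hcut a).symm)
  have hcs : Function.Surjective cutₗ := fun x => ⟨J x, hinj (by
    change J (cut (J x)) = J x
    rw [hcut, hqJ, hpJ])⟩
  refine ⟨L, R, inferInstance, inferInstance, (isClosed_columnSpace P).completeSpace_coe,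
    inferInstance, inferInstance, (isClosed_rowSpace P).completeSpace_coe, ⟨?_⟩⟩
  exact
    { aR := contractiveBilinear
        (fun x r => ⟨J x * r, mem_rowSpace.2 (by rw [hP.fst_mul, hpJ])⟩)
        (fun x x' r => Subtype.ext (by
          change J (x + x') * _ = J x * _ + J x' * _; rw [map_add, add_mul]))
        (fun c x r => Subtype.ext (by
          change J (c • x) * _ = c • (J x * _); rw [map_smul, smul_mul_assoc]))
        (fun x r r' => Subtype.ext (mul_add _ _ _))
        (fun c x r => Subtype.ext (mul_smul_comm _ _ _))
        (fun x r => hleft x r)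
      rB := contractiveBilinear
        (fun r b => ⟨r * b, mem_rowSpace.2 (by rw [hP.fst_mul, hR])⟩)
        (fun r r' b => Subtype.ext (add_mul _ _ _))
        (fun c r b => Subtype.ext (smul_mul_assoc _ _ _))
        (fun r b b' => Subtype.ext (mul_add _ _ _))
        (fun c r b => Subtype.ext (mul_smul_comm _ _ _))
        (fun r b => norm_mul_le (r : A) b)
      bL := contractiveBilinear
        (fun b l => ⟨b * l, mem_columnSpace.2 (by rw [hP.snd_mul, hL])⟩)
        (fun b b' l => Subtype.ext (add_mul _ _ _))
        (fun c b l => Subtype.ext (smul_mul_assoc _ _ _))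
        (fun b l l' => Subtype.ext (mul_add _ _ _))
        (fun c b l => Subtype.ext (mul_smul_comm _ _ _))
        (fun b l => norm_mul_le b (l : A))
      lA := contractiveBilinear
        (fun l x => ⟨l * J x, mem_columnSpace.2 (by rw [hP.snd_mul, hqJ])⟩)
        (fun l l' x => Subtype.ext (add_mul _ _ _))
        (fun c l x => Subtype.ext (smul_mul_assoc _ _ _))
        (fun l x x' => Subtype.ext (by
          change _ * J (x + x') = _ * J x + _ * J x'; rw [map_add, mul_add]))
        (fun c l x => Subtype.ext (by
          change _ * J (c • x) = c • (_ * J x); rw [map_smul, mul_smul_comm]))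
        (fun l x => hright l x)
      rL := contractiveBilinear prod
        (fun r r' l => hinj (by rw [map_add, hprod, hprod, hprod]; exact add_mul _ _ _))
        (fun c r l => hinj (by rw [map_smul, hprod, hprod]; exact smul_mul_assoc _ _ _))
        (fun r l l' => hinj (by rw [map_add, hprod, hprod, hprod]; exact mul_add _ _ _))
        (fun c r l => hinj (by rw [map_smul, hprod, hprod]; exact mul_smul_comm _ _ _))
        (fun r l => by rw [← hnorm, hprod]; exact norm_mul_le (r : A) (l : A))
      lR := contractiveBilinear (fun l r => (l : A) * (r : A))
        (fun l l' r => add_mul _ _ _)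
        (fun c l r => smul_mul_assoc _ _ _)
        (fun l r r' => mul_add _ _ _)
        (fun c l r => mul_smul_comm _ _ _)
        (fun l r => norm_mul_le (l : A) (r : A))
      norm_aR := fun x r => hleft x r
      norm_rB := fun r b => norm_mul_le (r : A) b
      norm_bL := fun b l => norm_mul_le b (l : A)
      norm_lA := fun l x => hright l x
      norm_rL := fun r l => by
        change ‖prod r l‖ ≤ _
        rw [← hnorm, hprod]; exact norm_mul_le (r : A) (l : A)
      norm_lR := fun l r => norm_mul_le (l : A) (r : A)
      assoc_aaR := fun x x' r => Subtype.ext (by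
        change J (x * x') * (r : A) = J x * (J x' * r)
        rw [map_mul, mul_assoc])
      assoc_aRb := fun x r b => Subtype.ext (mul_assoc (J x) (r : A) b)
      assoc_rBb := fun r b b' => Subtype.ext (mul_assoc (r : A) b b')
      assoc_bbL := fun b b' l => Subtype.ext (mul_assoc b b' (l : A))
      assoc_bLa := fun b l x => Subtype.ext (mul_assoc b (l : A) (J x))
      assoc_lAa := fun l x x' => Subtype.ext (by
        change (l : A) * J x * J x' = l * J (x * x')
        rw [map_mul, mul_assoc])
      assoc_aRL := fun x r l => hinj (by
        refine (hprod _ l).trans ((mul_assoc (J x) (r : A) (l : A)).trans ?_)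
        change _ = J (x * prod r l)
        rw [map_mul, hprod])
      assoc_rLa := fun r l x => hinj (by
        change J (prod r l * x) = J (prod r ⟨l * J x, _⟩)
        rw [hprod, map_mul, hprod]; exact mul_assoc _ _ _)
      assoc_rBL := fun r b l => hinj (by
        change J (prod ⟨r * b, _⟩ l) = J (prod r ⟨b * l, _⟩)
        rw [hprod, hprod]; exact mul_assoc _ _ _)
      assoc_bLR := fun b l r => mul_assoc b (l : A) (r : A)
      assoc_lRb := fun l r b => mul_assoc (l : A) (r : A) b
      assoc_lAR := fun l x r => mul_assoc (l : A) (J x) (r : A)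
      assoc_rLR := fun r l r' => Subtype.ext (by
        change J (prod r l) * (r' : A) = r * (l * r')
        rw [hprod, mul_assoc])
      assoc_lRL := fun l r l' => Subtype.ext (by
        change (l : A) * r * l' = l * J (prod r l')
        rw [hprod, mul_assoc])
      dense_aR := hdense pₗ hpc hps _ fun a b => ⟨cut a, p b, Subtype.ext (by
        change J (cut a) * P.fst b = P.fst (P.snd a * b)
        rw [← P.central, hqJ, hcut, hP.fst_mul])⟩
      dense_rB := hdense pₗ hpc hps _ fun a b => ⟨p (P.snd a), b, Subtype.ext (by
        change P.fst (P.snd a) * b = P.fst (P.snd a * b)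
        rw [hP.fst_mul])⟩
      dense_bL := hdense qₗ hqc hqs _ fun a b => ⟨P.snd a, q b, Subtype.ext (by
        change P.snd a * P.snd b = P.snd (P.snd a * b)
        rw [hP.snd_mul])⟩
      dense_lA := hdense qₗ hqc hqs _ fun a b => ⟨q a, cut b, Subtype.ext (by
        change P.snd a * J (cut b) = P.snd (P.snd a * b)
        rw [hcut, ← P.central, hP.snd_snd, hP.snd_mul])⟩
      dense_rL := hdense cutₗ hcc hcs _ fun a b => ⟨p (P.snd a), q b, hinj (by
        change J (prod (p (P.snd a)) (q b)) = J (cut (P.snd a * b))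
        rw [hprod, hcut, hP.snd_mul, hP.fst_mul])⟩
      dense_lR := hdense LinearMap.id continuous_id Function.surjective_id _
        fun a b => ⟨q a, p b, by
          change P.snd a * P.fst b = P.snd a * b
          rw [← P.central, hP.snd_snd]⟩ }

end Corner

end GroupoidDescent

theorem mainTheorem11
    {X : Type u} [Groupoid.{v} X] [TopologicalSpace X] [TopologicalSpace (Arr X)]
    [TopologicalGroupoid X] [T2Space (Arr X)]
    [LocallyCompactSpace (Arr X)]
    (haar : HaarSystem X) (N : UnconditionalNorm haar)
    {B : X → Type w} [∀ x, NonUnitalNormedRing (B x)] [∀ x, NormedSpace ℂ (B x)]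
    [∀ x, IsScalarTower ℂ (B x) (B x)] [∀ x, SMulCommClass ℂ (B x) (B x)]
    [∀ x, CompleteSpace (B x)]
    (β : GBanachAlgebra X B) (hβ : β.NonDegenerate)
    (U : TopologicalSpace.Opens X) (hU : IsClosed (U : Set X))
    (hfull : IsFull (U : Set X)) :
    ∃ (𝒜 : ConvolutionProduct β N)
      (𝒜U : ConvolutionProduct (β.restrict U) (N.restrict U))
      (P : 𝓜(ℂ, 𝒜.Algebra)) (J : 𝒜U.Algebra →ₙₐ[ℂ] 𝒜.Algebra),
      Isometry J ∧
      (∀ ξ : CompactSections (β.restrict U) (N.restrict U),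
        ∃ ξ' : CompactSections β N,
          IsExtensionByZero ξ ξ' ∧ J (𝒜U.ofSection ξ) = 𝒜.ofSection ξ') ∧
      IsIdempotentMultiplier P ∧
      Set.range J = Set.range (fun a : 𝒜.Algebra => P.fst (P.snd a)) ∧
      Dense (Submodule.span ℂ {c : 𝒜.Algebra | ∃ a b : 𝒜.Algebra, P.snd a * b = c} :
        Set 𝒜.Algebra) ∧
      MoritaEquivalent 𝒜U.Algebra 𝒜.Algebra := by
  obtain ⟨𝒜⟩ := nonempty_convolutionProduct β N
  obtain ⟨𝒜U⟩ := nonempty_convolutionProduct (β.restrict U) (N.restrict U)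
  obtain ⟨P, hP, hPval⟩ := exists_idempotentMultiplier hU 𝒜
  obtain ⟨J, hJ, hJext⟩ := exists_extensionHom hU 𝒜 𝒜U
  have hrange := range_extensionHom_eq hU hJ hJext hPval
  have hdense := dense_span_corner hβ hU hfull fun ξ => (hPval ξ).2
  exact ⟨𝒜, 𝒜U, P, J, hJ, fun ξ => ⟨ξ.extend hU, ξ.isExtensionByZero_extend hU, hJext ξ⟩, hP,
    hrange, hdense, moritaEquivalent_of_fullCorner hP hJ hrange hdense⟩
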